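/- Let $d\in\mathbb N$ and let $\mathrm P(\mathbb C^d)$ be the projective space, with the metric $d(\hat x,\hat y)=\sqrt{1-|\langle x,y\rangle|^2}=\|\pi_{\hat x}-\pi_{\hat y}\|$ (where $x,y$ are norm one representatives and $\pi_{\hat x}$ is the orthogonal projector onto $\mathbb Cx$) and its Borel $\sigma$-algebra. Let $\mu$ be a $\sigma$-finite Borel measure on $M_d(\mathbb C)$ such that $$\int\|v\|^2\,d\mu(v)<\infty,\qquad \int v^*v\,d\mu(v)=\mathrm{Id}.$$ For $vx\neq0$ let $v\cdot\hat x$ be the class of $vx$ (if $vx=0$, put $v\cdot\hat x=\hat x$), and let $\Pi$ be the Markov kernel $$\Pi(\hat x,S)=\int \mathbf 1_S(v\cdot\hat x)\,\|vx\|^2\,d\mu(v),$$ acting on functions by $\Pi f(\hat x)=\int f(\hat y)\,\Pi(\hat x,d\hat y)$. Let $\Omega=M_d(\mathbb C)^{\mathbb N}$ with elements $\omega=(v_1,v_2,\dots)$, let $W_n=v_n\cdots v_1$ and $\hat x_n=W_n\cdot\hat x$, and let $\mathcal J_n$ be the $\sigma$-algebra on $\mathrm P(\mathbb C^d)\times\Omega$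 generated by $(\hat x,v_1,\dots,v_n)$. For a probability measure $\nu$ on $\mathrm P(\mathbb C^d)$ let $\mathbb P_\nu$ be the probability measure on $\mathrm P(\mathbb C^d)\times\Omega$ determined by $$\mathbb P_\nu\big(\hat x\in S,\ (v_1,\dots,v_n)\in A\big)=\int_{S\times A}\|v_n\cdots v_1x\|^2\,d\nu(\hat x)\,d\mu^{\otimes n}(v_1,\dots,v_n)$$ for all $n\in\mathbb N$ and all measurable $S\subset\mathrm P(\mathbb C^d)$ and $A\subset M_d(\mathbb C)^n$. Assume: **(Pur)** every nonzero orthogonal projector $\pi$ such that for every $n\in\mathbb N$, $\pi v_1^*\cdots v_n^*v_n\cdots v_1\pi\propto\pi$ for $\mu^{\otimes n}$-almost all $(v_1,\dots,v_n)$, has rank one; **(Erg)** there is a unique minimal subspace $E$ among the subspaces $F\neq\{0\}$ of $\mathbb C^d$ such that $vF\subset F$ for all $v\in\operatorname{supp}\mu$. Then, for every probability measure $\nu$ on $\mathrm P(\mathbb C^d)$, the law $\mathbb P_\nu$ exists and is unique, and $\Pi$ has a unique invariant probability measure $\nu_{inv}$. Let $g:\mathrm P(\mathbb C^d)\to\mathbb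 C$ be Hölder continuous with some exponent in $(0,1]$, and put $\bar g=g-\mathbb E_{\nu_{inv}}(g)$. Then: 1. The Poisson equation $(\mathrm{Id}-\Pi)\tilde g=\bar g$ has a continuous solution $\tilde g$. 2. Any two continuous solutions of the Poisson equation are equal up to an additive constant. 3. Let $\tilde g$ be any continuous solution, and put $$S_n(\bar g)=\sum_{k=0}^{n-1}\bar g(\hat x_k),\qquad M_n(g)=\sum_{k=1}^n\big(\tilde g(\hat x_k)-\Pi\tilde g(\hat x_{k-1})\big).$$ Then the increments $M_{n+1}(g)-M_n(g)$ are bounded uniformly in $n$ and in $(\hat x,\omega)$. For every probability measure $\nu$ on $\mathrm P(\mathbb C^d)$, $(M_n(g))_n$ is a $(\mathcal J_n)$-martingale under $\mathbb P_\nu$, and $\mathbb P_\nu$-almost surely $$\sup_n|S_n(\bar g)-M_n(g)|\le\operatorname{osc}(\tilde g)\le2\|\tilde g\|_\infty,$$ where $\operatorname{osc}(f)=\sup_{\hat x,\hat y}|f(\hat x)-f(\hat y)|$. -/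

import Mathlib

open MeasureTheory ProbabilityTheory
open scoped NNReal ENNReal

noncomputable section

namespace QuantumTrajectory

/-- `ℂ^d` with its standard Hermitian inner product. -/
abbrev Vec (d : ℕ) : Type := EuclideanSpace ℂ (Fin d)

/-- `M_d(ℂ)`, seen as the algebra of linear maps of `ℂ^d`, with the operator norm and its Borel
`σ`-algebra. -/
abbrev Op (d : ℕ) : Type := Vec d →L[ℂ] Vec d

/-- The Hermitian adjoint `v^*`. -/
abbrev adj {d : ℕ} (v : Op d) : Op d := ContinuousLinearMap.adjoint v

/-- The projective space `P(ℂ^d)`. -/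
abbrev PState (d : ℕ) : Type := Projectivization ℂ (Vec d)

variable {d : ℕ}

/-- A norm one representative of a point of the projective space. -/
def unitRep (x : PState d) : Vec d := ((‖x.rep‖⁻¹ : ℝ) : ℂ) • x.rep

lemma norm_unitRep (x : PState d) : ‖unitRep x‖ = 1 := by
  have h : ‖x.rep‖ ≠ 0 := norm_ne_zero_iff.mpr x.rep_nonzero
  simp [unitRep, norm_smul, h]

lemma unitRep_ne_zero (x : PState d) : unitRep x ≠ 0 := by
  intro h
  have := norm_unitRep x
  simp [h] at this

lemma mk_unitRep (x : PState d) :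
    Projectivization.mk ℂ (unitRep x) (unitRep_ne_zero x) = x := by
  have h : ((‖x.rep‖⁻¹ : ℝ) : ℂ) ≠ 0 := by
    simpa using x.rep_nonzero
  conv_rhs => rw [← x.mk_rep]
  rw [Projectivization.mk_eq_mk_iff']
  exact ⟨_, rfl⟩

/-- The orthogonal projector `π_x` onto the line `x`. -/
def proj (x : PState d) : Op d := InnerProductSpace.rankOne ℂ (unitRep x) (unitRep x)

lemma proj_apply (x : PState d) (z : Vec d) :
    proj x z = inner ℂ (unitRep x) z • unitRep x := rfl

lemma proj_injective : Function.Injective (proj : PState d → Op d) := by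
  intro x y h
  have h1 : proj x (unitRep x) = unitRep x := by
    simp [proj_apply, inner_self_eq_norm_sq_to_K, norm_unitRep]
  rw [h, proj_apply] at h1
  rw [← mk_unitRep x, ← mk_unitRep y, Projectivization.mk_eq_mk_iff']
  exact ⟨_, h1⟩

/-- The metric `d(x, y) = ‖π_x - π_y‖` (operator norm) on the projective space. -/
instance : MetricSpace (PState d) := MetricSpace.induced proj proj_injective inferInstance

lemma dist_eq_norm_proj (x y : PState d) : dist x y = ‖proj x - proj y‖ := by
  rw [← dist_eq_norm]; rfl

lemma adj_proj (x : PState d) : adj (proj x) = proj x := by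
  simp [proj]

lemma norm_mul_self_of_adj {A : Op d} (h : adj A = A) : ‖A * A‖ = ‖A‖ ^ 2 := by
  rw [pow_two, ← ContinuousLinearMap.norm_adjoint_comp_self A]
  change _ = ‖adj A * A‖
  rw [h]

/-- The metric is also given by `d(x, y) = √(1 - |⟨x, y⟩|²)`. -/
lemma dist_eq_sqrt (x y : PState d) :
    dist x y = √(1 - ‖inner ℂ (unitRep x) (unitRep y)‖ ^ 2) := by
  rw [dist_eq_norm_proj]
  set u := unitRep x with hu
  set w := unitRep y with hw
  set A : Op d := proj x - proj y with hA
  set s : ℝ := 1 - ‖inner ℂ u w‖ ^ 2 with hs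
  have huu : inner ℂ u u = (1 : ℂ) := by
    simp [hu, inner_self_eq_norm_sq_to_K, norm_unitRep]
  have hww : inner ℂ w w = (1 : ℂ) := by
    simp [hw, inner_self_eq_norm_sq_to_K, norm_unitRep]
  have hc : inner ℂ w u * inner ℂ u w = ((1 - s : ℝ) : ℂ) := by
    rw [hs, ← inner_conj_symm w u, Complex.conj_mul']
    simp
  have hAz : ∀ z, A z = inner ℂ u z • u - inner ℂ w z • w := fun z => rfl
  have hAu : A (A u) = (s : ℂ) • u := by
    simp only [hAz, huu, hww, one_smul, inner_sub_right, inner_smul_right]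
    have : (s : ℂ) = 1 - inner ℂ w u * inner ℂ u w := by rw [hc]; push_cast; ring
    rw [this]
    module
  have hAw : A (A w) = (s : ℂ) • w := by
    simp only [hAz, huu, hww, one_smul, inner_sub_right, inner_smul_right]
    have : (s : ℂ) = 1 - inner ℂ w u * inner ℂ u w := by rw [hc]; push_cast; ring
    rw [this]
    module
  have hA3 : A * A * A = (s : ℂ) • A := by
    ext1 z
    have : (A * A * A) z = A (A (A z)) := rfl
    rw [this, hAz z, map_sub, map_sub, map_smul, map_smul, map_smul, map_smul, hAu, hAw]
    rw [smul_apply, hAz z]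
    module
  have hsa : adj A = A := by
    have hx := adj_proj x
    have hy := adj_proj y
    simp only [adj] at hx hy ⊢
    rw [hA, map_sub, hx, hy]
  have hn2 : ‖A * A‖ = ‖A‖ ^ 2 := norm_mul_self_of_adj hsa
  have hs0 : 0 ≤ s := by
    have : ‖inner ℂ u w‖ ≤ ‖u‖ * ‖w‖ := norm_inner_le_norm u w
    rw [hu, hw, norm_unitRep, norm_unitRep] at this
    have h0 := norm_nonneg (inner ℂ u w)
    rw [hs]; nlinarith
  have hsA : adj (A * A) = A * A := by
    have : adj (A * A) = adj A * adj A := ContinuousLinearMap.adjoint_comp A A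
    rw [this, hsa]
  have hn4 : ‖A * A * A * A‖ = ‖A‖ ^ 4 := by
    rw [mul_assoc (A * A) A A, norm_mul_self_of_adj hsA, hn2]; ring
  have key : ‖A‖ ^ 4 = s * ‖A‖ ^ 2 := by
    rw [← hn4, hA3, smul_mul_assoc, norm_smul, hn2, Complex.norm_real, Real.norm_of_nonneg hs0]
  rw [eq_comm, Real.sqrt_eq_iff_mul_self_eq hs0 (norm_nonneg _)]
  by_cases h0 : ‖A‖ = 0
  · have hA0 : A = 0 := norm_eq_zero.mp h0
    have : (s : ℂ) • u = 0 := by rw [← hAu, hA0]; simp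
    have hu0 : u ≠ 0 := unitRep_ne_zero x
    have hsz : s = 0 := by simpa [hu0] using this
    rw [h0, hsz]; simp
  · have : ‖A‖ ^ 2 ≠ 0 := pow_ne_zero _ h0
    have h2 : ‖A‖ ^ 2 * (‖A‖ ^ 2 - s) = 0 := by linear_combination key
    rcases mul_eq_zero.mp h2 with h | h
    · exact absurd h this
    · linear_combination -h

/-- The Borel `σ`-algebra of the projective space. -/
instance : MeasurableSpace (PState d) := borel (PState d)

instance : BorelSpace (PState d) := ⟨rfl⟩

/-- `v · x`, the point represented by `v x` if `v x ≠ 0` (and `x`, by convention, otherwise). -/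
def act (v : Op d) (x : PState d) : PState d :=
  open Classical in
  if h : v (unitRep x) = 0 then x else Projectivization.mk ℂ (v (unitRep x)) h

lemma proj_mk (z : Vec d) (hz : z ≠ 0) :
    proj (Projectivization.mk ℂ z hz) =
      ((‖z‖⁻¹ ^ 2 : ℝ) : ℂ) • InnerProductSpace.rankOne ℂ z z := by
  set x := Projectivization.mk ℂ z hz with hx
  have h1 : Projectivization.mk ℂ (unitRep x) (unitRep_ne_zero x) =
      Projectivization.mk ℂ z hz := by rw [mk_unitRep, hx]
  rw [Projectivization.mk_eq_mk_iff'] at h1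
  obtain ⟨a, ha⟩ := h1
  have hn : ‖a‖ * ‖z‖ = 1 := by rw [← norm_smul, ha, norm_unitRep]
  have hz0 : ‖z‖ ≠ 0 := norm_ne_zero_iff.mpr hz
  have ha' : ‖a‖ = ‖z‖⁻¹ := by field_simp; exact hn
  ext1 y
  rw [proj_apply, ← ha, smul_apply, InnerProductSpace.rankOne_apply,
    inner_smul_left, smul_smul, smul_smul, ← ha']
  congr 1
  push_cast
  rw [← Complex.conj_mul']
  ring

lemma measurable_proj : Measurable (proj : PState d → Op d) := by
  have : Isometry (proj : PState d → Op d) := fun _ _ => rfl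
  exact this.continuous.measurable

lemma comp_proj_comp (v : Op d) (x : PState d) :
    v * proj x * adj v = InnerProductSpace.rankOne ℂ (v (unitRep x)) (v (unitRep x)) := by
  ext1 y
  change v (proj x (adj v y)) = _
  rw [proj_apply, map_smul,
    ContinuousLinearMap.adjoint_inner_right]
  rfl

lemma norm_comp_proj_comp (v : Op d) (x : PState d) :
    ‖v * proj x * adj v‖ = ‖v (unitRep x)‖ ^ 2 := by
  rw [comp_proj_comp, InnerProductSpace.norm_rankOne, pow_two]

lemma measurable_comp_proj_comp :
    Measurable (fun p : Op d × PState d => p.1 * proj p.2 * adj p.1) := by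
  have hc : Continuous (fun q : Op d × Op d => q.1 * q.2 * adj q.1) :=
    (continuous_fst.mul continuous_snd).mul (ContinuousLinearMap.adjoint.continuous.comp continuous_fst)
  exact hc.measurable.comp
    (measurable_fst.prodMk (measurable_proj.comp measurable_snd))

/-- The weight `(v, x) ↦ ‖v x‖²` is measurable. -/
lemma measurable_weight :
    Measurable (fun p : Op d × PState d => ‖p.1 (unitRep p.2)‖ₑ ^ 2) := by
  have : (fun p : Op d × PState d => ‖p.1 (unitRep p.2)‖ₑ ^ 2) =
      fun p : Op d × PState d => ‖p.1 * proj p.2 * adj p.1‖ₑ := by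
    funext p
    rw [comp_proj_comp, InnerProductSpace.enorm_rankOne, pow_two]
  rw [this]
  exact measurable_comp_proj_comp.enorm

/-- The action `(v, x) ↦ v · x` is measurable. -/
lemma measurable_act : Measurable (fun p : Op d × PState d => act p.1 p.2) := by
  have hcomap : borel (PState d) = MeasurableSpace.comap proj (borel (Op d)) := borel_comap
  change @Measurable _ _ _ (borel (PState d)) _
  rw [hcomap, measurable_comap_iff, ← BorelSpace.measurable_eq (α := Op d)]
  classical
  have hset : MeasurableSet
      {p : Op d × PState d | p.1 * proj p.2 * adj p.1 = 0} :=
    measurable_comp_proj_comp (measurableSet_singleton 0)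
  have heq : (proj ∘ fun p : Op d × PState d => act p.1 p.2) =
      fun p => if p ∈ {p : Op d × PState d | p.1 * proj p.2 * adj p.1 = 0} then proj p.2
        else ((‖p.1 * proj p.2 * adj p.1‖⁻¹ : ℝ) : ℂ) • (p.1 * proj p.2 * adj p.1) := by
    funext p
    by_cases h : p.1 (unitRep p.2) = 0
    · have h' : p.1 * proj p.2 * adj p.1 = 0 := by rw [comp_proj_comp, h]; simp
      simp [act, h, h']
    · have h' : p.1 * proj p.2 * adj p.1 ≠ 0 := by
        rw [comp_proj_comp]; exact InnerProductSpace.rankOne_ne_zero h h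
      simp only [Function.comp_apply, act, h, dite_false, Set.mem_ofPred_eq, h', if_false]
      rw [proj_mk, norm_comp_proj_comp, comp_proj_comp, inv_pow]
  rw [heq]
  refine Measurable.ite hset (measurable_proj.comp measurable_snd) ?_
  exact (Complex.measurable_ofReal.comp measurable_comp_proj_comp.norm.inv).smul
    measurable_comp_proj_comp

/-- The Markov transition kernel
`Π(x, S) = ∫ 1_S(v · x) ‖v x‖² dμ(v)`. -/
def transKernel (μ : Measure (Op d)) [SFinite μ] : Kernel (PState d) (PState d) where
  toFun x := (μ.withDensity fun v => ‖v (unitRep x)‖ₑ ^ 2).map fun v => act v x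
  measurable' := by
    refine Measure.measurable_of_measurable_coe _ fun S hS => ?_
    have hact : ∀ x : PState d, Measurable fun v : Op d => act v x := fun x =>
      measurable_act.comp measurable_prodMk_right
    have : (fun x : PState d =>
        ((μ.withDensity fun v => ‖v (unitRep x)‖ₑ ^ 2).map fun v => act v x) S) =
        fun x => ∫⁻ v, ({p : Op d × PState d | act p.1 p.2 ∈ S}.indicator
          (fun p => ‖p.1 (unitRep p.2)‖ₑ ^ 2)) (v, x) ∂μ := by
      funext x
      rw [Measure.map_apply (hact x) hS, withDensity_apply _ (hact x hS),
        ← lintegral_indicator (hact x hS)]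
      rfl
    rw [this]
    exact (measurable_weight.indicator (measurable_act hS)).lintegral_prod_left'

lemma transKernel_apply (μ : Measure (Op d)) [SFinite μ] (x : PState d) {S : Set (PState d)}
    (hS : MeasurableSet S) :
    transKernel μ x S =
      ∫⁻ v, S.indicator 1 (act v x) * ‖v (unitRep x)‖ₑ ^ 2 ∂μ := by
  have hact : Measurable fun v : Op d => act v x := measurable_act.comp measurable_prodMk_right
  change ((μ.withDensity fun v => ‖v (unitRep x)‖ₑ ^ 2).map fun v => act v x) S = _
  rw [Measure.map_apply hact hS, withDensity_apply _ (hact hS), ← lintegral_indicator (hact hS)]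
  refine lintegral_congr fun v => ?_
  by_cases h : act v x ∈ S <;> simp [Set.indicator, h]

/-- The operator `Π` on functions, `(Π f)(x) = ∫ f(y) Π(x, dy)`. -/
def transOp (μ : Measure (Op d)) [SFinite μ] (f : PState d → ℂ) (x : PState d) : ℂ :=
  ∫ y, f y ∂(transKernel μ x)

/-- The ordered product `v_n ⋯ v_1`; the factor `v_{i+1}` is the entry of index `i`. -/
def prodW : (n : ℕ) → (Fin n → Op d) → Op d
  | 0, _ => 1
  | n + 1, v => v (Fin.last n) * prodW n (fun i => v i.castSucc)

/-- The product space `P(ℂ^d) × Ω` with `Ω = M_d(ℂ)^ℕ`; it carries the product `σ`-algebra.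
The factor `v_{i+1}` of `(x, (v_1, v_2, …))` is the entry of index `i`. -/
abbrev Path (d : ℕ) : Type := PState d × (ℕ → Op d)

/-- `(x, (v_1, v_2, …)) ↦ (x, (v_1, …, v_n))`. -/
def trunc (n : ℕ) (p : Path d) : PState d × (Fin n → Op d) := (p.1, fun i => p.2 i)

lemma measurable_trunc (n : ℕ) : Measurable (trunc (d := d) n) := by
  unfold trunc
  fun_prop

/-- The filtration `J_n`, generated by `x` and `v_1, …, v_n`. -/
def filtJ (d : ℕ) : Filtration ℕ (inferInstance : MeasurableSpace (Path d)) where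
  seq n := MeasurableSpace.comap (trunc n) inferInstance
  mono' := by
    intro m n hmn
    let r : PState d × (Fin n → Op d) → PState d × (Fin m → Op d) :=
      fun q => (q.1, fun i => q.2 (Fin.castLE hmn i))
    have hr : Measurable r := by unfold r; fun_prop
    have : (trunc m : Path d → _) = r ∘ trunc n := rfl
    change MeasurableSpace.comap (trunc m) _ ≤ MeasurableSpace.comap (trunc n) _
    rw [this, ← MeasurableSpace.comap_comp]
    exact MeasurableSpace.comap_mono hr.comap_le
  le' n := (measurable_trunc n).comap_le

/-- `P` is the law `ℙ_ν`: the probability measure on `P(ℂ^d) × Ω` with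
`ℙ_ν(S × O_n) = ∫_{S × O_n} ‖v_n ⋯ v_1 x‖² dν(x) dμ^{⊗n}(v_1, …, v_n)`
for all `n`, all Borel sets `S` and all `O_n` of the form `{(v_1, …, v_n) ∈ A}`. -/
def IsPathLaw (μ : Measure (Op d)) (ν : Measure (PState d)) (P : Measure (Path d)) : Prop :=
  IsProbabilityMeasure P ∧
    ∀ (n : ℕ) (S : Set (PState d)) (A : Set (Fin n → Op d)), MeasurableSet S → MeasurableSet A →
      P (trunc n ⁻¹' (S ×ˢ A)) =
        ∫⁻ q in S ×ˢ A, ‖prodW n q.2 (unitRep q.1)‖ₑ ^ 2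
          ∂(ν.prod (Measure.pi fun _ : Fin n => μ))

/-- The quantum trajectory `x_n = (v_n ⋯ v_1) · x`. -/
def traj (n : ℕ) (p : Path d) : PState d := act (prodW n (trunc n p).2) p.1

/-- The empirical sum `S_n(f) = ∑_{k=0}^{n-1} f(x_k)`. -/
def empSum (f : PState d → ℂ) (n : ℕ) (p : Path d) : ℂ :=
  ∑ k ∈ Finset.range n, f (traj k p)

/-- `M_n = ∑_{k=1}^{n} (f(x_k) - (Π f)(x_{k-1}))`. -/
def mart (μ : Measure (Op d)) [SFinite μ] (f : PState d → ℂ) (n : ℕ) (p : Path d) : ℂ :=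
  ∑ k ∈ Finset.Icc 1 n, (f (traj k p) - transOp μ f (traj (k - 1) p))

/-- `g` is Hölder continuous with some exponent `α ∈ (0, 1]`. -/
def IsHolder (g : PState d → ℂ) : Prop :=
  ∃ C α : ℝ≥0, 0 < α ∧ α ≤ 1 ∧ HolderWith C α g

/-- The oscillation `sup_{x, y} |f(x) - f(y)|`. -/
def osc (f : PState d → ℂ) : ℝ := ⨆ q : PState d × PState d, ‖f q.1 - f q.2‖

/-- The sup norm. -/
def supNorm (f : PState d → ℂ) : ℝ := ⨆ x : PState d, ‖f x‖

/-- Assumption (Pur): every nonzero orthogonal projector `π` such that, for all `n`,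
`π v_1^* ⋯ v_n^* v_n ⋯ v_1 π` is proportional to `π` for `μ^{⊗n}`-almost all `(v_1, …, v_n)`,
has rank one. -/
def Pur (μ : Measure (Op d)) : Prop :=
  ∀ π : Op d, π * π = π → adj π = π → π ≠ 0 →
    (∀ n : ℕ, ∀ᵐ v ∂(Measure.pi fun _ : Fin n => μ),
      ∃ c : ℂ, π * adj (prodW n v) * prodW n v * π = c • π) →
    Module.finrank ℂ (LinearMap.range (π : Vec d →ₗ[ℂ] Vec d)) = 1

/-- Assumption (Erg): among the nonzero subspaces of `ℂ^d` that are invariant under all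
`v ∈ supp μ` there is exactly one minimal subspace. -/
def Erg (μ : Measure (Op d)) : Prop :=
  ∃! E : Submodule ℂ (Vec d),
    Minimal (fun F : Submodule ℂ (Vec d) => F ≠ ⊥ ∧ ∀ v ∈ μ.support, ∀ x ∈ F, v x ∈ F) E

/-- `f` solves the Poisson equation `(Id - Π) f = g - E_{νinv}(g)`. -/
def SolvesPoisson (μ : Measure (Op d)) [SFinite μ] (νinv : Measure (PState d))
    (g f : PState d → ℂ) : Prop :=
  ∀ x, f x - transOp μ f x = g x - ∫ y, g y ∂νinv

end QuantumTrajectory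

end

noncomputable section

namespace QuantumTrajectory

variable {d : ℕ}

open scoped BoundedContinuousFunction

/-! ### Geometry of the action on the projective space -/

/-! The normalization `∫ v^*v dμ = Id` makes `‖Wx‖² dm(W)` a probability for every `x` when `m` is a
convolution power of `μ`, and `Π^n` is the averaging operator of the `n`-th power
(`IsStoch.avg_mconv`). Everything rests on one estimate: the mean of `areaSum W`, a substitute for
`‖∧²W‖`, becomes arbitrarily small along convolution powers (`exists_integral_areaSum_le`).

For that estimate, let `gR W = tr (W^*W)² / tr W^*W`. It is convex and homogeneous in the Gram
matrix `W^*W`, and the Gram matrix is preserved in mean by random left multiplication. So the mean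
of `gR` is nondecreasing in `n`; it is bounded by `d`, hence its increments (the mean gains) tend to
zero. If the gain at `W` vanishes at all orders, the projector onto the range of `W` satisfies the
condition in (Pur), and a nonzero `W` then has rank one (`gPhi_eq_zero_of_gain`). Compactness turns
this into an inequality (`exists_gPhi_le`): the rank defect `gPhi` is small in mean, and it controls
the areas.

Since `dist (W·x) (W·y) ‖Wx‖ ‖Wy‖ ≤ areaSum W * dist x y`, an iterate of `Π` halves Hölder constants
up to a multiple of the sup norm (`exists_lasotaYorke`). The same estimate makes continuous harmonic
functions constant (`eq_of_harmonic`): otherwise the sets where the real part is maximal and minimal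
are preserved by the dynamics and at positive distance; their spans are invariant, so by (Erg) they
share some `e ≠ 0`. Then `‖We‖² ≤ A * areaSum W` almost everywhere, although `∫ ‖We‖² = ‖e‖²`.

The Poisson equation is solved with the Abel resolvents `∑ r^n Π^n ḡ`, `r → 1` (`exists_poisson`).
Their Hölder constants are bounded by their sup norms uniformly in `r`, so suitably normalized they
converge along a subsequence. Were the sup norms to blow up along it, the limit would be harmonic,
centred and of norm one, which is impossible. No spectral gap or aperiodicity enters.

Two continuous solutions differ by a harmonic function. Integrating the equation against a second
invariant law proves uniqueness of the invariant law; its existence is Krylov–Bogoliubov. The path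
law comes from Ionescu–Tulcea, the martingale property is the Markov property, and `S_n - M_n`
telescopes to `f(x_0) - f(x_n)`. -/

lemma exists_unitRep_mk (z : Vec d) (hz : z ≠ 0) :
    ∃ c : ℂ, ‖c‖ * ‖z‖ = 1 ∧ unitRep (Projectivization.mk ℂ z hz) = c • z := by
  set x := Projectivization.mk ℂ z hz with hx
  have h1 : Projectivization.mk ℂ (unitRep x) (unitRep_ne_zero x) =
      Projectivization.mk ℂ z hz := by rw [mk_unitRep, hx]
  rw [Projectivization.mk_eq_mk_iff'] at h1
  obtain ⟨a, ha⟩ := h1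
  exact ⟨a, by rw [← norm_smul, ha, norm_unitRep], ha.symm⟩

lemma act_of_ne_zero {v : Op d} {x : PState d} (h : v (unitRep x) ≠ 0) :
    act v x = Projectivization.mk ℂ (v (unitRep x)) h := by
  simp [act, h]

lemma exists_unitRep_act {v : Op d} {x : PState d} (h : v (unitRep x) ≠ 0) :
    ∃ c : ℂ, ‖c‖ * ‖v (unitRep x)‖ = 1 ∧ unitRep (act v x) = c • v (unitRep x) := by
  rw [act_of_ne_zero h]
  exact exists_unitRep_mk _ h

/-- The cocycle property of the weight, source of every semigroup and Markov statement below. No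
nonvanishing is needed: both sides are zero when `W x = 0`. -/
lemma norm_apply_act_mul (v W : Op d) (x : PState d) :
    ‖v (unitRep (act W x))‖ * ‖W (unitRep x)‖ = ‖(v * W) (unitRep x)‖ := by
  change _ = ‖v (W (unitRep x))‖
  by_cases h : W (unitRep x) = 0
  · simp [h]
  · obtain ⟨c, hc, hu⟩ := exists_unitRep_act h
    rw [hu, map_smul, norm_smul, mul_right_comm, hc, one_mul]

/-- The hypothesis cannot be dropped: when `v W x = 0`, the default value of `act` gives `x` on the
left but may give `W · x` on the right. The weight vanishes there, so this does no harm. -/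
lemma act_mul {v W : Op d} {x : PState d} (h : (v * W) (unitRep x) ≠ 0) :
    act (v * W) x = act v (act W x) := by
  have h' : v (W (unitRep x)) ≠ 0 := h
  have hW : W (unitRep x) ≠ 0 := fun h0 => h' (by simp [h0])
  obtain ⟨c, hc, hu⟩ := exists_unitRep_act hW
  have hc0 : c ≠ 0 := by rintro rfl; simp at hc
  have hv : v (unitRep (act W x)) ≠ 0 := by
    rw [hu, map_smul]; exact smul_ne_zero hc0 h'
  rw [act_of_ne_zero h, act_of_ne_zero hv, Projectivization.mk_eq_mk_iff']
  refine ⟨c⁻¹, ?_⟩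
  rw [hu, map_smul, smul_smul, inv_mul_cancel₀ hc0, one_smul]
  rfl

lemma act_one (x : PState d) : act (1 : Op d) x = x := by
  have h : (1 : Op d) (unitRep x) ≠ 0 := unitRep_ne_zero x
  rw [act_of_ne_zero h]
  exact mk_unitRep x

lemma isometry_proj : Isometry (proj : PState d → Op d) := fun _ _ => rfl

lemma continuous_mk :
    Continuous fun z : {z : Vec d // z ≠ 0} => Projectivization.mk ℂ z.1 z.2 := by
  rw [isometry_proj.isEmbedding.continuous_iff]
  have : (proj ∘ fun z : {z : Vec d // z ≠ 0} => Projectivization.mk ℂ z.1 z.2) =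
      fun z => ((‖z.1‖⁻¹ ^ 2 : ℝ) : ℂ) • InnerProductSpace.rankOne ℂ z.1 z.1 := by
    funext z; exact proj_mk _ _
  rw [this]
  have h1 : Continuous fun z : {z : Vec d // z ≠ 0} => ‖z.1‖⁻¹ :=
    continuous_subtype_val.norm.inv₀ fun z => norm_ne_zero_iff.mpr z.2
  have h2 : Continuous fun z : Vec d => InnerProductSpace.rankOne ℂ z z := by
    have h := ((ContinuousLinearMap.smulRightL ℂ (Vec d) (Vec d)).continuous.comp
      (innerSL ℂ (E := Vec d)).continuous).clm_apply continuous_id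
    exact h
  exact (Complex.continuous_ofReal.comp (h1.pow 2)).smul (h2.comp continuous_subtype_val)

instance : CompactSpace (PState d) := by
  let s : Set (Vec d) := Metric.sphere 0 1
  have hs : IsCompact s := isCompact_sphere 0 1
  have : CompactSpace s := isCompact_iff_compactSpace.mp hs
  have hne : ∀ z : s, z.1 ≠ 0 := fun z => by
    intro h
    have := z.2
    simp [s, h] at this
  let F : s → PState d := fun z => Projectivization.mk ℂ z.1 (hne z)
  have hF : Continuous F := continuous_mk.comp
    (continuous_subtype_val.subtype_mk hne)
  have hsurj : Function.Surjective F := fun x =>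
    ⟨⟨unitRep x, by simp [s, norm_unitRep]⟩, mk_unitRep x⟩
  exact hsurj.compactSpace hF

lemma continuous_comp_proj_comp :
    Continuous (fun p : Op d × PState d => p.1 * proj p.2 * adj p.1) := by
  have hc : Continuous (fun q : Op d × Op d => q.1 * q.2 * adj q.1) :=
    (continuous_fst.mul continuous_snd).mul
      (ContinuousLinearMap.adjoint.continuous.comp continuous_fst)
  exact hc.comp (continuous_fst.prodMk (isometry_proj.continuous.comp continuous_snd))

lemma continuous_weight :
    Continuous (fun p : Op d × PState d => ‖p.1 (unitRep p.2)‖ ^ 2) := by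
  simp_rw [← norm_comp_proj_comp]
  exact continuous_comp_proj_comp.norm

lemma proj_act {v : Op d} {x : PState d} (h : v (unitRep x) ≠ 0) :
    proj (act v x) = ((‖v * proj x * adj v‖⁻¹ : ℝ) : ℂ) • (v * proj x * adj v) := by
  rw [act_of_ne_zero h, proj_mk, norm_comp_proj_comp, comp_proj_comp, inv_pow]

/-- The projector onto the image line is `W π_x W^*` divided by its norm, which is jointly
continuous as long as `W x ≠ 0`. -/
lemma continuousAt_act {p : Op d × PState d} (h : p.1 (unitRep p.2) ≠ 0) :
    ContinuousAt (fun p : Op d × PState d => act p.1 p.2) p := by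
  rw [isometry_proj.isEmbedding.continuousAt_iff]
  have hne : ∀ᶠ q : Op d × PState d in nhds p, q.1 (unitRep q.2) ≠ 0 := by
    have := (continuous_weight (d := d)).continuousAt.eventually_ne
      (x := p) (y := (0 : ℝ)) (by simpa using h)
    filter_upwards [this] with q hq h0
    simp [h0] at hq
  have hev : (fun q : Op d × PState d =>
      ((‖q.1 * proj q.2 * adj q.1‖⁻¹ : ℝ) : ℂ) • (q.1 * proj q.2 * adj q.1)) =ᶠ[nhds p]
      (proj ∘ fun p : Op d × PState d => act p.1 p.2) := by
    filter_upwards [hne] with q hq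
    exact (proj_act hq).symm
  refine ContinuousAt.congr ?_ hev
  have h0 : ‖p.1 * proj p.2 * adj p.1‖ ≠ 0 := by
    rw [norm_comp_proj_comp]; simpa using h
  have hc := (continuous_comp_proj_comp (d := d)).continuousAt (x := p)
  exact (Complex.continuous_ofReal.continuousAt.comp (hc.norm.inv₀ h0)).smul hc

/-- The weight is `‖W π_x W^*‖`, the norm of an expression linear in `π_x`, and the metric is the
norm distance of the projectors. -/
lemma abs_weight_sub_le (W : Op d) (x y : PState d) :
    |‖W (unitRep x)‖ ^ 2 - ‖W (unitRep y)‖ ^ 2| ≤ ‖W‖ ^ 2 * dist x y := by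
  rw [← norm_comp_proj_comp, ← norm_comp_proj_comp, dist_eq_norm_proj]
  refine (abs_norm_sub_norm_le _ _).trans ?_
  have : W * proj x * adj W - W * proj y * adj W = W * (proj x - proj y) * adj W := by
    rw [mul_sub, sub_mul]
  rw [this]
  calc _ ≤ ‖W‖ * ‖proj x - proj y‖ * ‖adj W‖ :=
        (norm_mul_le _ _).trans (mul_le_mul_of_nonneg_right (norm_mul_le _ _) (norm_nonneg _))
    _ = _ := by rw [adj, LinearIsometryEquiv.norm_map]; ring

lemma dist_le_one (x y : PState d) : dist x y ≤ 1 := by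
  rw [dist_eq_sqrt]
  refine Real.sqrt_le_one.mpr ?_
  have := sq_nonneg ‖inner ℂ (unitRep x) (unitRep y)‖
  linarith

/-! ### The area of a pair of vectors -/

/-- The area of the parallelogram spanned by `a` and `b`. -/
def area (a b : Vec d) : ℝ := √(‖a‖ ^ 2 * ‖b‖ ^ 2 - ‖inner ℂ a b‖ ^ 2)

lemma area_nonneg (a b : Vec d) : 0 ≤ area a b := Real.sqrt_nonneg _

lemma area_comm (a b : Vec d) : area a b = area b a := by
  rw [area, area, norm_inner_symm, mul_comm]

lemma area_sq_nonneg (a b : Vec d) : 0 ≤ ‖a‖ ^ 2 * ‖b‖ ^ 2 - ‖inner ℂ a b‖ ^ 2 := by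
  have := norm_inner_le_norm (𝕜 := ℂ) a b
  have h2 := pow_le_pow_left₀ (norm_nonneg _) this 2
  rw [mul_pow] at h2
  linarith

/-- The vector on the right is linear in `b`, so for fixed `a` the area is a seminorm in `b`. This
replaces the exterior square. -/
lemma norm_mul_area (a b : Vec d) :
    ‖a‖ * area a b = ‖((‖a‖ ^ 2 : ℝ) : ℂ) • b - inner ℂ a b • a‖ := by
  rw [← sq_eq_sq₀ (mul_nonneg (norm_nonneg _) (area_nonneg _ _)) (norm_nonneg _), mul_pow, area,
    Real.sq_sqrt (area_sq_nonneg a b)]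
  rw [@norm_sub_sq ℂ, norm_smul, norm_smul, inner_smul_left, inner_smul_right,
    ← inner_conj_symm b a]
  have h : ((starRingEnd ℂ) ((‖a‖ ^ 2 : ℝ) : ℂ) * (inner ℂ a b * (starRingEnd ℂ) (inner ℂ a b)))
      = ((‖a‖ ^ 2 * ‖inner ℂ a b‖ ^ 2 : ℝ) : ℂ) := by
    rw [Complex.conj_ofReal, Complex.mul_conj']
    push_cast; ring
  rw [h, Complex.norm_real]
  simp only [norm_pow, norm_norm, RCLike.re_to_complex, Complex.ofReal_re]
  ring

lemma area_sum_right_le {ι : Type*} (s : Finset ι) (a : Vec d) (c : ι → ℂ) (b : ι → Vec d) :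
    area a (∑ i ∈ s, c i • b i) ≤ ∑ i ∈ s, ‖c i‖ * area a (b i) := by
  by_cases ha : a = 0
  · subst ha; simp [area]
  have ha' : 0 < ‖a‖ := norm_pos_iff.mpr ha
  refine le_of_mul_le_mul_left ?_ ha'
  rw [norm_mul_area, Finset.mul_sum]
  have : ((‖a‖ ^ 2 : ℝ) : ℂ) • (∑ i ∈ s, c i • b i) - inner ℂ a (∑ i ∈ s, c i • b i) • a =
      ∑ i ∈ s, c i • (((‖a‖ ^ 2 : ℝ) : ℂ) • b i - inner ℂ a (b i) • a) := by
    simp_rw [inner_sum, Finset.smul_sum, Finset.sum_smul, ← Finset.sum_sub_distrib,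
      inner_smul_right]
    refine Finset.sum_congr rfl fun i _ => ?_
    module
  rw [this]
  refine (norm_sum_le _ _).trans (Finset.sum_le_sum fun i _ => ?_)
  rw [norm_smul, ← norm_mul_area]
  exact le_of_eq (by ring)

lemma area_sub_smul (a b : Vec d) (c : ℂ) : area a (b - c • a) = area a b := by
  by_cases ha : a = 0
  · subst ha; simp
  have ha' : ‖a‖ ≠ 0 := norm_ne_zero_iff.mpr ha
  refine mul_left_cancel₀ ha' ?_
  rw [norm_mul_area, norm_mul_area, inner_sub_right, inner_smul_right,
    inner_self_eq_norm_sq_to_K]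
  congr 1
  push_cast
  module

lemma area_smul_right (a b : Vec d) (c : ℂ) : area a (c • b) = ‖c‖ * area a b := by
  rw [area, area, norm_smul, inner_smul_right, norm_mul, mul_pow, mul_pow]
  have : ‖a‖ ^ 2 * (‖c‖ ^ 2 * ‖b‖ ^ 2) - ‖c‖ ^ 2 * ‖inner ℂ a b‖ ^ 2 =
    ‖c‖ ^ 2 * (‖a‖ ^ 2 * ‖b‖ ^ 2 - ‖inner ℂ a b‖ ^ 2) := by ring
  rw [this, Real.sqrt_mul (sq_nonneg _), Real.sqrt_sq (norm_nonneg _)]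

lemma area_smul_left (a b : Vec d) (c : ℂ) : area (c • a) b = ‖c‖ * area a b := by
  rw [area_comm, area_smul_right, area_comm]

lemma dist_eq_area (x y : PState d) : dist x y = area (unitRep x) (unitRep y) := by
  rw [dist_eq_sqrt, area, norm_unitRep, norm_unitRep]; simp

/-- The standard orthonormal basis of `ℂ^d`. -/
abbrev stdB (d : ℕ) : OrthonormalBasis (Fin d) ℂ (Vec d) := EuclideanSpace.basisFun (Fin d) ℂ

/-- The sum of the areas of the images of the pairs of basis vectors. -/
def areaSum (W : Op d) : ℝ := ∑ i, ∑ j, area (W (stdB d i)) (W (stdB d j))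

lemma areaSum_nonneg (W : Op d) : 0 ≤ areaSum W :=
  Finset.sum_nonneg fun _ _ => Finset.sum_nonneg fun _ _ => area_nonneg _ _

lemma norm_repr_le (z : Vec d) (i : Fin d) : ‖(stdB d).repr z i‖ ≤ ‖z‖ := by
  rw [← (stdB d).repr.norm_map z]
  exact PiLp.norm_apply_le _ i

lemma apply_eq_sum (W : Op d) (z : Vec d) :
    W z = ∑ i, (stdB d).repr z i • W (stdB d i) := by
  conv_lhs => rw [← (stdB d).sum_repr z]
  simp [map_sum]

/-- Subadditivity of the area in each argument, applied to the basis expansions of `a` and `b`: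
`areaSum W` plays the role of `‖∧²W‖`. -/
lemma area_apply_le (W : Op d) (a b : Vec d) : area (W a) (W b) ≤ ‖a‖ * ‖b‖ * areaSum W := by
  rw [apply_eq_sum W b]
  refine (area_sum_right_le _ _ _ _).trans ?_
  rw [areaSum, Finset.sum_comm, Finset.mul_sum]
  refine Finset.sum_le_sum fun j _ => ?_
  rw [area_comm, apply_eq_sum W a, mul_comm ‖a‖, mul_assoc]
  refine mul_le_mul (norm_repr_le b j) ?_ (area_nonneg _ _) (norm_nonneg _)
  refine (area_sum_right_le _ _ _ _).trans ?_
  rw [Finset.mul_sum]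
  refine Finset.sum_le_sum fun i _ => ?_
  rw [area_comm]
  exact mul_le_mul_of_nonneg_right (norm_repr_le a i) (area_nonneg _ _)

/-- Replacing `b` by its component orthogonal to `a` leaves the image area unchanged, and that
component has norm exactly `dist x y`. -/
lemma area_apply_unitRep_le (W : Op d) (x y : PState d) :
    area (W (unitRep x)) (W (unitRep y)) ≤ areaSum W * dist x y := by
  set a := unitRep x with ha
  set b := unitRep y with hb
  have h1 : area (W a) (W b) = area (W a) (W (b - inner ℂ a b • a)) := by
    rw [map_sub, map_smul, area_sub_smul]
  have h2 : ‖b - inner ℂ a b • a‖ = dist x y := by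
    have := norm_mul_area a b
    rw [dist_eq_area, ← ha, ← hb]
    rw [ha, norm_unitRep, ← ha] at this
    simpa using this.symm
  rw [h1]
  refine (area_apply_le _ _ _).trans (le_of_eq ?_)
  rw [h2, ha, norm_unitRep]; ring

/-- The distance is the area of unit representatives, so rescaling turns the left side into the area
of `W x` and `W y`. With the norms kept on the left, vanishing images are included. -/
lemma dist_act_mul_le (W : Op d) (x y : PState d) :
    dist (act W x) (act W y) * (‖W (unitRep x)‖ * ‖W (unitRep y)‖) ≤ areaSum W * dist x y := by
  have h0 : 0 ≤ areaSum W * dist x y := mul_nonneg (areaSum_nonneg W) dist_nonneg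
  by_cases hx : W (unitRep x) = 0
  · simpa [hx] using h0
  by_cases hy : W (unitRep y) = 0
  · simpa [hy] using h0
  obtain ⟨c, hc, hu⟩ := exists_unitRep_act hx
  obtain ⟨c', hc', hu'⟩ := exists_unitRep_act hy
  rw [dist_eq_area, hu, hu', area_smul_left, area_smul_right]
  refine le_of_eq_of_le ?_ (area_apply_unitRep_le W x y)
  linear_combination (area (W (unitRep x)) (W (unitRep y)) * ‖c'‖ * ‖W (unitRep y)‖) * hc +
    (area (W (unitRep x)) (W (unitRep y))) * hc'

lemma min_sq_le_mul {a b : ℝ} (ha : 0 ≤ a) (hb : 0 ≤ b) : min (a ^ 2) (b ^ 2) ≤ a * b := by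
  rcases le_total a b with h | h
  · exact (min_le_left _ _).trans (by nlinarith)
  · exact (min_le_right _ _).trans (by nlinarith)

lemma dist_act_mul_min_le (W : Op d) (x y : PState d) :
    dist (act W x) (act W y) * min (‖W (unitRep x)‖ ^ 2) (‖W (unitRep y)‖ ^ 2) ≤
      areaSum W * dist x y :=
  (mul_le_mul_of_nonneg_left (min_sq_le_mul (norm_nonneg _) (norm_nonneg _))
    dist_nonneg).trans (dist_act_mul_le W x y)

/-! ### Stochastic measures on operators and their convolution powers -/

/-- The normalization `∫ v^* v dm(v) = Id`, in weak form. -/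
def IsStoch (m : Measure (Op d)) : Prop := ∀ x : Vec d, ∫⁻ v, ‖v x‖ₑ ^ 2 ∂m = ‖x‖ₑ ^ 2

lemma continuous_apply_vec (x : Vec d) : Continuous fun v : Op d => v x :=
  (ContinuousLinearMap.apply ℂ (Vec d) x).continuous

/-- Apply the functional `A ↦ ⟨x, A x⟩` to the operator-valued integral; the second moment makes
that integral a genuine Bochner integral. -/
lemma isStoch_of_integral {μ : Measure (Op d)} (hsq : ∫⁻ v, ‖v‖ₑ ^ 2 ∂μ < ∞)
    (hstoch : ∫ v, adj v * v ∂μ = 1) : IsStoch μ := by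
  have hcont : Continuous fun v : Op d => adj v * v :=
    (ContinuousLinearMap.adjoint (𝕜 := ℂ) (E := Vec d) (F := Vec d)).continuous.mul continuous_id
  have hint : Integrable (fun v : Op d => adj v * v) μ := by
    refine ⟨hcont.aestronglyMeasurable, ?_⟩
    refine lt_of_le_of_lt (lintegral_mono fun v => ?_) hsq
    calc ‖adj v * v‖ₑ ≤ ‖adj v‖ₑ * ‖v‖ₑ := by
          rw [← ofReal_norm, ← ofReal_norm, ← ofReal_norm,
            ← ENNReal.ofReal_mul (norm_nonneg _)]
          exact ENNReal.ofReal_le_ofReal (norm_mul_le _ _)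
      _ = ‖v‖ₑ ^ 2 := by
          rw [pow_two, adj, ← ofReal_norm, LinearIsometryEquiv.norm_map, ofReal_norm]
  intro x
  let L : Op d →L[ℂ] ℂ := (innerSL ℂ x).comp (ContinuousLinearMap.apply ℂ (Vec d) x)
  have hL : ∀ v : Op d, L (adj v * v) = ((‖v x‖ ^ 2 : ℝ) : ℂ) := fun v => by
    change inner ℂ x (adj v (v x)) = _
    rw [ContinuousLinearMap.adjoint_inner_right, inner_self_eq_norm_sq_to_K]
    push_cast; rfl
  have h1 := L.integral_comp_comm hint
  rw [hstoch] at h1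
  simp_rw [hL] at h1
  have h2 : L 1 = ((‖x‖ ^ 2 : ℝ) : ℂ) := by
    change inner ℂ x x = _
    rw [inner_self_eq_norm_sq_to_K]; push_cast; rfl
  rw [h2, integral_complex_ofReal, Complex.ofReal_inj] at h1
  have hint2 : Integrable (fun v : Op d => ‖v x‖ ^ 2) μ := by
    have := (L.integrable_comp hint).re
    refine this.congr (Filter.Eventually.of_forall fun v => ?_)
    simp only [hL]
    exact Complex.ofReal_re _
  have h3 := ofReal_integral_eq_lintegral_ofReal hint2
    (Filter.Eventually.of_forall fun v => sq_nonneg _)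
  rw [h1] at h3
  simp_rw [ENNReal.ofReal_pow (norm_nonneg _), ofReal_norm] at h3
  exact h3.symm

lemma IsStoch.mconv {m m' : Measure (Op d)} [SFinite m] [SFinite m']
    (h : IsStoch m) (h' : IsStoch m') : IsStoch (m ∗ₘ m') := by
  intro x
  have hm : Measurable fun v : Op d => ‖v x‖ₑ ^ 2 :=
    (continuous_apply_vec x).measurable.enorm.pow_const 2
  rw [Measure.lintegral_mconv_eq_lintegral_prod hm,
    lintegral_prod_symm (fun z : Op d × Op d => ‖(z.1 * z.2) x‖ₑ ^ 2)
      (hm.comp measurable_mul).aemeasurable, ← h' x]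
  exact lintegral_congr fun W => h (W x)

/-- The law of the product of `n` independent factors, as a convolution power. -/
def powMeas (μ : Measure (Op d)) : ℕ → Measure (Op d)
  | 0 => Measure.dirac 1
  | n + 1 => μ ∗ₘ powMeas μ n

instance (μ : Measure (Op d)) [SFinite μ] (n : ℕ) : SFinite (powMeas μ n) := by
  induction n with
  | zero => rw [powMeas]; infer_instance
  | succ n ih => rw [powMeas]; infer_instance

lemma powMeas_add (μ : Measure (Op d)) [SFinite μ] (k n : ℕ) :
    powMeas μ (k + n) = powMeas μ k ∗ₘ powMeas μ n := by
  induction k with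
  | zero => rw [Nat.zero_add, powMeas, Measure.dirac_one_mconv]
  | succ k ih => rw [Nat.add_right_comm, powMeas, powMeas, ih, Measure.mconv_assoc]

lemma isStoch_powMeas {μ : Measure (Op d)} [SFinite μ] (h : IsStoch μ) (n : ℕ) :
    IsStoch (powMeas μ n) := by
  induction n with
  | zero =>
    intro x
    have hm : Measurable fun v : Op d => ‖v x‖ₑ ^ 2 :=
      (continuous_apply_vec x).measurable.enorm.pow_const 2
    rw [powMeas, lintegral_dirac' _ hm]; rfl
  | succ n ih => exact h.mconv ih

lemma measurable_prodW (n : ℕ) : Measurable (prodW (d := d) n) := by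
  induction n with
  | zero => exact measurable_const
  | succ n ih =>
    change Measurable fun v : Fin (n + 1) → Op d =>
      v (Fin.last n) * prodW n (fun i => v i.castSucc)
    exact (measurable_pi_apply _).mul
      (ih.comp (measurable_pi_lambda _ fun i => measurable_pi_apply _))

/-- The bridge to (Pur), which speaks of product measures; the analytic estimates only use
convolution powers. The last coordinate is the leftmost factor. -/
lemma powMeas_eq_map (μ : Measure (Op d)) [SigmaFinite μ] (n : ℕ) :
    powMeas μ n = (Measure.pi fun _ : Fin n => μ).map (prodW n) := by
  induction n with
  | zero =>
    rw [powMeas, Measure.pi_of_empty (fun _ : Fin 0 => μ) finZeroElim,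
      Measure.map_dirac' (measurable_prodW 0)]
    rfl
  | succ n ih =>
    have hmp := (measurePreserving_piFinSuccAbove (fun _ : Fin (n + 1) => μ) (Fin.last n)).symm
    rw [← hmp.map_eq, Measure.map_map (measurable_prodW _) hmp.measurable, powMeas, ih,
      Measure.mconv]
    have hid : μ.prod ((Measure.pi fun _ : Fin n => μ).map (prodW n)) =
        (μ.prod (Measure.pi fun _ : Fin n => μ)).map (Prod.map id (prodW n)) := by
      have h := Measure.map_prod_map μ (Measure.pi fun _ : Fin n => μ) measurable_id
        (measurable_prodW n)
      rwa [Measure.map_id] at h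
    rw [hid, Measure.map_map measurable_mul (measurable_id.prodMap (measurable_prodW n))]
    have hf : ((fun x : Op d × Op d => x.1 * x.2) ∘ Prod.map id (prodW n)) =
        (prodW (n + 1) ∘
          (MeasurableEquiv.piFinSuccAbove (fun _ : Fin (n + 1) => Op d) (Fin.last n)).symm) := by
      funext p
      simp [prodW, MeasurableEquiv.piFinSuccAbove, Fin.insertNthEquiv]
    rw [hf]

/-! ### Gram matrices -/

/-- `tr W^* W`. -/
def gT (W : Op d) : ℝ := ∑ i, ‖W (stdB d i)‖ ^ 2

/-- The matrix of `W^* W`. -/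
def gram (W : Op d) : EuclideanSpace ℂ (Fin d × Fin d) :=
  WithLp.toLp 2 fun p => inner ℂ (W (stdB d p.1)) (W (stdB d p.2))

lemma gram_apply (W : Op d) (p : Fin d × Fin d) :
    gram W p = inner ℂ (W (stdB d p.1)) (W (stdB d p.2)) := rfl

/-- `tr (W^* W)^2 / tr W^* W`. -/
def gR (W : Op d) : ℝ := ‖gram W‖ ^ 2 / gT W

/-- `tr W^* W - tr (W^* W)^2 / tr W^* W`, which vanishes if and only if `W` has rank at most one. -/
def gPhi (W : Op d) : ℝ := gT W - gR W

lemma gT_nonneg (W : Op d) : 0 ≤ gT W := Finset.sum_nonneg fun _ _ => sq_nonneg _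

lemma gR_nonneg (W : Op d) : 0 ≤ gR W := div_nonneg (sq_nonneg _) (gT_nonneg W)

lemma norm_gram_sq (W : Op d) :
    ‖gram W‖ ^ 2 = ∑ i, ∑ j, ‖inner ℂ (W (stdB d i)) (W (stdB d j))‖ ^ 2 := by
  rw [EuclideanSpace.norm_sq_eq, Fintype.sum_prod_type]
  rfl

lemma gT_sq (W : Op d) :
    gT W ^ 2 = ∑ i, ∑ j, ‖W (stdB d i)‖ ^ 2 * ‖W (stdB d j)‖ ^ 2 := by
  rw [gT, pow_two, Finset.sum_mul_sum]

/-- `(tr A)² - tr A²` for `A = W^*W` is a sum of `2 × 2` principal minors, that is, of squared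
areas. Hence `gPhi` measures the distance to rank one. -/
lemma gT_sq_sub (W : Op d) : gT W ^ 2 - ‖gram W‖ ^ 2 =
    ∑ i, ∑ j, area (W (stdB d i)) (W (stdB d j)) ^ 2 := by
  rw [gT_sq, norm_gram_sq, ← Finset.sum_sub_distrib]
  refine Finset.sum_congr rfl fun i _ => ?_
  rw [← Finset.sum_sub_distrib]
  refine Finset.sum_congr rfl fun j _ => ?_
  rw [area, Real.sq_sqrt (area_sq_nonneg _ _)]

lemma norm_gram_sq_le (W : Op d) : ‖gram W‖ ^ 2 ≤ gT W ^ 2 := by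
  rw [← sub_nonneg, gT_sq_sub]
  exact Finset.sum_nonneg fun _ _ => Finset.sum_nonneg fun _ _ => sq_nonneg _

lemma norm_gram_le (W : Op d) : ‖gram W‖ ≤ gT W :=
  (sq_le_sq₀ (norm_nonneg _) (gT_nonneg W)).mp (norm_gram_sq_le W)

lemma gR_le_gT (W : Op d) : gR W ≤ gT W := by
  refine div_le_of_le_mul₀ (gT_nonneg W) (gT_nonneg W) ?_
  rw [← pow_two]; exact norm_gram_sq_le W

lemma gPhi_nonneg (W : Op d) : 0 ≤ gPhi W := sub_nonneg.mpr (gR_le_gT W)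

lemma gPhi_le_gT (W : Op d) : gPhi W ≤ gT W := sub_le_self _ (gR_nonneg W)

lemma norm_le_sum (W : Op d) : ‖W‖ ≤ ∑ i, ‖W (stdB d i)‖ := by
  refine W.opNorm_le_bound (Finset.sum_nonneg fun _ _ => norm_nonneg _) fun x => ?_
  rw [apply_eq_sum W x, Finset.sum_mul]
  refine (norm_sum_le _ _).trans (Finset.sum_le_sum fun i _ => ?_)
  rw [norm_smul, mul_comm]
  exact mul_le_mul_of_nonneg_left (norm_repr_le x i) (norm_nonneg _)

lemma norm_sq_le (W : Op d) : ‖W‖ ^ 2 ≤ d * gT W := by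
  refine (pow_le_pow_left₀ (norm_nonneg _) (norm_le_sum W) 2).trans ?_
  have := sq_sum_le_card_mul_sum_sq (s := Finset.univ) (f := fun i => ‖W (stdB d i)‖)
  rwa [Finset.card_univ, Fintype.card_fin] at this

lemma eq_zero_of_gT_eq_zero {W : Op d} (h : gT W = 0) : W = 0 := by
  have := norm_sq_le W
  rw [h, mul_zero] at this
  have h2 : ‖W‖ ^ 2 = 0 := le_antisymm this (sq_nonneg _)
  simpa using h2

lemma gram_eq_zero_of_gT {W : Op d} (h : gT W = 0) : gram W = 0 := by
  have := norm_gram_le W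
  rw [h] at this
  exact norm_le_zero_iff.mp this

lemma gT_le (W : Op d) : gT W ≤ d * ‖W‖ ^ 2 := by
  have : ∀ i ∈ (Finset.univ : Finset (Fin d)), ‖W (stdB d i)‖ ^ 2 ≤ ‖W‖ ^ 2 := fun i _ => by
    refine pow_le_pow_left₀ (norm_nonneg _) ?_ 2
    have := W.le_opNorm (stdB d i)
    rwa [(stdB d).orthonormal.1 i, mul_one] at this
  have h2 := Finset.sum_le_card_nsmul _ _ _ this
  simpa [gT] using h2

lemma gT_mul_le (V W : Op d) : gT (V * W) ≤ ‖V‖ ^ 2 * gT W := by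
  rw [gT, gT, Finset.mul_sum]
  refine Finset.sum_le_sum fun i _ => ?_
  rw [← mul_pow]
  exact pow_le_pow_left₀ (norm_nonneg _) (V.le_opNorm _) 2

lemma gT_smul (c : ℂ) (W : Op d) : gT (c • W) = ‖c‖ ^ 2 * gT W := by
  simp [gT, norm_smul, mul_pow, Finset.mul_sum]

lemma gram_smul (c : ℂ) (W : Op d) : gram (c • W) = ((‖c‖ ^ 2 : ℝ) : ℂ) • gram W := by
  ext p
  rw [PiLp.smul_apply, gram_apply, gram_apply, smul_apply,
    smul_apply, inner_smul_left, inner_smul_right, ← mul_assoc,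
    Complex.conj_mul', smul_eq_mul]
  push_cast; rfl

lemma gR_smul (c : ℂ) (W : Op d) : gR (c • W) = ‖c‖ ^ 2 * gR W := by
  by_cases hc : c = 0
  · subst hc; simp [gR, gram_smul]
  have : ‖c‖ ≠ 0 := norm_ne_zero_iff.mpr hc
  rw [gR, gR, gram_smul, gT_smul, norm_smul, Complex.norm_real, mul_pow]
  simp only [norm_pow, norm_norm]
  field_simp

lemma continuous_gT : Continuous (gT : Op d → ℝ) :=
  continuous_finsetSum _ fun _ _ => (continuous_apply_vec _).norm.pow 2

lemma continuous_gram : Continuous (gram : Op d → EuclideanSpace ℂ (Fin d × Fin d)) := by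
  refine (PiLp.continuous_toLp 2 _).comp (continuous_pi fun p => ?_)
  exact (continuous_apply_vec _).inner (continuous_apply_vec _)

lemma continuous_gR : Continuous (gR : Op d → ℝ) := by
  rw [continuous_iff_continuousAt]
  intro W
  by_cases h : gT W = 0
  -- Here the quotient takes its default value zero, and `0 ≤ gR ≤ gT` squeezes.
  · have hR : gR W = 0 := by rw [gR, h, div_zero]
    rw [ContinuousAt, hR]
    have h2 := continuous_gT.tendsto W
    rw [h] at h2
    exact squeeze_zero gR_nonneg gR_le_gT h2
  · exact (continuous_gram.norm.pow 2).continuousAt.div continuous_gT.continuousAt h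

/-- The squared area is at most `gT W * gPhi W`. The weighted form of the arithmetic-geometric
inequality makes the bound linear in `gT` and `gPhi`, so that it can be integrated. -/
lemma area_le_add (W : Op d) (i j : Fin d) {η : ℝ} (hη : 0 < η) :
    area (W (stdB d i)) (W (stdB d j)) ≤ η * gT W + η⁻¹ * gPhi W := by
  have h1 : area (W (stdB d i)) (W (stdB d j)) ^ 2 ≤ gT W * gPhi W := by
    have : gT W * gPhi W = gT W ^ 2 - ‖gram W‖ ^ 2 := by
      rw [gPhi, gR]
      by_cases h : gT W = 0
      · rw [gram_eq_zero_of_gT h, h]; simp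
      · field_simp
    rw [this, gT_sq_sub]
    have h3 := Finset.single_le_sum (f := fun j => area (W (stdB d i)) (W (stdB d j)) ^ 2)
      (fun _ _ => sq_nonneg _) (Finset.mem_univ j)
    have h4 := Finset.single_le_sum
      (f := fun i => ∑ j, area (W (stdB d i)) (W (stdB d j)) ^ 2)
      (fun _ _ => Finset.sum_nonneg fun _ _ => sq_nonneg _) (Finset.mem_univ i)
    exact h3.trans h4
  have hT := gT_nonneg W
  have hP := gPhi_nonneg W
  refine abs_le_of_sq_le_sq' (h1.trans ?_) (by positivity) |>.2
  have : (η * gT W + η⁻¹ * gPhi W) ^ 2 = gT W * gPhi W + gT W * gPhi W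
      + ((η * gT W) ^ 2 + (η⁻¹ * gPhi W) ^ 2) := by
    field_simp; ring
  rw [this]
  have h5 : 0 ≤ gT W * gPhi W := mul_nonneg hT hP
  have h6 := sq_nonneg (η * gT W)
  have h7 := sq_nonneg (η⁻¹ * gPhi W)
  linarith

lemma areaSum_le (W : Op d) {η : ℝ} (hη : 0 < η) :
    areaSum W ≤ (d : ℝ) ^ 2 * (η * gT W + η⁻¹ * gPhi W) := by
  calc areaSum W ≤ ∑ _i : Fin d, ∑ _j : Fin d, (η * gT W + η⁻¹ * gPhi W) :=
        Finset.sum_le_sum fun i _ => Finset.sum_le_sum fun j _ => area_le_add W i j hη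
    _ = _ := by simp; ring

lemma continuous_area {X : Type*} [TopologicalSpace X] {f g : X → Vec d} (hf : Continuous f)
    (hg : Continuous g) : Continuous fun x => area (f x) (g x) :=
  (((hf.norm.pow 2).mul (hg.norm.pow 2)).sub ((hf.inner hg).norm.pow 2)).sqrt

lemma continuous_areaSum : Continuous (areaSum : Op d → ℝ) :=
  continuous_finsetSum _ fun _ _ => continuous_finsetSum _ fun _ _ =>
    continuous_area (continuous_apply_vec _) (continuous_apply_vec _)

/-! ### Integrability against stochastic measures -/

lemma IsStoch.integrable_norm_apply_sq {m : Measure (Op d)} (h : IsStoch m) (x : Vec d) :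
    Integrable (fun V : Op d => ‖V x‖ ^ 2) m := by
  refine ⟨((continuous_apply_vec x).norm.pow 2).aestronglyMeasurable, ?_⟩
  have : ∀ V : Op d, ‖‖V x‖ ^ 2‖ₑ = ‖V x‖ₑ ^ 2 := fun V => by
    rw [enorm_pow, enorm_norm]
  rw [HasFiniteIntegral]
  simp_rw [this]
  rw [h x]
  exact ENNReal.pow_lt_top enorm_lt_top

lemma IsStoch.integral_norm_apply_sq {m : Measure (Op d)} (h : IsStoch m) (x : Vec d) :
    ∫ V : Op d, ‖V x‖ ^ 2 ∂m = ‖x‖ ^ 2 := by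
  rw [integral_eq_lintegral_of_nonneg_ae (Filter.Eventually.of_forall fun _ => sq_nonneg _)
    ((continuous_apply_vec x).norm.pow 2).aestronglyMeasurable]
  simp_rw [ENNReal.ofReal_pow (norm_nonneg _), ofReal_norm]
  rw [h x]
  simp

lemma IsStoch.integrable_gT {m : Measure (Op d)} (h : IsStoch m) : Integrable gT m :=
  integrable_finsetSum _ fun _ _ => h.integrable_norm_apply_sq _

lemma IsStoch.integral_gT {m : Measure (Op d)} (h : IsStoch m) : ∫ V, gT V ∂m = d := by
  unfold gT
  rw [integral_finsetSum _ fun _ _ => h.integrable_norm_apply_sq _]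
  simp_rw [h.integral_norm_apply_sq, (stdB d).orthonormal.1]
  simp

lemma IsStoch.integrable_norm_sq {m : Measure (Op d)} (h : IsStoch m) :
    Integrable (fun V : Op d => ‖V‖ ^ 2) m := by
  refine (h.integrable_gT.const_mul (d : ℝ)).mono'
    (continuous_norm.pow 2).aestronglyMeasurable (Filter.Eventually.of_forall fun V => ?_)
  rw [Real.norm_of_nonneg (sq_nonneg _)]
  exact norm_sq_le V

lemma IsStoch.integral_norm_sq_le {m : Measure (Op d)} (h : IsStoch m) :
    ∫ V : Op d, ‖V‖ ^ 2 ∂m ≤ (d : ℝ) ^ 2 := by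
  refine (integral_mono h.integrable_norm_sq (h.integrable_gT.const_mul (d : ℝ))
    norm_sq_le).trans (le_of_eq ?_)
  rw [integral_const_mul, h.integral_gT, pow_two]

lemma IsStoch.integrable_gT_mul {m : Measure (Op d)} (h : IsStoch m) (W : Op d) :
    Integrable (fun V => gT (V * W)) m :=
  integrable_finsetSum _ fun i _ => h.integrable_norm_apply_sq (W (stdB d i))

lemma IsStoch.integral_gT_mul {m : Measure (Op d)} (h : IsStoch m) (W : Op d) :
    ∫ V, gT (V * W) ∂m = gT W := by
  have : ∀ V : Op d, gT (V * W) = ∑ i, ‖V (W (stdB d i))‖ ^ 2 := fun V => rfl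
  simp_rw [this]
  rw [integral_finsetSum _ fun i _ => h.integrable_norm_apply_sq (W (stdB d i))]
  simp_rw [h.integral_norm_apply_sq]
  rfl

lemma continuous_mul_right' (W : Op d) : Continuous fun V : Op d => V * W :=
  continuous_id.mul continuous_const

lemma IsStoch.integrable_gR_mul {m : Measure (Op d)} (h : IsStoch m) (W : Op d) :
    Integrable (fun V => gR (V * W)) m :=
  (h.integrable_gT_mul W).mono' (continuous_gR.comp (continuous_mul_right' W)).aestronglyMeasurable
    (Filter.Eventually.of_forall fun V => by
      rw [Real.norm_of_nonneg (gR_nonneg _)]; exact gR_le_gT _)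

lemma IsStoch.integrable_gR {m : Measure (Op d)} (h : IsStoch m) : Integrable gR m := by
  simpa using h.integrable_gR_mul 1

lemma IsStoch.integrable_gPhi {m : Measure (Op d)} (h : IsStoch m) : Integrable gPhi m :=
  h.integrable_gT.sub h.integrable_gR

lemma IsStoch.integrable_gram_mul {m : Measure (Op d)} (h : IsStoch m) (W : Op d) :
    Integrable (fun V => gram (V * W)) m :=
  (h.integrable_gT_mul W).mono'
    (continuous_gram.comp (continuous_mul_right' W)).aestronglyMeasurable
    (Filter.Eventually.of_forall fun _ => norm_gram_le _)

/-- Polarization of the weak normalization. -/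
lemma IsStoch.integral_inner_apply {m : Measure (Op d)} (h : IsStoch m) (a b : Vec d) :
    ∫ V : Op d, inner ℂ (V a) (V b) ∂m = inner ℂ a b := by
  have hi : ∀ x : Vec d, Integrable (fun V : Op d => ((‖V x‖ ^ 2 : ℝ) : ℂ)) m := fun x =>
    (h.integrable_norm_apply_sq x).ofReal (𝕜 := ℂ)
  have e : ∀ V : Op d, inner ℂ (V a) (V b) =
      (((‖V (a + b)‖ ^ 2 : ℝ) : ℂ) - ((‖V (a - b)‖ ^ 2 : ℝ) : ℂ) +
        (((‖V (a - Complex.I • b)‖ ^ 2 : ℝ) : ℂ) -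
        ((‖V (a + Complex.I • b)‖ ^ 2 : ℝ) : ℂ)) * Complex.I) / 4 := fun V => by
    rw [inner_eq_sum_norm_sq_div_four]
    simp only [map_add, map_sub, map_smul]
    push_cast; rfl
  simp_rw [e]
  have hs : ∀ x y : Vec d, Integrable (fun V : Op d =>
      ((‖V x‖ ^ 2 : ℝ) : ℂ) - ((‖V y‖ ^ 2 : ℝ) : ℂ)) m := fun x y => (hi x).sub (hi y)
  rw [integral_div, integral_add (hs _ _) ((hs _ _).mul_const _),
    integral_mul_const, integral_sub (hi _) (hi _), integral_sub (hi _) (hi _)]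
  have e2 : ∀ x : Vec d, ∫ V : Op d, ((‖V x‖ ^ 2 : ℝ) : ℂ) ∂m = ((‖x‖ ^ 2 : ℝ) : ℂ) := fun x => by
    rw [integral_complex_ofReal, h.integral_norm_apply_sq]
  simp only [e2]
  rw [inner_eq_sum_norm_sq_div_four]
  push_cast; rfl

/-- The Gram matrix is preserved in mean by left multiplication; testing against a fixed `g` is all
that the convexity argument needs. -/
lemma IsStoch.integral_inner_gram {m : Measure (Op d)} (h : IsStoch m) (W : Op d)
    (g : EuclideanSpace ℂ (Fin d × Fin d)) :
    ∫ V, inner ℂ g (gram (V * W)) ∂m = inner ℂ g (gram W) := by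
  have hc : ∀ p, Integrable (fun V : Op d => gram (V * W) p) m := fun p =>
    (h.integrable_gram_mul W).norm.mono'
      ((PiLp.continuous_apply 2 _ p).comp
        (continuous_gram.comp (continuous_mul_right' W))).aestronglyMeasurable
      (Filter.Eventually.of_forall fun V => PiLp.norm_apply_le _ p)
  simp only [PiLp.inner_apply]
  rw [integral_finsetSum _ fun p _ => ((hc p).const_inner (g p))]
  refine Finset.sum_congr rfl fun p _ => ?_
  have : ∀ V : Op d, inner ℂ (g p) (gram (V * W) p) =
      inner ℂ (V (W (stdB d p.1))) (V (W (stdB d p.2))) * (starRingEnd ℂ) (g p) := fun V => rfl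
  simp_rw [this]
  rw [integral_mul_const, h.integral_inner_apply]
  rfl

/-- The weighted squared deviation between the normalized Gram matrices of `V W` and `W`. -/
def dev (V W : Op d) : ℝ :=
  gT (V * W) * ‖((gT (V * W))⁻¹ : ℝ) • gram (V * W) - ((gT W)⁻¹ : ℝ) • gram W‖ ^ 2

lemma dev_nonneg (V W : Op d) : 0 ≤ dev V W := mul_nonneg (gT_nonneg _) (sq_nonneg _)

/-- Expand the square in `dev`. Apart from `dev` itself, the right side is linear in `gram (V * W)`
and `gT (V * W)`, whose means are known. -/
lemma gR_mul_eq (V W : Op d) :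
    gR (V * W) = 2 * (gT W)⁻¹ * RCLike.re (inner ℂ (gram W) (gram (V * W)))
      - gT (V * W) * ((gT W)⁻¹ ^ 2 * ‖gram W‖ ^ 2) + dev V W := by
  have hin : RCLike.re (inner ℂ (((gT (V * W))⁻¹ : ℝ) • gram (V * W)) (((gT W)⁻¹ : ℝ) • gram W)) =
      (gT (V * W))⁻¹ * ((gT W)⁻¹ * RCLike.re (inner ℂ (gram W) (gram (V * W)))) := by
    rw [RCLike.real_smul_eq_coe_smul (K := ℂ), RCLike.real_smul_eq_coe_smul (K := ℂ),
      inner_smul_left, inner_smul_right, RCLike.conj_ofReal, RCLike.re_ofReal_mul,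
      RCLike.re_ofReal_mul, ← inner_conj_symm, RCLike.conj_re]
  rw [dev, @norm_sub_sq ℂ, hin, norm_smul, norm_smul, mul_pow, mul_pow, norm_inv, norm_inv,
    Real.norm_of_nonneg (gT_nonneg _), Real.norm_of_nonneg (gT_nonneg _), gR]
  by_cases h0 : gT (V * W) = 0
  · simp [h0, gram_eq_zero_of_gT h0]
  · generalize (gT W)⁻¹ = s
    field_simp
    ring

/-- Jensen's inequality with an explicit defect: the two linear terms integrate to `2 gR W - gR W`,
and what remains is the mean of `dev`. -/
lemma IsStoch.integral_gR_mul {m : Measure (Op d)} (h : IsStoch m) (W : Op d) :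
    Integrable (fun V => dev V W) m ∧ ∫ V, gR (V * W) ∂m = gR W + ∫ V, dev V W ∂m := by
  have h1 : Integrable (fun V : Op d => 2 * (gT W)⁻¹ *
      RCLike.re (inner ℂ (gram W) (gram (V * W)))) m :=
    (((h.integrable_gram_mul W).const_inner (𝕜 := ℂ) (gram W)).re).const_mul _
  have h2 : Integrable (fun V : Op d => gT (V * W) * ((gT W)⁻¹ ^ 2 * ‖gram W‖ ^ 2)) m :=
    (h.integrable_gT_mul W).mul_const _
  have h3 : Integrable (fun V => dev V W) m := by
    have := ((h.integrable_gR_mul W).sub h1).add h2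
    refine this.congr (Filter.Eventually.of_forall fun V => ?_)
    simp only [Pi.add_apply, Pi.sub_apply]
    rw [gR_mul_eq]; ring
  refine ⟨h3, ?_⟩
  simp_rw [gR_mul_eq]
  have h12 : Integrable (fun V : Op d => 2 * (gT W)⁻¹ *
      RCLike.re (inner ℂ (gram W) (gram (V * W))) -
      gT (V * W) * ((gT W)⁻¹ ^ 2 * ‖gram W‖ ^ 2)) m := h1.sub h2
  rw [integral_add h12 h3, integral_sub h1 h2, integral_const_mul, integral_mul_const,
    h.integral_gT_mul, integral_re ((h.integrable_gram_mul W).const_inner _),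
    h.integral_inner_gram, ← norm_sq_eq_re_inner, gR]
  congr 1
  by_cases h0 : gT W = 0
  · simp [h0]
  · field_simp; ring

/-! ### Purification -/

/-- The gain of the convex functional `gR` under left multiplication by an `m`-random factor. -/
def gain (m : Measure (Op d)) (W : Op d) : ℝ := ∫ V, gR (V * W) ∂m - gR W

lemma IsStoch.gain_eq {m : Measure (Op d)} (h : IsStoch m) (W : Op d) :
    gain m W = ∫ V, dev V W ∂m := by
  rw [gain, (h.integral_gR_mul W).2]; ring

lemma IsStoch.gain_nonneg {m : Measure (Op d)} (h : IsStoch m) (W : Op d) : 0 ≤ gain m W := by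
  rw [h.gain_eq]; exact integral_nonneg fun V => dev_nonneg V W

lemma gain_smul (m : Measure (Op d)) (c : ℂ) (W : Op d) :
    gain m (c • W) = ‖c‖ ^ 2 * gain m W := by
  simp_rw [gain, mul_smul_comm, gR_smul, integral_const_mul]
  ring

lemma IsStoch.continuous_gain {m : Measure (Op d)} (h : IsStoch m) : Continuous (gain m) := by
  refine Continuous.sub ?_ continuous_gR
  rw [continuous_iff_continuousAt]
  intro W₀
  refine continuousAt_of_dominated (bound := fun V => ‖V‖ ^ 2 * (gT W₀ + 1)) ?_ ?_
    (h.integrable_norm_sq.mul_const _) ?_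
  · exact Filter.Eventually.of_forall fun W =>
      (continuous_gR.comp (continuous_mul_right' W)).aestronglyMeasurable
  · have : ∀ᶠ W in nhds W₀, gT W < gT W₀ + 1 :=
      continuous_gT.continuousAt.eventually_lt continuousAt_const (by linarith)
    filter_upwards [this] with W hW
    refine Filter.Eventually.of_forall fun V => ?_
    rw [Real.norm_of_nonneg (gR_nonneg _)]
    exact (gR_le_gT _).trans ((gT_mul_le V W).trans
      (mul_le_mul_of_nonneg_left hW.le (sq_nonneg _)))
  · exact Filter.Eventually.of_forall fun V =>
      (continuous_gR.comp (continuous_const.mul continuous_id)).continuousAt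

lemma IsStoch.integral_gR_mconv {m m' : Measure (Op d)} [SFinite m] [SFinite m']
    (h : IsStoch m) (h' : IsStoch m') (W : Op d) :
    Integrable (fun V => ∫ V', gR (V' * (V * W)) ∂m') m ∧
    ∫ Z, gR (Z * W) ∂(m' ∗ₘ m) = ∫ V, ∫ V', gR (V' * (V * W)) ∂m' ∂m := by
  have hint : Integrable (fun Z => gR (Z * W)) (m' ∗ₘ m) := (h'.mconv h).integrable_gR_mul W
  have hp : Integrable (fun p : Op d × Op d => gR (p.1 * p.2 * W)) (m'.prod m) :=
    (integrable_map_measure hint.1 measurable_mul.aemeasurable).mp hint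
  have e : ∀ V V' : Op d, gR (V' * (V * W)) = gR (V' * V * W) := fun V V' => by rw [mul_assoc]
  simp_rw [e]
  refine ⟨hp.integral_prod_right, ?_⟩
  rw [integral_mconv hint]
  exact integral_integral_swap hp

/-- The additional factor acts on `V * W`, where its own gain is nonnegative. -/
lemma IsStoch.gain_le_mconv {m m' : Measure (Op d)} [SFinite m] [SFinite m']
    (h : IsStoch m) (h' : IsStoch m') (W : Op d) : gain m W ≤ gain (m' ∗ₘ m) W := by
  obtain ⟨h1, h2⟩ := h.integral_gR_mconv h' W
  rw [gain, gain, h2]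
  refine sub_le_sub_right (integral_mono (h.integrable_gR_mul W) h1 fun V => ?_) _
  have := h'.gain_nonneg (V * W)
  rw [gain] at this
  linarith

lemma gain_powMeas_mono {μ : Measure (Op d)} [SFinite μ] (h : IsStoch μ) (W : Op d) :
    Monotone fun k => gain (powMeas μ k) W :=
  monotone_nat_of_le_succ fun k => (isStoch_powMeas h k).gain_le_mconv h W

lemma gram_eq_smul_of_dev {V W : Op d} (h : dev V W = 0) :
    ∃ c : ℝ, gram (V * W) = c • gram W := by
  rcases mul_eq_zero.mp h with h | h
  · exact ⟨0, by rw [gram_eq_zero_of_gT h, zero_smul]⟩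
  · by_cases h0 : gT (V * W) = 0
    · exact ⟨0, by rw [gram_eq_zero_of_gT h0, zero_smul]⟩
    refine ⟨gT (V * W) * (gT W)⁻¹, ?_⟩
    have h2 := sub_eq_zero.mp (norm_eq_zero.mp (pow_eq_zero_iff two_ne_zero |>.mp h))
    rw [mul_smul, ← h2, smul_smul, mul_inv_cancel₀ h0, one_smul]

lemma inner_apply_eq_sum (W : Op d) (a b : Vec d) :
    inner ℂ (W a) (W b) = ∑ i, ∑ j, (starRingEnd ℂ) ((stdB d).repr a i) *
      ((stdB d).repr b j) * gram W (i, j) := by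
  rw [apply_eq_sum W a, apply_eq_sum W b, sum_inner]
  refine Finset.sum_congr rfl fun i _ => ?_
  rw [inner_sum]
  refine Finset.sum_congr rfl fun j _ => ?_
  rw [inner_smul_left, inner_smul_right, gram_apply, mul_assoc]

lemma inner_mul_apply_of_gram {V W : Op d} {c : ℝ} (h : gram (V * W) = c • gram W) (a b : Vec d) :
    inner ℂ (V (W a)) (V (W b)) = (c : ℂ) * inner ℂ (W a) (W b) := by
  have h1 := inner_apply_eq_sum (V * W) a b
  rw [h] at h1
  change inner ℂ (V (W a)) (V (W b)) = _ at h1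
  rw [h1, inner_apply_eq_sum W a b, Finset.mul_sum]
  refine Finset.sum_congr rfl fun i _ => ?_
  rw [Finset.mul_sum]
  refine Finset.sum_congr rfl fun j _ => ?_
  rw [PiLp.smul_apply, Complex.real_smul]
  ring

/-- Images of basis vectors are collinear, so every area vanishes. -/
lemma gPhi_eq_zero_of_finrank {W : Op d}
    (h : Module.finrank ℂ (LinearMap.range (W : Vec d →ₗ[ℂ] Vec d)) = 1) : gPhi W = 0 := by
  obtain ⟨⟨u, _⟩, -, hu⟩ := finrank_eq_one_iff'.mp h
  have hu' : ∀ i, ∃ c : ℂ, c • u = W (stdB d i) := fun i => by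
    obtain ⟨c, hc⟩ := hu ⟨W (stdB d i), ⟨_, rfl⟩⟩
    exact ⟨c, congrArg Subtype.val hc⟩
  choose c hc using hu'
  have hsq : gT W ^ 2 - ‖gram W‖ ^ 2 = 0 := by
    rw [gT_sq_sub]
    refine Finset.sum_eq_zero fun i _ => Finset.sum_eq_zero fun j _ => ?_
    rw [← hc i, ← hc j, area_smul_left, area_smul_right]
    simp [area, inner_self_eq_norm_sq_to_K, ← mul_pow]
    right; right
    ring_nf; simp
  rw [gPhi, gR]
  by_cases h0 : gT W = 0
  · simp [h0]
  · field_simp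
    simpa using hsq

/-- A null gain makes `dev` vanish almost everywhere, so `W^*V^*VW` is proportional to `W^*W`. On
the range of `W` this says `π V^*V π ∝ π`, for every length of the product, and (Pur) gives rank
one. -/
lemma gPhi_eq_zero_of_gain {μ : Measure (Op d)} [SigmaFinite μ] (h : IsStoch μ) (hPur : Pur μ)
    {W : Op d} (hW : ∀ k, gain (powMeas μ k) W = 0) : gPhi W = 0 := by
  by_cases hW0 : W = 0
  · subst hW0; simp [gPhi, gR, gT]
  let F : Submodule ℂ (Vec d) := LinearMap.range (W : Vec d →ₗ[ℂ] Vec d)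
  have hrange : LinearMap.range ((F.starProjection : Op d) : Vec d →ₗ[ℂ] Vec d) = F :=
    Submodule.range_starProjection F
  refine gPhi_eq_zero_of_finrank ?_
  change Module.finrank ℂ F = 1
  rw [← hrange]
  refine hPur F.starProjection (F.isIdempotentElem_starProjection) ?_ ?_ fun n => ?_
  · exact (isSelfAdjoint_starProjection F)
  · intro h0
    apply hW0
    ext1 x
    have h1 : F.starProjection (W x) = W x :=
      Submodule.starProjection_eq_self_iff.mpr ⟨x, rfl⟩
    rw [h0] at h1
    exact h1.symm
  · have hst := isStoch_powMeas h n
    have h1 := hW n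
    rw [hst.gain_eq, integral_eq_zero_iff_of_nonneg (fun V => dev_nonneg V W)
      (hst.integral_gR_mul W).1, powMeas_eq_map] at h1
    have h2 := ae_of_ae_map (measurable_prodW n).aemeasurable h1
    filter_upwards [h2] with v hv
    obtain ⟨c, hc⟩ := gram_eq_smul_of_dev hv
    refine ⟨c, ?_⟩
    ext1 y
    refine ext_inner_left ℂ fun x => ?_
    obtain ⟨a, ha⟩ : F.starProjection x ∈ F := F.starProjection_apply_mem x
    obtain ⟨b, hb⟩ : F.starProjection y ∈ F := F.starProjection_apply_mem y
    have ha' : W a = F.starProjection x := ha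
    have hb' : W b = F.starProjection y := hb
    have key := inner_mul_apply_of_gram hc a b
    rw [ha', hb'] at key
    change inner ℂ x (F.starProjection (adj (prodW n v) (prodW n v (F.starProjection y)))) =
      inner ℂ x ((c : ℂ) • F.starProjection y)
    rw [← Submodule.inner_starProjection_left_eq_right, adj,
      ContinuousLinearMap.adjoint_inner_right, key, inner_smul_right,
      Submodule.inner_starProjection_left_eq_right,
      Submodule.starProjection_eq_self_iff.mpr (F.starProjection_apply_mem y)]

/-- Compactness. Counterexamples for each `k`, scaled to norm one, satisfy `k * gain_k ≤ gPhi ≤ gT ≤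
d`. Gains increase with the order, so a limit point has null gain at every order, hence `gPhi = 0`,
while the first term forces `gPhi ≥ ε gT > 0`. The integer `k` serves both as order and as constant.
-/
lemma exists_gPhi_le {μ : Measure (Op d)} [SigmaFinite μ] (h : IsStoch μ) (hPur : Pur μ)
    {ε : ℝ} (hε : 0 < ε) :
    ∃ k : ℕ, ∀ W : Op d, gPhi W ≤ ε * gT W + k * gain (powMeas μ k) W := by
  by_contra! hcon
  choose W hW using hcon
  have hne : ∀ k, W k ≠ 0 := fun k h0 => by
    have h1 := hW k
    have h2 := gPhi_le_gT (W k)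
    have h3 : gT (W k) = 0 := by rw [h0]; simp [gT]
    have h4 : 0 ≤ k * gain (powMeas μ k) (W k) :=
      mul_nonneg (Nat.cast_nonneg _) ((isStoch_powMeas h k).gain_nonneg _)
    rw [h3] at h1 h2
    linarith
  let U : ℕ → Op d := fun k => ((‖W k‖⁻¹ : ℝ) : ℂ) • W k
  have hUn : ∀ k, ‖U k‖ = 1 := fun k => by
    have : ‖W k‖ ≠ 0 := norm_ne_zero_iff.mpr (hne k)
    simp [U, norm_smul, this]
  have hU : ∀ k, ε * gT (U k) + k * gain (powMeas μ k) (U k) < gPhi (U k) := fun k => by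
    have hp : 0 < ‖((‖W k‖⁻¹ : ℝ) : ℂ)‖ ^ 2 := by
      have := norm_pos_iff.mpr (hne k)
      rw [Complex.norm_real, norm_inv, norm_norm]
      positivity
    have h1 := mul_lt_mul_of_pos_left (hW k) hp
    simp only [U, gPhi, gT_smul, gR_smul, gain_smul] at h1 ⊢
    linarith
  obtain ⟨V, hV, φ, hφ, hlim⟩ := (isCompact_sphere (0 : Op d) 1).tendsto_subseq
    (x := U) (fun k => by simp [hUn k])
  have hVn : ‖V‖ = 1 := by simpa using hV
  have hgain : ∀ j, gain (powMeas μ j) V = 0 := by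
    intro j
    refine le_antisymm ?_ ((isStoch_powMeas h j).gain_nonneg _)
    have h1 : Filter.Tendsto (fun k => gain (powMeas μ j) (U (φ k))) Filter.atTop
        (nhds (gain (powMeas μ j) V)) :=
      ((isStoch_powMeas h j).continuous_gain.tendsto V).comp hlim
    have h2 : Filter.Tendsto (fun k => (d : ℝ) / ((φ k : ℕ) : ℝ)) Filter.atTop (nhds 0) :=
      (tendsto_const_div_atTop_nhds_zero_nat (d : ℝ)).comp hφ.tendsto_atTop
    -- For fixed `j` and large `k`, monotonicity bounds the gain of order `j` by that of order `φ
    -- k`, which is at most `d / φ k`.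
    refine le_of_tendsto_of_tendsto h1 h2 ?_
    filter_upwards [Filter.eventually_ge_atTop (j + 1)] with k hk
    have hjk : j + 1 ≤ φ k := hk.trans (hφ.id_le k)
    have hpos : (0 : ℝ) < φ k := by exact_mod_cast (by omega : 0 < φ k)
    rw [le_div_iff₀ hpos]
    have h3 := gain_powMeas_mono h (U (φ k)) (by omega : j ≤ φ k)
    have h4 := hU (φ k)
    have h5 := gPhi_le_gT (U (φ k))
    have h6 := gT_le (U (φ k))
    rw [hUn] at h6
    have h7 : 0 ≤ ε * gT (U (φ k)) := mul_nonneg hε.le (gT_nonneg _)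
    have h8 := mul_le_mul_of_nonneg_right h3 hpos.le
    simp only at h8
    linarith
  have hphi := gPhi_eq_zero_of_gain h hPur hgain
  have hle : ε * gT V ≤ gPhi V := by
    have h1 : Filter.Tendsto (fun k => ε * gT (U (φ k))) Filter.atTop (nhds (ε * gT V)) :=
      ((continuous_const.mul continuous_gT).tendsto V).comp hlim
    have h2 : Filter.Tendsto (fun k => gPhi (U (φ k))) Filter.atTop (nhds (gPhi V)) :=
      ((continuous_gT.sub continuous_gR).tendsto V).comp hlim
    refine le_of_tendsto_of_tendsto' h1 h2 fun k => ?_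
    have h4 := hU (φ k)
    have h5 : 0 ≤ (φ k : ℝ) * gain (powMeas μ (φ k)) (U (φ k)) :=
      mul_nonneg (Nat.cast_nonneg _) ((isStoch_powMeas h _).gain_nonneg _)
    linarith
  rw [hphi] at hle
  have h0 : gT V = 0 := le_antisymm (by nlinarith) (gT_nonneg V)
  rw [eq_zero_of_gT_eq_zero h0] at hVn
  simp at hVn

/-- The mean gain of order `k` under the `n`-th power is the increment `a (k + n) - a n` of a
bounded monotone sequence, so it tends to zero with `n` while `k` stays fixed. -/
lemma exists_integral_gPhi_le {μ : Measure (Op d)} [SigmaFinite μ] (h : IsStoch μ)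
    (hPur : Pur μ) {ε : ℝ} (hε : 0 < ε) : ∃ n, 1 ≤ n ∧ ∫ W, gPhi W ∂(powMeas μ n) ≤ ε := by
  have hst := isStoch_powMeas h
  -- The mean of `gT` is `d`, so this tolerance costs at most `ε / 2`; the `+ 1` avoids division by
  -- zero.
  obtain ⟨k, hk⟩ := exists_gPhi_le h hPur (ε := ε / (2 * (d + 1))) (by positivity)
  let a : ℕ → ℝ := fun n => ∫ W, gR W ∂(powMeas μ n)
  have hadd : ∀ j n, Integrable (gain (powMeas μ j)) (powMeas μ n) ∧
      ∫ W, gain (powMeas μ j) W ∂(powMeas μ n) = a (j + n) - a n := fun j n => by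
    obtain ⟨h1, h2⟩ := (hst n).integral_gR_mconv (hst j) 1
    simp only [mul_one] at h1 h2
    refine ⟨h1.sub (hst n).integrable_gR, ?_⟩
    simp only [a, powMeas_add, h2]
    exact integral_sub h1 (hst n).integrable_gR
  have hmono : Monotone a := monotone_nat_of_le_succ fun n => by
    have h1 := (hadd 1 n).2
    have h2 : 0 ≤ ∫ W, gain (powMeas μ 1) W ∂(powMeas μ n) :=
      integral_nonneg fun W => (hst 1).gain_nonneg W
    rw [add_comm 1 n] at h1
    linarith
  have hbdd : BddAbove (Set.range a) := ⟨d, by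
    rintro _ ⟨n, rfl⟩
    rw [← (hst n).integral_gT]
    exact integral_mono (hst n).integrable_gR (hst n).integrable_gT gR_le_gT⟩
  have hlim := tendsto_atTop_ciSup hmono hbdd
  have hlim2 : Filter.Tendsto (fun n => (k : ℝ) * (a (k + n) - a n)) Filter.atTop (nhds 0) := by
    have h1 : Filter.Tendsto (fun n => a (k + n)) Filter.atTop (nhds (⨆ i, a i)) :=
      hlim.comp (Filter.tendsto_atTop_mono (fun n => Nat.le_add_left n k) Filter.tendsto_id)
    simpa using (h1.sub hlim).const_mul (k : ℝ)
  obtain ⟨n, hn, hn1⟩ := ((hlim2.eventually_le_const (half_pos hε)).and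
    (Filter.eventually_ge_atTop 1)).exists
  refine ⟨n, hn1, ?_⟩
  calc ∫ W, gPhi W ∂(powMeas μ n)
      ≤ ∫ W, (ε / (2 * (d + 1)) * gT W + k * gain (powMeas μ k) W) ∂(powMeas μ n) :=
        integral_mono (hst n).integrable_gPhi
          (((hst n).integrable_gT.const_mul _).add ((hadd k n).1.const_mul _)) hk
    _ = ε / (2 * (d + 1)) * d + k * (a (k + n) - a n) := by
        rw [integral_add ((hst n).integrable_gT.const_mul _) ((hadd k n).1.const_mul _),
          integral_const_mul, integral_const_mul, (hst n).integral_gT, (hadd k n).2]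
    _ ≤ ε / 2 + ε / 2 := by
        refine add_le_add ?_ hn
        rw [div_mul_eq_mul_div, div_le_div_iff₀ (by positivity) two_pos]
        nlinarith
    _ = ε := by ring

lemma IsStoch.integrable_areaSum {m : Measure (Op d)} (h : IsStoch m) : Integrable areaSum m := by
  refine ((((h.integrable_gT.const_mul 1).add (h.integrable_gPhi.const_mul 1⁻¹)).const_mul
    ((d : ℝ) ^ 2))).mono' continuous_areaSum.aestronglyMeasurable
    (Filter.Eventually.of_forall fun W => ?_)
  rw [Real.norm_of_nonneg (areaSum_nonneg W)]
  exact areaSum_le W one_pos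

/-- Under purification the mean area contraction coefficient becomes arbitrarily small. -/
lemma exists_integral_areaSum_le {μ : Measure (Op d)} [SigmaFinite μ] (h : IsStoch μ)
    (hPur : Pur μ) {ε : ℝ} (hε : 0 < ε) : ∃ n, 1 ≤ n ∧ ∫ W, areaSum W ∂(powMeas μ n) ≤ ε := by
  have hst := isStoch_powMeas h
  set D : ℝ := d + 1 with hD
  have hD0 : 0 < D := by positivity
  -- Chosen so that `D² * η * D = ε / 2`; the tolerance on `gPhi` below makes the other term `ε / 2`
  -- as well.
  set η : ℝ := ε / (2 * D ^ 3) with hη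
  have hη0 : 0 < η := by positivity
  obtain ⟨n, hn1, hn⟩ :=
    exists_integral_gPhi_le h hPur (ε := η * (ε / (2 * D ^ 2))) (by positivity)
  refine ⟨n, hn1, ?_⟩
  have hi : Integrable (fun W => (d : ℝ) ^ 2 * (η * gT W + η⁻¹ * gPhi W)) (powMeas μ n) :=
    (((hst n).integrable_gT.const_mul _).add ((hst n).integrable_gPhi.const_mul _)).const_mul _
  calc ∫ W, areaSum W ∂(powMeas μ n)
      ≤ ∫ W, (d : ℝ) ^ 2 * (η * gT W + η⁻¹ * gPhi W) ∂(powMeas μ n) :=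
        integral_mono (hst n).integrable_areaSum hi fun W => areaSum_le W hη0
    _ = (d : ℝ) ^ 2 * (η * d + η⁻¹ * ∫ W, gPhi W ∂(powMeas μ n)) := by
        rw [integral_const_mul, integral_add ((hst n).integrable_gT.const_mul _)
          ((hst n).integrable_gPhi.const_mul _), integral_const_mul, integral_const_mul,
          (hst n).integral_gT]
    _ ≤ D ^ 2 * (η * D + η⁻¹ * (η * (ε / (2 * D ^ 2)))) := by
        have hd : (d : ℝ) ≤ D := by rw [hD]; linarith
        have h0 : 0 ≤ ∫ W, gPhi W ∂(powMeas μ n) := integral_nonneg gPhi_nonneg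
        gcongr
    _ = ε := by rw [hη]; field_simp; ring

/-! ### The averaging operators on functions -/

/-- The integrand `‖W x‖² f(W · x)`. -/
def wact (f : PState d → ℂ) (W : Op d) (x : PState d) : ℂ :=
  ‖W (unitRep x)‖ ^ 2 • f (act W x)

/-- The averaging operator `f ↦ ∫ ‖W x‖² f(W · x) dm(W)`. -/
def avg (m : Measure (Op d)) (f : PState d → ℂ) (x : PState d) : ℂ := ∫ W, wact f W x ∂m

lemma measurable_wact {f : PState d → ℂ} (hf : Measurable f) :
    Measurable fun p : Op d × PState d => wact f p.1 p.2 :=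
  continuous_weight.measurable.smul (hf.comp measurable_act)

lemma measurable_wact_left {f : PState d → ℂ} (hf : Measurable f) (x : PState d) :
    Measurable fun W : Op d => wact f W x := by
  have h : Measurable fun W : Op d => (W, x) := measurable_prodMk_right
  have h2 := (measurable_wact hf).comp h
  exact h2

lemma norm_wact_le {f : PState d → ℂ} {B : ℝ} (hB : ∀ x, ‖f x‖ ≤ B) (W : Op d) (x : PState d) :
    ‖wact f W x‖ ≤ ‖W (unitRep x)‖ ^ 2 * B := by
  rw [wact, norm_smul, Real.norm_of_nonneg (sq_nonneg _)]
  exact mul_le_mul_of_nonneg_left (hB _) (sq_nonneg _)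

lemma IsStoch.integrable_wact {m : Measure (Op d)} (h : IsStoch m) {f : PState d → ℂ}
    (hf : Measurable f) {B : ℝ} (hB : ∀ x, ‖f x‖ ≤ B) (x : PState d) :
    Integrable (fun W => wact f W x) m :=
  ((h.integrable_norm_apply_sq (unitRep x)).mul_const B).mono'
    ((measurable_wact hf).comp measurable_prodMk_right).aestronglyMeasurable
    (Filter.Eventually.of_forall fun W => norm_wact_le hB W x)

lemma IsStoch.integral_weight {m : Measure (Op d)} (h : IsStoch m) (x : PState d) :
    ∫ W : Op d, ‖W (unitRep x)‖ ^ 2 ∂m = 1 := by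
  rw [h.integral_norm_apply_sq, norm_unitRep, one_pow]

lemma IsStoch.norm_avg_le {m : Measure (Op d)} (h : IsStoch m) {f : PState d → ℂ}
    {B : ℝ} (hB : ∀ x, ‖f x‖ ≤ B) (x : PState d) : ‖avg m f x‖ ≤ B := by
  calc ‖avg m f x‖ ≤ ∫ W : Op d, ‖W (unitRep x)‖ ^ 2 * B ∂m :=
        norm_integral_le_of_norm_le ((h.integrable_norm_apply_sq _).mul_const B)
          (Filter.Eventually.of_forall fun W => norm_wact_le hB W x)
    _ = B := by rw [integral_mul_const, h.integral_weight, one_mul]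

lemma exists_norm_le {f : PState d → ℂ} (hf : Continuous f) : ∃ B : ℝ, 0 ≤ B ∧ ∀ x, ‖f x‖ ≤ B := by
  obtain ⟨B, hB⟩ := isCompact_univ.exists_bound_of_continuousOn hf.continuousOn
  exact ⟨max B 0, le_max_right _ _, fun x => (hB x trivial).trans (le_max_left _ _)⟩

/-- The action may be discontinuous where `W x = 0`, but the weight tends to zero there and `f` is
bounded. -/
lemma continuous_wact {f : PState d → ℂ} (hf : Continuous f) :
    Continuous fun p : Op d × PState d => wact f p.1 p.2 := by
  obtain ⟨B, -, hB⟩ := exists_norm_le hf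
  rw [continuous_iff_continuousAt]
  intro p
  by_cases h : p.1 (unitRep p.2) = 0
  · have h0 : wact f p.1 p.2 = 0 := by simp [wact, h]
    rw [ContinuousAt, h0]
    have h1 : Filter.Tendsto (fun p : Op d × PState d => ‖p.1 (unitRep p.2)‖ ^ 2 * B) (nhds p)
        (nhds 0) := by
      have := (continuous_weight (d := d)).tendsto p |>.mul_const B
      simpa [h] using this
    exact squeeze_zero_norm (fun p => norm_wact_le hB p.1 p.2) h1
  · exact continuous_weight.continuousAt.smul (hf.continuousAt.comp (continuousAt_act h))

lemma continuous_wact_right {f : PState d → ℂ} (hf : Continuous f) (W : Op d) :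
    Continuous fun x : PState d => wact f W x := by
  have h : Continuous fun x : PState d => (W, x) := by fun_prop
  have h2 := (continuous_wact hf).comp h
  exact h2

lemma IsStoch.continuous_avg {m : Measure (Op d)} (h : IsStoch m) {f : PState d → ℂ}
    (hf : Continuous f) : Continuous (avg m f) := by
  obtain ⟨B, hB0, hB⟩ := exists_norm_le hf
  refine continuous_of_dominated (F := fun x W => wact f W x) (bound := fun W => ‖W‖ ^ 2 * B) (fun x => ?_) (fun x => ?_)
    (h.integrable_norm_sq.mul_const B) ?_
  · exact (h.integrable_wact hf.measurable hB x).1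
  · refine Filter.Eventually.of_forall fun W => (norm_wact_le hB W x).trans ?_
    refine mul_le_mul_of_nonneg_right (pow_le_pow_left₀ (norm_nonneg _) ?_ 2) hB0
    simpa [norm_unitRep] using W.le_opNorm (unitRep x)
  · exact Filter.Eventually.of_forall fun W => continuous_wact_right hf W

lemma wact_mul (f : PState d → ℂ) (V W : Op d) (x : PState d) :
    wact f (V * W) x = ‖W (unitRep x)‖ ^ 2 • wact f V (act W x) := by
  have h1 := norm_apply_act_mul V W x
  rw [wact, wact, smul_smul, ← mul_pow, mul_comm ‖W (unitRep x)‖, h1]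
  by_cases h : (V * W) (unitRep x) = 0
  · simp [h]
  · rw [act_mul h]

/-- The semigroup law, from the cocycle identity `wact_mul` and Fubini. The factor drawn from `m`
acts first, so `avg m` is the outer operator. -/
lemma IsStoch.avg_mconv {m m' : Measure (Op d)} [SFinite m] [SFinite m'] (h : IsStoch m)
    (h' : IsStoch m') {f : PState d → ℂ} (hf : Measurable f) {B : ℝ} (hB : ∀ x, ‖f x‖ ≤ B) :
    avg (m' ∗ₘ m) f = avg m (avg m' f) := by
  funext x
  have hint : Integrable (fun Z => wact f Z x) (m' ∗ₘ m) := (h'.mconv h).integrable_wact hf hB x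
  have hp : Integrable (fun p : Op d × Op d => wact f (p.1 * p.2) x) (m'.prod m) :=
    (integrable_map_measure hint.1 measurable_mul.aemeasurable).mp hint
  have h1 : avg (m' ∗ₘ m) f x = ∫ W, ∫ V, wact f (V * W) x ∂m' ∂m := by
    rw [avg, integral_mconv hint]
    exact integral_integral_swap hp
  rw [h1, avg]
  refine integral_congr_ae (Filter.Eventually.of_forall fun W => ?_)
  simp_rw [wact_mul, integral_smul]
  rfl

lemma avg_dirac_one {f : PState d → ℂ} (hf : Measurable f) : avg (Measure.dirac 1) f = f := by
  funext x
  have hm := measurable_wact_left hf x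
  rw [avg, integral_dirac' _ _ hm.stronglyMeasurable, wact, act_one]
  simp [norm_unitRep]

lemma IsStoch.isMarkovKernel {μ : Measure (Op d)} [SFinite μ] (h : IsStoch μ) :
    IsMarkovKernel (transKernel μ) := by
  refine ⟨fun x => ⟨?_⟩⟩
  rw [transKernel_apply μ x MeasurableSet.univ]
  simp only [Set.indicator_univ, Pi.one_apply, one_mul]
  rw [h (unitRep x), ← ofReal_norm, norm_unitRep]
  simp

lemma transOp_eq_avg {μ : Measure (Op d)} [SFinite μ] {f : PState d → ℂ} (hf : Measurable f) :
    transOp μ f = avg μ f := by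
  funext x
  have hact : Measurable fun v : Op d => act v x := measurable_act.comp measurable_prodMk_right
  have hw : Measurable fun v : Op d => ‖v (unitRep x)‖ₑ ^ 2 :=
    (continuous_apply_vec _).measurable.enorm.pow_const 2
  have hlt : ∀ᵐ v ∂μ, ‖v (unitRep x)‖ₑ ^ 2 < ∞ :=
    Filter.Eventually.of_forall fun v => ENNReal.pow_lt_top enorm_lt_top
  have hk : transKernel μ x =
    (μ.withDensity fun v => ‖v (unitRep x)‖ₑ ^ 2).map fun v => act v x := rfl
  rw [transOp, hk, integral_map hact.aemeasurable hf.aestronglyMeasurable,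
    integral_withDensity_eq_integral_toReal_smul hw hlt, avg]
  refine integral_congr_ae (Filter.Eventually.of_forall fun v => ?_)
  simp [wact]

lemma IsStoch.integral_avg {μ : Measure (Op d)} [SFinite μ] (h : IsStoch μ)
    {ν : Measure (PState d)} [IsProbabilityMeasure ν] (hν : (transKernel μ).Invariant ν)
    {f : PState d → ℂ} (hf : Continuous f) : ∫ x, avg μ f x ∂ν = ∫ x, f x ∂ν := by
  have := h.isMarkovKernel
  obtain ⟨B, -, hB⟩ := exists_norm_le hf
  have hint : Integrable f (ν.bind (transKernel μ)) := by
    rw [hν]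
    exact (integrable_const B).mono' hf.aestronglyMeasurable (Filter.Eventually.of_forall hB)
  conv_rhs => rw [← hν]
  rw [Measure.comp_eq_comp_const_apply] at hint ⊢
  rw [Kernel.integral_comp hint, Kernel.const_apply, ← transOp_eq_avg hf.measurable]
  rfl

/-! ### The Lasota–Yorke inequality -/

/-- `f` is `α`-Hölder with constant `K`. -/
def HolderBd (α K : ℝ) (f : PState d → ℂ) : Prop := ∀ x y, ‖f x - f y‖ ≤ K * dist x y ^ α

lemma HolderBd.continuous {α K : ℝ} (hα : 0 < α) {f : PState d → ℂ} (h : HolderBd α K f) :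
    Continuous f := by
  rw [continuous_iff_continuousAt]
  intro x
  rw [ContinuousAt, tendsto_iff_norm_sub_tendsto_zero]
  have h1 : Filter.Tendsto (fun y => K * dist y x ^ α) (nhds x) (nhds 0) := by
    have h2 : Continuous fun y => K * dist y x ^ α :=
      continuous_const.mul ((continuous_id.dist continuous_const).rpow_const fun _ => Or.inr hα.le)
    have := h2.tendsto x
    simpa [hα.ne'] using this
  exact squeeze_zero (fun _ => norm_nonneg _) (fun y => h y x) h1

/-- A bound of the concave power that is affine in `s`, with a free scale `t`. It replaces Jensen's
inequality: the distance then enters linearly and can be integrated. -/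
lemma rpow_le_tangent {α s t : ℝ} (hα : 0 < α) (hα1 : α ≤ 1) (hs : 0 ≤ s) (ht : 0 < t) :
    s ^ α ≤ t ^ (α - 1) * s + t ^ α := by
  rcases le_total s t with h | h
  · exact (Real.rpow_le_rpow hs h hα.le).trans
      (le_add_of_nonneg_left (mul_nonneg (Real.rpow_nonneg ht.le _) hs))
  · have hs' : 0 < s := ht.trans_le h
    have h1 : s ^ α = s ^ (α - 1) * s := by
      rw [Real.rpow_sub_one hs'.ne', div_mul_cancel₀ _ hs'.ne']
    rw [h1]
    refine le_add_of_le_of_nonneg (mul_le_mul_of_nonneg_right ?_ hs) (Real.rpow_nonneg ht.le _)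
    exact Real.rpow_le_rpow_of_nonpos ht h (by linarith)

/-- Split so that `z - w` carries the smaller weight: `dist_act_mul_min_le` controls the image
distance only against the minimum of the two weights. -/
lemma norm_smul_sub_smul_le {a b B D : ℝ} {z w : ℂ} (ha : 0 ≤ a) (hb : 0 ≤ b) (hz : ‖z‖ ≤ B)
    (hw : ‖w‖ ≤ B) (hzw : ‖z - w‖ ≤ D) : ‖a • z - b • w‖ ≤ D * min a b + B * |a - b| := by
  rcases le_total a b with h | h
  · have : a • z - b • w = a • (z - w) + (a - b) • w := by module
    rw [this, min_eq_left h]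
    refine (norm_add_le _ _).trans (add_le_add ?_ ?_)
    · rw [norm_smul, Real.norm_of_nonneg ha, mul_comm]
      exact mul_le_mul_of_nonneg_right hzw ha
    · rw [norm_smul, Real.norm_eq_abs, mul_comm]
      exact mul_le_mul_of_nonneg_right hw (abs_nonneg _)
  · have : a • z - b • w = b • (z - w) + (a - b) • z := by module
    rw [this, min_eq_right h]
    refine (norm_add_le _ _).trans (add_le_add ?_ ?_)
    · rw [norm_smul, Real.norm_of_nonneg hb, mul_comm]
      exact mul_le_mul_of_nonneg_right hzw hb
    · rw [norm_smul, Real.norm_eq_abs, mul_comm]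
      exact mul_le_mul_of_nonneg_right hz (abs_nonneg _)

lemma norm_wact_sub_le {f : PState d → ℂ} {α K B t : ℝ} (hα : 0 < α) (hα1 : α ≤ 1) (hK : 0 ≤ K)
    (hf : HolderBd α K f) (hB : ∀ x, ‖f x‖ ≤ B) (ht : 0 < t) (W : Op d) (x y : PState d) :
    ‖wact f W x - wact f W y‖ ≤
      K * (t ^ (α - 1) * (areaSum W * dist x y) + t ^ α * ‖W (unitRep x)‖ ^ 2) +
        B * (‖W‖ ^ 2 * dist x y) := by
  have hB0 : 0 ≤ B := (norm_nonneg _).trans (hB x)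
  refine (norm_smul_sub_smul_le (sq_nonneg _) (sq_nonneg _) (hB _) (hB _) (hf _ _)).trans
    (add_le_add ?_ (mul_le_mul_of_nonneg_left (abs_weight_sub_le W x y) hB0))
  rw [mul_assoc]
  refine mul_le_mul_of_nonneg_left ?_ hK
  have hmin : 0 ≤ min (‖W (unitRep x)‖ ^ 2) (‖W (unitRep y)‖ ^ 2) :=
    le_min (sq_nonneg _) (sq_nonneg _)
  refine (mul_le_mul_of_nonneg_right
    (rpow_le_tangent hα hα1 dist_nonneg ht) hmin).trans ?_
  rw [add_mul, mul_assoc]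
  have h1 := Real.rpow_nonneg ht.le (α - 1)
  have h2 := Real.rpow_nonneg ht.le α
  exact add_le_add (mul_le_mul_of_nonneg_left (dist_act_mul_min_le W x y) h1)
    (mul_le_mul_of_nonneg_left (min_le_left _ _) h2)

/-- The movement of the images contributes `2 δ^α K`, small with the mean area; the variation of the
weights contributes `d² B`, through `∫ ‖W‖² ≤ d²`. -/
lemma IsStoch.holderBd_avg {m : Measure (Op d)} (h : IsStoch m) {f : PState d → ℂ}
    {α K B δ : ℝ} (hα : 0 < α) (hα1 : α ≤ 1) (hK : 0 ≤ K) (hf : HolderBd α K f)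
    (hB : ∀ x, ‖f x‖ ≤ B) (hδ : 0 < δ) (hδm : ∫ W, areaSum W ∂m ≤ δ) :
    HolderBd α (2 * δ ^ α * K + (d : ℝ) ^ 2 * B) (avg m f) := by
  intro x y
  by_cases hxy : x = y
  · subst hxy; simp [hα.ne']
  have hr : 0 < dist x y := dist_pos.mpr hxy
  have hB0 : 0 ≤ B := (norm_nonneg _).trans (hB x)
  have hfm := (hf.continuous hα).measurable
  -- At this scale both terms of the affine bound become at most `δ^α * dist x y ^ α`.
  set t : ℝ := δ * dist x y with ht
  have ht0 : 0 < t := mul_pos hδ hr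
  have hi1 := (h.integrable_areaSum.mul_const (dist x y)).const_mul (t ^ (α - 1))
  have hi2 := (h.integrable_norm_apply_sq (unitRep x)).const_mul (t ^ α)
  have hi3 := (h.integrable_norm_sq.mul_const (dist x y)).const_mul B
  have hi12 : Integrable (fun W : Op d =>
      K * (t ^ (α - 1) * (areaSum W * dist x y) + t ^ α * ‖W (unitRep x)‖ ^ 2)) m :=
    (hi1.add hi2).const_mul K
  have hr1 : dist x y ≤ dist x y ^ α := by
    simpa using Real.rpow_le_rpow_of_exponent_ge hr (dist_le_one x y) hα1
  calc ‖avg m f x - avg m f y‖ = ‖∫ W, (wact f W x - wact f W y) ∂m‖ := by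
        rw [integral_sub (h.integrable_wact hfm hB x) (h.integrable_wact hfm hB y)]; rfl
    _ ≤ ∫ W, (K * (t ^ (α - 1) * (areaSum W * dist x y) + t ^ α * ‖W (unitRep x)‖ ^ 2) +
        B * (‖W‖ ^ 2 * dist x y)) ∂m :=
        norm_integral_le_of_norm_le (hi12.add hi3)
          (Filter.Eventually.of_forall fun W => norm_wact_sub_le hα hα1 hK hf hB ht0 W x y)
    _ = K * (t ^ (α - 1) * ((∫ W, areaSum W ∂m) * dist x y) + t ^ α) +
        B * ((∫ W : Op d, ‖W‖ ^ 2 ∂m) * dist x y) := by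
        rw [integral_add hi12 hi3, integral_const_mul,
          integral_add hi1 hi2, integral_const_mul, integral_mul_const, integral_const_mul,
          h.integral_weight, integral_const_mul, integral_mul_const, mul_one]
    _ ≤ K * (t ^ (α - 1) * (δ * dist x y) + t ^ α) + B * ((d : ℝ) ^ 2 * dist x y ^ α) := by
        have h1 := Real.rpow_nonneg ht0.le (α - 1)
        have h2 := h.integral_norm_sq_le
        gcongr
    _ = (2 * δ ^ α * K + (d : ℝ) ^ 2 * B) * dist x y ^ α := by
        rw [← ht, Real.rpow_sub_one ht0.ne', div_mul_cancel₀ _ ht0.ne', ht,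
          Real.mul_rpow hδ.le hr.le]
        ring

/-! ### Continuous harmonic functions are constant -/

/-- Maximum principle: the nonnegative function `‖Wx‖² (Re f(x) - Re f(W·x))` has integral zero. -/
lemma IsStoch.ae_eq_of_isMax {m : Measure (Op d)} (h : IsStoch m) {f : PState d → ℂ}
    (hf : Continuous f) (hharm : avg m f = f) {x : PState d}
    (hmax : ∀ y, (f y).re ≤ (f x).re) :
    ∀ᵐ W ∂m, W (unitRep x) = 0 ∨ (f (act W x)).re = (f x).re := by
  obtain ⟨B, -, hB⟩ := exists_norm_le hf
  have hi := h.integrable_wact hf.measurable hB x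
  have hre : ∀ W : Op d, (wact f W x).re = ‖W (unitRep x)‖ ^ 2 * (f (act W x)).re := fun W => by
    rw [wact, Complex.smul_re, smul_eq_mul]
  have hi2 : Integrable (fun W : Op d => ‖W (unitRep x)‖ ^ 2 * (f (act W x)).re) m :=
    hi.re.congr (Filter.Eventually.of_forall fun W => hre W)
  have hint : ∫ W : Op d, ‖W (unitRep x)‖ ^ 2 * (f (act W x)).re ∂m = (f x).re := by
    have h1 : ∫ W, (wact f W x).re ∂m = (∫ W, wact f W x ∂m).re := integral_re hi
    simp_rw [hre] at h1
    rw [h1]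
    exact congrArg Complex.re (congrFun hharm x)
  have hi3 := (h.integrable_norm_apply_sq (unitRep x)).mul_const (f x).re
  have hi4 : Integrable (fun W : Op d => ‖W (unitRep x)‖ ^ 2 * ((f x).re - (f (act W x)).re)) m := by
    refine (hi3.sub hi2).congr (Filter.Eventually.of_forall fun W => ?_)
    simp only [Pi.sub_apply]; ring
  have hz : ∫ W : Op d, ‖W (unitRep x)‖ ^ 2 * ((f x).re - (f (act W x)).re) ∂m = 0 := by
    simp_rw [mul_sub]
    rw [integral_sub hi3 hi2, integral_mul_const, h.integral_weight, hint]; ring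
  rw [integral_eq_zero_iff_of_nonneg
    (fun W => mul_nonneg (sq_nonneg _) (sub_nonneg.mpr (hmax _))) hi4] at hz
  filter_upwards [hz] with W hW
  rcases mul_eq_zero.mp hW with h1 | h1
  · left; simpa using h1
  · right; linarith

/-- The linear span of a set of points of the projective space. -/
def spanPts (K : Set (PState d)) : Submodule ℂ (Vec d) := Submodule.span ℂ (unitRep '' K)

lemma unitRep_mem_spanPts {K : Set (PState d)} {x : PState d} (hx : x ∈ K) :
    unitRep x ∈ spanPts K := Submodule.subset_span ⟨x, hx, rfl⟩

lemma spanPts_ne_bot {K : Set (PState d)} (hK : K.Nonempty) : spanPts K ≠ ⊥ := by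
  obtain ⟨x, hx⟩ := hK
  intro h0
  have := unitRep_mem_spanPts hx
  rw [h0, Submodule.mem_bot] at this
  exact unitRep_ne_zero x this

/-- For fixed `x`, the operators sending `x` into the finite-dimensional span form a closed set of
full measure, hence one containing the whole support. -/
lemma apply_mem_spanPts {μ : Measure (Op d)} {K : Set (PState d)}
    (hK : ∀ x ∈ K, ∀ᵐ v ∂μ, v (unitRep x) = 0 ∨ act v x ∈ K) {v : Op d} (hv : v ∈ μ.support)
    {z : Vec d} (hz : z ∈ spanPts K) : v z ∈ spanPts K := by
  have hpt : ∀ x ∈ K, v (unitRep x) ∈ spanPts K := by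
    intro x hx
    have hcl : IsClosed {w : Op d | w (unitRep x) ∈ spanPts K} :=
      (Submodule.closed_of_finiteDimensional (spanPts K)).preimage (continuous_apply_vec _)
    refine Measure.support_subset_of_isClosed hcl ?_ hv
    filter_upwards [hK x hx] with w hw
    by_cases h0 : w (unitRep x) = 0
    · simp [h0]
    · obtain ⟨c, hc, hu⟩ := exists_unitRep_act h0
      have hc0 : c ≠ 0 := by rintro rfl; simp at hc
      have h1 := unitRep_mem_spanPts (hw.resolve_left h0)
      rw [hu] at h1
      exact (Submodule.smul_mem_iff _ hc0).mp h1
  refine Submodule.span_induction (p := fun z _ => v z ∈ spanPts K) ?_ ?_ ?_ ?_ hz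
  · rintro _ ⟨x, hx, rfl⟩; exact hpt x hx
  · simp
  · intro a b _ _ ha hb; rw [map_add]; exact add_mem ha hb
  · intro c a _ ha; rw [map_smul]; exact Submodule.smul_mem _ _ ha

/-- By finite dimension each of the two subspaces contains a minimal invariant one, and (Erg)
identifies these. -/
lemma Erg.exists_mem_inf {μ : Measure (Op d)} (hErg : Erg μ) {F G : Submodule ℂ (Vec d)}
    (hF : F ≠ ⊥) (hG : G ≠ ⊥) (hFi : ∀ v ∈ μ.support, ∀ x ∈ F, v x ∈ F)
    (hGi : ∀ v ∈ μ.support, ∀ x ∈ G, v x ∈ G) : ∃ e, e ≠ 0 ∧ e ∈ F ∧ e ∈ G := by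
  obtain ⟨E, hE, huniq⟩ := hErg
  obtain ⟨F', hF'F, hF'⟩ := exists_minimal_le_of_wellFoundedLT
    (fun F : Submodule ℂ (Vec d) => F ≠ ⊥ ∧ ∀ v ∈ μ.support, ∀ x ∈ F, v x ∈ F) F ⟨hF, hFi⟩
  obtain ⟨G', hG'G, hG'⟩ := exists_minimal_le_of_wellFoundedLT
    (fun F : Submodule ℂ (Vec d) => F ≠ ⊥ ∧ ∀ v ∈ μ.support, ∀ x ∈ F, v x ∈ F) G ⟨hG, hGi⟩
  have h1 := huniq F' hF'
  have h2 := huniq G' hG'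
  obtain ⟨e, he, he0⟩ := Submodule.exists_mem_ne_zero_of_ne_bot hE.prop.1
  exact ⟨e, he0, hF'F (h1 ▸ he), hG'G (h2 ▸ he)⟩

/-- The finite set and the constant do not depend on `W`; this lets almost-sure statements about
single points be combined. -/
lemma exists_norm_apply_le_of_mem_spanPts {K : Set (PState d)} {e : Vec d} (he : e ∈ spanPts K) :
    ∃ (s : Finset (PState d)) (C : ℝ), (∀ x ∈ s, x ∈ K) ∧ 0 ≤ C ∧
      ∀ W : Op d, ‖W e‖ ≤ C * ∑ x ∈ s, ‖W (unitRep x)‖ := by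
  classical
  refine Submodule.span_induction (p := fun e _ => ∃ (s : Finset (PState d)) (C : ℝ),
    (∀ x ∈ s, x ∈ K) ∧ 0 ≤ C ∧ ∀ W : Op d, ‖W e‖ ≤ C * ∑ x ∈ s, ‖W (unitRep x)‖) ?_ ?_ ?_ ?_ he
  · rintro _ ⟨x, hx, rfl⟩
    exact ⟨{x}, 1, by simpa using hx, zero_le_one, fun W => by simp⟩
  · exact ⟨∅, 0, by simp, le_rfl, by simp⟩
  · rintro a b _ _ ⟨s, C, hs, hC, hsW⟩ ⟨t, D, ht, hD, htW⟩
    refine ⟨s ∪ t, C + D, fun x hx => ?_, add_nonneg hC hD, fun W => ?_⟩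
    · rcases Finset.mem_union.mp hx with h | h
      exacts [hs x h, ht x h]
    · have h1 : ∑ x ∈ s, ‖W (unitRep x)‖ ≤ ∑ x ∈ s ∪ t, ‖W (unitRep x)‖ :=
        Finset.sum_le_sum_of_subset_of_nonneg Finset.subset_union_left fun _ _ _ => norm_nonneg _
      have h2 : ∑ x ∈ t, ‖W (unitRep x)‖ ≤ ∑ x ∈ s ∪ t, ‖W (unitRep x)‖ :=
        Finset.sum_le_sum_of_subset_of_nonneg Finset.subset_union_right fun _ _ _ => norm_nonneg _
      rw [map_add, add_mul]
      exact (norm_add_le _ _).trans (add_le_add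
        ((hsW W).trans (mul_le_mul_of_nonneg_left h1 hC))
        ((htW W).trans (mul_le_mul_of_nonneg_left h2 hD)))
  · rintro c a _ ⟨s, C, hs, hC, hsW⟩
    refine ⟨s, ‖c‖ * C, hs, mul_nonneg (norm_nonneg _) hC, fun W => ?_⟩
    rw [map_smul, norm_smul, mul_assoc]
    exact mul_le_mul_of_nonneg_left (hsW W) (norm_nonneg _)

/-- Two sets of points whose spans share a nonzero vector cannot stay at positive distance under
the random dynamics. -/
lemma false_of_separated {μ : Measure (Op d)} [SigmaFinite μ] (h : IsStoch μ) (hPur : Pur μ)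
    {K L : Set (PState d)} {ρ : ℝ} (hρ : 0 < ρ) (hKL : ∀ x ∈ K, ∀ y ∈ L, ρ ≤ dist x y)
    (hK : ∀ n, ∀ x ∈ K, ∀ᵐ W ∂(powMeas μ n), W (unitRep x) = 0 ∨ act W x ∈ K)
    (hL : ∀ n, ∀ x ∈ L, ∀ᵐ W ∂(powMeas μ n), W (unitRep x) = 0 ∨ act W x ∈ L)
    {e : Vec d} (he : e ≠ 0) (heK : e ∈ spanPts K) (heL : e ∈ spanPts L) : False := by
  obtain ⟨s, C, hs, hC, hsW⟩ := exists_norm_apply_le_of_mem_spanPts heK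
  obtain ⟨t, D, ht, hD, htW⟩ := exists_norm_apply_le_of_mem_spanPts heL
  obtain ⟨A, hA⟩ : ∃ A : ℝ, A = C * D * (s.card * t.card * ρ⁻¹) + 1 := ⟨_, rfl⟩
  have hA0 : 0 < A := by rw [hA]; positivity
  have he0 : 0 < ‖e‖ ^ 2 := by have := norm_pos_iff.mpr he; positivity
  obtain ⟨n, -, hn⟩ := exists_integral_areaSum_le h hPur (ε := ‖e‖ ^ 2 / (2 * A))
    (div_pos he0 (mul_pos two_pos hA0))
  have hst := isStoch_powMeas h n
  have hae : ∀ᵐ W ∂(powMeas μ n), ‖W e‖ ^ 2 ≤ A * areaSum W := by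
    have h1 : ∀ᵐ W ∂(powMeas μ n), ∀ x ∈ s, W (unitRep x) = 0 ∨ act W x ∈ K :=
      (Filter.eventually_all_finset s).mpr fun x hx => hK n x (hs x hx)
    have h2 : ∀ᵐ W ∂(powMeas μ n), ∀ x ∈ t, W (unitRep x) = 0 ∨ act W x ∈ L :=
      (Filter.eventually_all_finset t).mpr fun x hx => hL n x (ht x hx)
    filter_upwards [h1, h2] with W hW1 hW2
    -- If neither image vanishes, the images stay in `K` and `L`, at distance at least `ρ`, so the
    -- area must absorb the product of the norms.
    have hpair : ∀ x ∈ s, ∀ y ∈ t,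
        ‖W (unitRep x)‖ * ‖W (unitRep y)‖ ≤ ρ⁻¹ * areaSum W := by
      intro x hx y hy
      have ha0 : 0 ≤ ρ⁻¹ * areaSum W := mul_nonneg (inv_nonneg.mpr hρ.le) (areaSum_nonneg W)
      rcases hW1 x hx with h0 | hxK
      · simpa [h0] using ha0
      rcases hW2 y hy with h0 | hyL
      · simpa [h0] using ha0
      have h3 := dist_act_mul_le W x y
      have h4 := hKL _ hxK _ hyL
      have h5 : areaSum W * dist x y ≤ areaSum W :=
        mul_le_of_le_one_right (areaSum_nonneg W) (dist_le_one x y)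
      rw [inv_mul_eq_div, le_div_iff₀' hρ]
      exact (mul_le_mul_of_nonneg_right h4 (by positivity)).trans (h3.trans h5)
    have hsum : (∑ x ∈ s, ‖W (unitRep x)‖) * (∑ y ∈ t, ‖W (unitRep y)‖) ≤
        s.card * t.card * ρ⁻¹ * areaSum W := by
      rw [Finset.sum_mul_sum]
      refine (Finset.sum_le_sum fun x hx => Finset.sum_le_sum fun y hy =>
        hpair x hx y hy).trans (le_of_eq ?_)
      simp; ring
    calc ‖W e‖ ^ 2 = ‖W e‖ * ‖W e‖ := pow_two _
      _ ≤ (C * ∑ x ∈ s, ‖W (unitRep x)‖) * (D * ∑ y ∈ t, ‖W (unitRep y)‖) :=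
          mul_le_mul (hsW W) (htW W) (norm_nonneg _) ((norm_nonneg _).trans (hsW W))
      _ = C * D * ((∑ x ∈ s, ‖W (unitRep x)‖) * (∑ y ∈ t, ‖W (unitRep y)‖)) := by ring
      _ ≤ C * D * (s.card * t.card * ρ⁻¹ * areaSum W) :=
          mul_le_mul_of_nonneg_left hsum (mul_nonneg hC hD)
      _ ≤ A * areaSum W := by
          have := areaSum_nonneg W
          rw [hA, add_mul]; linarith
  -- The mean of `‖We‖²` is `‖e‖²` at every order, whereas the chosen order makes the right side
  -- half of that.
  have h1 : ‖e‖ ^ 2 ≤ A * (‖e‖ ^ 2 / (2 * A)) := by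
    calc ‖e‖ ^ 2 = ∫ W : Op d, ‖W e‖ ^ 2 ∂(powMeas μ n) := (hst.integral_norm_apply_sq e).symm
      _ ≤ ∫ W, A * areaSum W ∂(powMeas μ n) :=
          integral_mono_ae (hst.integrable_norm_apply_sq e) (hst.integrable_areaSum.const_mul A) hae
      _ ≤ _ := by rw [integral_const_mul]; exact mul_le_mul_of_nonneg_left hn hA0.le
  have h2 : A * (‖e‖ ^ 2 / (2 * A)) = ‖e‖ ^ 2 / 2 := by
    have hA1 := hA0.ne'
    generalize ‖e‖ ^ 2 = q
    field_simp
  linarith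

lemma powMeas_one (μ : Measure (Op d)) [SFinite μ] : powMeas μ 1 = μ := by
  rw [powMeas, powMeas, Measure.mconv_dirac_one]

lemma avg_powMeas_eq {μ : Measure (Op d)} [SFinite μ] (h : IsStoch μ) {f : PState d → ℂ}
    (hf : Continuous f) (hharm : avg μ f = f) (n : ℕ) : avg (powMeas μ n) f = f := by
  obtain ⟨B, -, hB⟩ := exists_norm_le hf
  induction n with
  | zero => exact avg_dirac_one hf.measurable
  | succ n ih => rw [powMeas, (isStoch_powMeas h n).avg_mconv h hf.measurable hB, hharm, ih]

lemma avg_neg (m : Measure (Op d)) (f : PState d → ℂ) : avg m (-f) = -avg m f := by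
  funext x
  simp [avg, wact, integral_neg]

lemma avg_const_mul (m : Measure (Op d)) (c : ℂ) (f : PState d → ℂ) :
    avg m (fun x => c * f x) = fun x => c * avg m f x := by
  funext x
  rw [avg, avg, ← integral_const_mul]
  refine integral_congr_ae (Filter.Eventually.of_forall fun W => ?_)
  simp only [wact, mul_smul_comm]

/-- If the real part were not constant, its maximum and minimum sets would be preserved by the
maximum principle, separated by uniform continuity, and would have spans meeting nontrivially by
(Erg), against `false_of_separated`. -/
lemma re_eq_of_harmonic {μ : Measure (Op d)} [SigmaFinite μ] (h : IsStoch μ) (hErg : Erg μ)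
    (hPur : Pur μ) {f : PState d → ℂ} (hf : Continuous f) (hharm : avg μ f = f)
    (x y : PState d) : (f x).re = (f y).re := by
  have hre : Continuous fun x => (f x).re := Complex.continuous_re.comp hf
  obtain ⟨a, -, ha⟩ := isCompact_univ.exists_isMaxOn ⟨x, trivial⟩ hre.continuousOn
  obtain ⟨b, -, hb⟩ := isCompact_univ.exists_isMinOn ⟨x, trivial⟩ hre.continuousOn
  have ha' : ∀ y, (f y).re ≤ (f a).re := fun y => ha trivial
  have hb' : ∀ y, (f b).re ≤ (f y).re := fun y => hb trivial
  by_contra hne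
  have hlt : (f b).re < (f a).re := by
    by_contra hle
    have h1 := ha' x; have h2 := ha' y; have h3 := hb' x; have h4 := hb' y
    exact hne (by linarith)
  let K : Set (PState d) := {y | (f y).re = (f a).re}
  let L : Set (PState d) := {y | (f y).re = (f b).re}
  have hK : ∀ n, ∀ x ∈ K, ∀ᵐ W ∂(powMeas μ n), W (unitRep x) = 0 ∨ act W x ∈ K := by
    intro n x hx
    have hx' : (f x).re = (f a).re := hx
    filter_upwards [(isStoch_powMeas h n).ae_eq_of_isMax hf (avg_powMeas_eq h hf hharm n)
      (x := x) (fun y => hx' ▸ ha' y)] with W hW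
    exact hW.imp_right fun h1 => h1.trans hx'
  have hL : ∀ n, ∀ x ∈ L, ∀ᵐ W ∂(powMeas μ n), W (unitRep x) = 0 ∨ act W x ∈ L := by
    intro n x hx
    have hx' : (f x).re = (f b).re := hx
    have hharm' : avg (powMeas μ n) (-f) = -f := by rw [avg_neg, avg_powMeas_eq h hf hharm n]
    filter_upwards [(isStoch_powMeas h n).ae_eq_of_isMax hf.neg hharm'
      (x := x) (fun y => by simpa [hx'] using hb' y)] with W hW
    exact hW.imp_right fun h1 => (neg_inj.mp h1).trans hx'
  obtain ⟨ρ, hρ, hρd⟩ := Metric.uniformContinuous_iff.mp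
    (CompactSpace.uniformContinuous_of_continuous hre) ((f a).re - (f b).re) (sub_pos.mpr hlt)
  have hKL : ∀ x ∈ K, ∀ y ∈ L, ρ ≤ dist x y := by
    intro x hx y hy
    by_contra hlt'
    have h1 := hρd (not_le.mp hlt')
    have hx' : (f x).re = (f a).re := hx
    have hy' : (f y).re = (f b).re := hy
    rw [hx', hy', Real.dist_eq, abs_of_pos (sub_pos.mpr hlt)] at h1
    exact lt_irrefl _ h1
  -- Invariance of the spans under the support of `μ` only uses order one; the separation argument
  -- uses all orders.
  have hK1 := hK 1
  have hL1 := hL 1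
  rw [powMeas_one] at hK1 hL1
  obtain ⟨e, he0, heK, heL⟩ := hErg.exists_mem_inf (spanPts_ne_bot (K := K) ⟨a, rfl⟩)
    (spanPts_ne_bot (K := L) ⟨b, rfl⟩) (fun v hv z hz => apply_mem_spanPts hK1 hv hz)
    (fun v hv z hz => apply_mem_spanPts hL1 hv hz)
  exact false_of_separated h hPur hρ hKL hK hL he0 heK heL

lemma eq_of_harmonic {μ : Measure (Op d)} [SigmaFinite μ] (h : IsStoch μ) (hErg : Erg μ)
    (hPur : Pur μ) {f : PState d → ℂ} (hf : Continuous f) (hharm : avg μ f = f)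
    (x y : PState d) : f x = f y := by
  refine Complex.ext (re_eq_of_harmonic h hErg hPur hf hharm x y) ?_
  -- The real part of `I * f` is minus the imaginary part of `f`.
  have h1 := re_eq_of_harmonic h hErg hPur (f := fun x => Complex.I * f x)
    (continuous_const.mul hf) (by rw [avg_const_mul, hharm]) x y
  simpa using h1

/-! ### The Poisson equation -/


lemma avg_add {m : Measure (Op d)} (h : IsStoch m) {f g : PState d → ℂ} (hf : Continuous f)
    (hg : Continuous g) (x : PState d) :
    avg m (fun x => f x + g x) x = avg m f x + avg m g x := by
  obtain ⟨B, -, hB⟩ := exists_norm_le hf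
  obtain ⟨B', -, hB'⟩ := exists_norm_le hg
  rw [avg, avg, avg, ← integral_add (h.integrable_wact hf.measurable hB x)
    (h.integrable_wact hg.measurable hB' x)]
  refine integral_congr_ae (Filter.Eventually.of_forall fun W => ?_)
  simp only [wact, smul_add]

/-- The averaging operator on bounded continuous functions. -/
def avgCLM {m : Measure (Op d)} (h : IsStoch m) : (PState d →ᵇ ℂ) →L[ℂ] (PState d →ᵇ ℂ) :=
  LinearMap.mkContinuous
    { toFun := fun f => BoundedContinuousFunction.mkOfCompact ⟨avg m f, h.continuous_avg f.continuous⟩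
      map_add' := fun f g => by
        ext x
        exact avg_add h f.continuous g.continuous x
      map_smul' := fun c f => by
        ext x
        exact congrFun (avg_const_mul m c f) x } 1
    (fun f => by
      rw [one_mul]
      exact (BoundedContinuousFunction.norm_le (norm_nonneg _)).mpr fun x =>
        h.norm_avg_le f.norm_coe_le_norm x)

lemma norm_avgCLM_le {m : Measure (Op d)} (h : IsStoch m) : ‖avgCLM h‖ ≤ 1 :=
  LinearMap.mkContinuous_norm_le _ zero_le_one _

lemma coe_avgCLM {m : Measure (Op d)} (h : IsStoch m) (f : PState d →ᵇ ℂ) :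
    ⇑(avgCLM h f) = avg m f := rfl

lemma coe_avgCLM_pow {μ : Measure (Op d)} [SFinite μ] (h : IsStoch μ) (n : ℕ)
    (f : PState d →ᵇ ℂ) : ⇑((avgCLM h ^ n) f) = avg (powMeas μ n) f := by
  induction n generalizing f with
  | zero => exact (avg_dirac_one f.continuous.measurable).symm
  | succ n ih =>
    rw [pow_succ, powMeas, (isStoch_powMeas h n).avg_mconv h f.continuous.measurable
      f.norm_coe_le_norm]
    exact ih (avgCLM h f)

/-- The value at which a contraction `H ↦ H / 2 + A` of admissible constants stabilizes. -/
lemma HolderBd.of_contraction {α A H : ℝ} {f : PState d → ℂ} (hf : HolderBd α H f)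
    (hA : ∀ H, 0 ≤ H → HolderBd α H f → HolderBd α (H / 2 + A) f) (hH : 0 ≤ H) (hA0 : 0 ≤ A) :
    HolderBd α (2 * A) f := by
  have key : ∀ n : ℕ, HolderBd α ((1 / 2) ^ n * H + 2 * A) f := by
    intro n
    induction n with
    | zero =>
      intro x y
      refine (hf x y).trans (mul_le_mul_of_nonneg_right ?_ (Real.rpow_nonneg dist_nonneg _))
      rw [pow_zero]; linarith
    | succ n ih =>
      have := hA _ (by positivity) ih
      convert! this using 1
      rw [pow_succ]; ring
  intro x y
  have hlim : Filter.Tendsto (fun n : ℕ => ((1 / 2 : ℝ) ^ n * H + 2 * A) * dist x y ^ α)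
      Filter.atTop (nhds ((0 * H + 2 * A) * dist x y ^ α)) :=
    (((tendsto_pow_atTop_nhds_zero_of_lt_one (by norm_num) (by norm_num)).mul_const H).add_const
      (2 * A)).mul_const _
  rw [zero_mul, zero_add] at hlim
  exact ge_of_tendsto' hlim fun n => key n x y

/-! ### Hölder bounds: sums, limits, compactness, and iteration of the Lasota–Yorke inequality. -/

lemma HolderBd.mono {α K K' : ℝ} {f : PState d → ℂ} (hf : HolderBd α K f) (h : K ≤ K') :
    HolderBd α K' f := fun x y =>
  (hf x y).trans (mul_le_mul_of_nonneg_right h (Real.rpow_nonneg dist_nonneg _))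

lemma HolderBd.smul {α K : ℝ} {f : PState d → ℂ} (hf : HolderBd α K f) (c : ℂ) :
    HolderBd α (‖c‖ * K) (fun x => c * f x) := fun x y => by
  rw [← mul_sub, norm_mul, mul_assoc]
  exact mul_le_mul_of_nonneg_left (hf x y) (norm_nonneg _)

lemma HolderBd.add {α K L : ℝ} {f g : PState d → ℂ} (hf : HolderBd α K f) (hg : HolderBd α L g) :
    HolderBd α (K + L) (fun x => f x + g x) := fun x y => by
  rw [add_sub_add_comm, add_mul]
  exact (norm_add_le _ _).trans (add_le_add (hf x y) (hg x y))

lemma HolderBd.sum {ι : Type*} {α : ℝ} {K : ι → ℝ} {f : ι → PState d → ℂ} (s : Finset ι)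
    (hf : ∀ i ∈ s, HolderBd α (K i) (f i)) :
    HolderBd α (∑ i ∈ s, K i) (fun x => ∑ i ∈ s, f i x) := fun x y => by
  rw [← Finset.sum_sub_distrib, Finset.sum_mul]
  exact (norm_sum_le _ _).trans (Finset.sum_le_sum fun i hi => hf i hi x y)

lemma isClosed_holderBd (α K : ℝ) : IsClosed {f : PState d →ᵇ ℂ | HolderBd α K f} := by
  simp only [HolderBd, Set.ofPred_forall]
  refine isClosed_iInter fun x => isClosed_iInter fun y => isClosed_le ?_ continuous_const
  exact ((BoundedContinuousFunction.lipschitz_eval_const x).continuous.sub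
    (BoundedContinuousFunction.lipschitz_eval_const y).continuous).norm

lemma isCompact_holderBd {α : ℝ} (hα : 0 < α) (K : ℝ) :
    IsCompact {f : PState d →ᵇ ℂ | ‖f‖ ≤ 1 ∧ HolderBd α K f} := by
  refine BoundedContinuousFunction.arzela_ascoli₂ (Metric.closedBall 0 1)
    (isCompact_closedBall _ _) _ ?_ ?_ ?_
  · exact (isClosed_le continuous_norm continuous_const).inter (isClosed_holderBd α K)
  · intro f x hf
    rw [mem_closedBall_zero_iff]
    exact (f.norm_coe_le_norm x).trans hf.1
  · refine Metric.equicontinuous_of_continuity_modulus (fun r => K * r ^ α) ?_ _ ?_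
    · have h2 : Continuous fun r : ℝ => K * r ^ α :=
        continuous_const.mul (continuous_id.rpow_const fun _ => Or.inr hα.le)
      have := h2.tendsto 0
      simpa [hα.ne'] using this
    · intro x y f
      rw [dist_eq_norm]
      exact f.2.2 x y

/-- The Lasota–Yorke inequality with contraction factor `1/2`. -/
lemma exists_lasotaYorke {μ : Measure (Op d)} [SigmaFinite μ] (h : IsStoch μ) (hPur : Pur μ)
    {α : ℝ} (hα : 0 < α) (hα1 : α ≤ 1) :
    ∃ N, 1 ≤ N ∧ ∀ (f : PState d → ℂ) (K B : ℝ), 0 ≤ K → HolderBd α K f → (∀ x, ‖f x‖ ≤ B) →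
      HolderBd α (K / 2 + (d : ℝ) ^ 2 * B) (avg (powMeas μ N) f) := by
  -- With this `δ`, the contraction factor `2 δ^α` equals `1 / 2`.
  have hδ : (0 : ℝ) < (1 / 4) ^ (1 / α) := Real.rpow_pos_of_pos (by norm_num) _
  obtain ⟨N, hN1, hN⟩ := exists_integral_areaSum_le h hPur hδ
  refine ⟨N, hN1, fun f K B hK hf hB => ?_⟩
  refine ((isStoch_powMeas h N).holderBd_avg hα hα1 hK hf hB hδ hN).mono (le_of_eq ?_)
  rw [← Real.rpow_mul (by norm_num), one_div_mul_cancel hα.ne', Real.rpow_one]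
  ring

/-- Iterate the Lasota–Yorke inequality in blocks of `N`; averaging never increases the sup norm, so
the additive term stays `d² B`. -/
lemma exists_holderBd_avg {μ : Measure (Op d)} [SigmaFinite μ] (h : IsStoch μ)
    (hPur : Pur μ) {α K B : ℝ} (hα : 0 < α) (hα1 : α ≤ 1) (hK : 0 ≤ K) {f : PState d → ℂ}
    (hf : HolderBd α K f) (hB0 : 0 ≤ B) (hB : ∀ x, ‖f x‖ ≤ B) :
    ∃ H, 0 ≤ H ∧ ∀ n, HolderBd α H (avg (powMeas μ n) f) := by
  obtain ⟨N, hN1, hN⟩ := exists_lasotaYorke h hPur hα hα1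
  have hall : ∀ n, ∃ H, 0 ≤ H ∧ HolderBd α H (avg (powMeas μ n) f) := fun n => by
    have h0 : 0 ≤ ∫ W, areaSum W ∂(powMeas μ n) := integral_nonneg areaSum_nonneg
    refine ⟨_, ?_, (isStoch_powMeas h n).holderBd_avg hα hα1 hK hf hB
      (add_pos_of_nonneg_of_pos h0 one_pos) (le_add_of_nonneg_right zero_le_one)⟩
    positivity
  choose c hc0 hc using hall
  have hsum0 : 0 ≤ ∑ i ∈ Finset.range N, c i := Finset.sum_nonneg fun i _ => hc0 i
  -- The sum covers the finitely many orders below `N`; any `H ≥ 2 d² B` satisfies `H / 2 + d² B ≤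
  -- H`, which closes the induction.
  refine ⟨∑ i ∈ Finset.range N, c i + 2 * ((d : ℝ) ^ 2 * B), by positivity, fun n => ?_⟩
  induction n using Nat.strong_induction_on with
  | _ n ih =>
    by_cases hn : n < N
    · refine (hc n).mono ?_
      have := Finset.single_le_sum (fun i _ => hc0 i) (Finset.mem_range.mpr hn)
      have h2 : 0 ≤ (d : ℝ) ^ 2 * B := by positivity
      linarith
    · obtain ⟨k, rfl⟩ : ∃ k, n = k + N := ⟨n - N, by omega⟩
      have hcont := (hf.continuous hα)
      rw [powMeas_add, (isStoch_powMeas h N).avg_mconv (isStoch_powMeas h k) hcont.measurable hB]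
      refine (hN _ _ B (by positivity) (ih k (by omega))
        ((isStoch_powMeas h k).norm_avg_le hB)).mono ?_
      linarith

/-! ### Abel resolvents and the solution of the Poisson equation. -/

lemma exists_resolvent {E : Type*} [NormedAddCommGroup E] [NormedSpace ℂ E] [CompleteSpace E]
    {T : E →L[ℂ] E} (hT : ‖T‖ ≤ 1) {r : ℝ} (hr0 : 0 ≤ r) (hr1 : r < 1) (g : E) :
    ∃ f : E, f - (r : ℂ) • T f = g ∧ HasSum (fun n : ℕ => ((r : ℂ) ^ n) • (T ^ n) g) f := by
  set S : E →L[ℂ] E := (r : ℂ) • T with hS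
  have hS1 : ‖S‖ < 1 := by
    rw [hS, norm_smul, Complex.norm_real, Real.norm_of_nonneg hr0]
    nlinarith [norm_nonneg T]
  have hsum : Summable fun n : ℕ => S ^ n := summable_geometric_of_norm_lt_one hS1
  refine ⟨(∑' n : ℕ, S ^ n) g, ?_, ?_⟩
  · have h1 : (1 - S) * ∑' n : ℕ, S ^ n = 1 := mul_neg_geom_series S hS1
    exact congrArg (fun A : E →L[ℂ] E => A g) h1
  · have h2 := (ContinuousLinearMap.apply ℂ E g).hasSum hsum.hasSum
    have h3 : (fun n : ℕ => ((r : ℂ) ^ n) • (T ^ n) g) =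
        fun n : ℕ => ContinuousLinearMap.apply ℂ E g (S ^ n) := by
      funext n
      rw [hS, smul_pow]; rfl
    rw [h3]; exact h2

lemma eq_sum_add_of_resolvent {E : Type*} [NormedAddCommGroup E] [NormedSpace ℂ E]
    {T : E →L[ℂ] E} {c : ℂ} {f g : E} (hf : f - c • T f = g) (n : ℕ) :
    f = ∑ j ∈ Finset.range n, c ^ j • (T ^ j) g + c ^ n • (T ^ n) f := by
  induction n with
  | zero => simp
  | succ n ih =>
    have h1 : (T ^ n) f = (T ^ n) g + c • (T ^ (n + 1)) f := by
      conv_lhs => rw [show f = g + c • T f from by rw [← hf]; abel]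
      rw [map_add, map_smul, pow_succ]; rfl
    rw [Finset.sum_range_succ, add_assoc, pow_succ c, mul_smul, ← smul_add, ← h1]
    exact ih

/-- This bound explodes as `r → 1`. Its only role is to supply a finite Hölder constant from which
the uniform contraction argument can start. -/
lemma holderBd_resolvent {μ : Measure (Op d)} [SFinite μ] (h : IsStoch μ) {α H r : ℝ}
    (hH : 0 ≤ H) (hr0 : 0 ≤ r) (hr1 : r < 1) {G f : PState d →ᵇ ℂ}
    (hG : ∀ n, HolderBd α H (avg (powMeas μ n) G))
    (hf : HasSum (fun n : ℕ => ((r : ℂ) ^ n) • (avgCLM h ^ n) G) f) :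
    HolderBd α ((1 - r)⁻¹ * H) f := by
  refine (isClosed_holderBd α _).mem_of_tendsto hf.tendsto_sum_nat
    (Filter.Eventually.of_forall fun m => ?_)
  have h1 : HolderBd α (∑ n ∈ Finset.range m, ‖(r : ℂ) ^ n‖ * H)
      (fun x => ∑ n ∈ Finset.range m, (r : ℂ) ^ n * avg (powMeas μ n) G x) :=
    HolderBd.sum _ fun n _ => (hG n).smul _
  have h2 : ∑ n ∈ Finset.range m, ‖(r : ℂ) ^ n‖ * H ≤ (1 - r)⁻¹ * H := by
    rw [← Finset.sum_mul]
    refine mul_le_mul_of_nonneg_right ?_ hH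
    rw [← tsum_geometric_of_lt_one hr0 hr1]
    have h3 : ∀ n : ℕ, ‖(r : ℂ) ^ n‖ = r ^ n := fun n => by
      rw [norm_pow, Complex.norm_real, Real.norm_of_nonneg hr0]
    simp_rw [h3]
    exact (summable_geometric_of_lt_one hr0 hr1).sum_le_tsum _ fun n _ => pow_nonneg hr0 n
  have h4 : ⇑(∑ n ∈ Finset.range m, ((r : ℂ) ^ n) • (avgCLM h ^ n) G) =
      fun x => ∑ n ∈ Finset.range m, (r : ℂ) ^ n * avg (powMeas μ n) G x := by
    funext x
    simp [← coe_avgCLM_pow h]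
  change HolderBd α _ _
  rw [h4]
  exact h1.mono h2

/-- The Hölder constant of the resolvent is controlled by its sup norm, uniformly in `r < 1`. -/
lemma exists_holderBd_resolvent {μ : Measure (Op d)} [SigmaFinite μ] (h : IsStoch μ)
    (hPur : Pur μ) {α K : ℝ} (hα : 0 < α) (hα1 : α ≤ 1) (hK : 0 ≤ K) {G : PState d →ᵇ ℂ}
    (hG : HolderBd α K G) :
    ∃ A D, 0 ≤ A ∧ 0 ≤ D ∧ ∀ (r : ℝ) (f : PState d →ᵇ ℂ), 0 ≤ r → r < 1 →
      f - (r : ℂ) • avgCLM h f = G →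
      HasSum (fun n : ℕ => ((r : ℂ) ^ n) • (avgCLM h ^ n) G) f →
      HolderBd α (A + D * ‖f‖) f := by
  obtain ⟨H, hH0, hH⟩ := exists_holderBd_avg h hPur hα hα1 hK hG (norm_nonneg G)
    G.norm_coe_le_norm
  obtain ⟨N, -, hN⟩ := exists_lasotaYorke h hPur hα hα1
  refine ⟨2 * (N * H), 2 * (d : ℝ) ^ 2, by positivity, by positivity,
    fun r f hr0 hr1 hf hsum => ?_⟩
  have hpow : ∀ n : ℕ, ‖(r : ℂ) ^ n‖ ≤ 1 := fun n => by
    rw [norm_pow, Complex.norm_real, Real.norm_of_nonneg hr0]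
    exact pow_le_one₀ hr0 hr1.le
  -- Unroll the resolvent equation `N` times: the first `N` terms have constants at most `H`, and
  -- the Lasota–Yorke inequality halves the constant of the remainder.
  have hstep : ∀ L, 0 ≤ L → HolderBd α L f →
      HolderBd α (L / 2 + (N * H + (d : ℝ) ^ 2 * ‖f‖)) f := by
    intro L hL hfL
    have h1 : HolderBd α (∑ n ∈ Finset.range N, ‖(r : ℂ) ^ n‖ * H)
        (fun x => ∑ n ∈ Finset.range N, (r : ℂ) ^ n * avg (powMeas μ n) G x) :=
      HolderBd.sum _ fun n _ => (hH n).smul _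
    have h2 := (hN f L ‖f‖ hL hfL f.norm_coe_le_norm).smul ((r : ℂ) ^ N)
    have h3 := h1.add h2
    have h4 : ⇑f = fun x => ∑ n ∈ Finset.range N, (r : ℂ) ^ n * avg (powMeas μ n) G x +
        (r : ℂ) ^ N * avg (powMeas μ N) f x := by
      funext x
      conv_lhs => rw [eq_sum_add_of_resolvent hf N]
      simp [← coe_avgCLM_pow h]
    rw [← h4] at h3
    refine h3.mono ?_
    have h5 : ∑ n ∈ Finset.range N, ‖(r : ℂ) ^ n‖ * H ≤ N * H := by
      calc _ ≤ ∑ n ∈ Finset.range N, H :=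
            Finset.sum_le_sum fun n _ => mul_le_of_le_one_left hH0 (hpow n)
        _ = N * H := by simp
    have h6 : ‖(r : ℂ) ^ N‖ * (L / 2 + (d : ℝ) ^ 2 * ‖f‖) ≤ L / 2 + (d : ℝ) ^ 2 * ‖f‖ :=
      mul_le_of_le_one_left (by positivity) (hpow N)
    linarith
  have hfin := holderBd_resolvent h hH0 hr0 hr1 hH hsum
  have hr : 0 ≤ (1 - r)⁻¹ := inv_nonneg.mpr (by linarith)
  exact (hfin.of_contraction hstep (mul_nonneg hr hH0) (by positivity)).mono
    (le_of_eq (by ring))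

/-- Integrating the equation against the invariant law gives `(1 - r) ∫ f = ∫ G = 0`. -/
lemma IsStoch.integral_resolvent {μ : Measure (Op d)} [SFinite μ] (h : IsStoch μ)
    {ν : Measure (PState d)} [IsProbabilityMeasure ν] (hν : (transKernel μ).Invariant ν)
    {r : ℝ} (hr1 : r < 1) {f G : PState d →ᵇ ℂ} (hG : ∫ x, G x ∂ν = 0)
    (hf : f - (r : ℂ) • avgCLM h f = G) : ∫ x, f x ∂ν = 0 := by
  have h1 : ∫ x, (f x - (r : ℂ) * avgCLM h f x) ∂ν = 0 := by
    rw [← hG]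
    refine integral_congr_ae (Filter.Eventually.of_forall fun x => ?_)
    rw [← hf]; simp
  rw [integral_sub (f.integrable ν) (((avgCLM h f).integrable ν).const_mul _),
    integral_const_mul] at h1
  have h2 : ∫ x, avgCLM h f x ∂ν = ∫ x, f x ∂ν := h.integral_avg hν f.continuous
  rw [h2, ← one_sub_mul] at h1
  refine (mul_eq_zero.mp h1).resolve_left ?_
  rw [sub_eq_zero]
  exact fun h3 => hr1.ne (by exact_mod_cast h3.symm)

lemma exists_poisson {μ : Measure (Op d)} [SigmaFinite μ] (h : IsStoch μ) (hErg : Erg μ)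
    (hPur : Pur μ) {ν : Measure (PState d)} [IsProbabilityMeasure ν]
    (hν : (transKernel μ).Invariant ν) {α K : ℝ} (hα : 0 < α) (hα1 : α ≤ 1) (hK : 0 ≤ K)
    {G : PState d →ᵇ ℂ} (hG : HolderBd α K G) (hG0 : ∫ x, G x ∂ν = 0) :
    ∃ f : PState d →ᵇ ℂ, f - avgCLM h f = G := by
  obtain ⟨A, D, hA, hD, hAD⟩ := exists_holderBd_resolvent h hPur hα hα1 hK hG
  let r : ℕ → ℝ := fun k => 1 - 1 / ((k : ℝ) + 1)
  have hpos : ∀ k : ℕ, (0 : ℝ) < 1 / ((k : ℝ) + 1) := fun k => Nat.one_div_pos_of_nat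
  have hr0 : ∀ k, 0 ≤ r k := fun k => by
    have : 1 / ((k : ℝ) + 1) ≤ 1 := by
      rw [div_le_one (by positivity)]; linarith [Nat.cast_nonneg (α := ℝ) k]
    simp only [r]; linarith
  have hr1 : ∀ k, r k < 1 := fun k => by have := hpos k; simp only [r]; linarith
  have hrlim : Filter.Tendsto r Filter.atTop (nhds 1) := by
    simpa only [sub_zero] using
      (tendsto_one_div_add_atTop_nhds_zero_nat (𝕜 := ℝ)).const_sub (1 : ℝ)
  choose f hf hsum using fun k => exists_resolvent (norm_avgCLM_le h) (hr0 k) (hr1 k) G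
  have hs : ∀ k, 0 < 1 + ‖f k‖ := fun k => by positivity
  -- With this factor `‖c f‖ = 1 - c`, so a single compactness argument covers bounded and unbounded
  -- resolvents; they are told apart by whether the limit of `c` vanishes.
  let c : ℕ → ℝ := fun k => (1 + ‖f k‖)⁻¹
  have hc0 : ∀ k, 0 ≤ c k := fun k => inv_nonneg.mpr (hs k).le
  have hc1 : ∀ k, c k ≤ 1 := fun k => inv_le_one_of_one_le₀ (by linarith [norm_nonneg (f k)])
  let g : ℕ → PState d →ᵇ ℂ := fun k => (c k : ℂ) • f k
  have hgn : ∀ k, ‖g k‖ = 1 - c k := fun k => by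
    simp only [g, norm_smul, Complex.norm_real, Real.norm_of_nonneg (hc0 k), c]
    have := (hs k).ne'
    field_simp
    ring
  have hgmem : ∀ k, g k ∈ {f : PState d →ᵇ ℂ | ‖f‖ ≤ 1 ∧ HolderBd α (A + D) f} := fun k => by
    refine ⟨by rw [hgn]; linarith [hc0 k], ?_⟩
    have h1 := (hAD (r k) (f k) (hr0 k) (hr1 k) (hf k) (hsum k)).smul (c k : ℂ)
    rw [Complex.norm_real, Real.norm_of_nonneg (hc0 k)] at h1
    refine HolderBd.mono h1 ?_
    simp only [c]
    rw [inv_mul_le_iff₀ (hs k)]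
    nlinarith [norm_nonneg (f k)]
  obtain ⟨⟨cl, gl⟩, ⟨hcl, hgl⟩, φ, hφ, hlim⟩ :=
    ((isCompact_Icc (a := (0 : ℝ)) (b := 1)).prod (isCompact_holderBd hα (A + D))).tendsto_subseq
      (x := fun k => (c k, g k)) (fun k => ⟨⟨hc0 k, hc1 k⟩, hgmem k⟩)
  have hclim : Filter.Tendsto (fun k => c (φ k)) Filter.atTop (nhds cl) :=
    (continuous_fst.tendsto _).comp hlim
  have hglim : Filter.Tendsto (fun k => g (φ k)) Filter.atTop (nhds gl) :=
    (continuous_snd.tendsto _).comp hlim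
  have hrlim' : Filter.Tendsto (fun k => r (φ k)) Filter.atTop (nhds 1) :=
    hrlim.comp hφ.tendsto_atTop
  have hg : ∀ k, g k - (r k : ℂ) • avgCLM h (g k) = (c k : ℂ) • G := fun k => by
    rw [← hf k, smul_sub, map_smul, smul_comm]
  have heq : gl - avgCLM h gl = (cl : ℂ) • G := by
    have h1 : Filter.Tendsto (fun k => g (φ k) - (r (φ k) : ℂ) • avgCLM h (g (φ k)))
        Filter.atTop (nhds (gl - ((1 : ℝ) : ℂ) • avgCLM h gl)) :=
      hglim.sub (((Complex.continuous_ofReal.tendsto _).comp hrlim').smul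
        (((avgCLM h).continuous.tendsto _).comp hglim))
    have h2 : Filter.Tendsto (fun k => (c (φ k) : ℂ) • G) Filter.atTop (nhds ((cl : ℂ) • G)) :=
      ((Complex.continuous_ofReal.tendsto _).comp hclim).smul_const G
    simp_rw [hg] at h1
    have := tendsto_nhds_unique h1 h2
    simpa using this
  have hgint : ∀ k, ∫ x, g k x ∂ν = 0 := fun k => by
    have h1 := h.integral_resolvent hν (hr1 k) hG0 (hf k)
    have h2 : ∀ x, g k x = (c k : ℂ) * f k x := fun x => rfl
    simp_rw [h2]
    rw [integral_const_mul, h1, mul_zero]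
  have hgintl : ∫ x, gl x ∂ν = 0 := by
    rw [← norm_le_zero_iff]
    have h0 := (tendsto_iff_norm_sub_tendsto_zero.mp hglim)
    refine ge_of_tendsto' h0 fun k => ?_
    have h1 : ∫ x, gl x ∂ν = -∫ x, (g (φ k) - gl) x ∂ν := by
      have h2 : ∀ x, (g (φ k) - gl) x = g (φ k) x - gl x := fun x => rfl
      simp_rw [h2]
      rw [integral_sub ((g (φ k)).integrable ν) (gl.integrable ν), hgint]; simp
    rw [h1, norm_neg]
    simpa using norm_integral_le_of_norm_le_const (μ := ν)
      (Filter.Eventually.of_forall (g (φ k) - gl).norm_coe_le_norm)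
  have hgnl : ‖gl‖ = 1 - cl := by
    refine tendsto_nhds_unique hglim.norm ?_
    simp_rw [hgn]
    exact hclim.const_sub 1
  -- A zero limit means that the resolvents blow up: `gl` is then harmonic, hence constant, hence
  -- zero since centred, yet it has norm `1 - cl = 1`.
  by_cases hc : cl = 0
  · exfalso
    rw [hc, Complex.ofReal_zero, zero_smul, sub_eq_zero] at heq
    have hconst := eq_of_harmonic h hErg hPur gl.continuous
      (by rw [← coe_avgCLM h, ← heq])
    have hzero : gl = 0 := by
      ext x
      have h1 : ∀ y, gl y = gl x := fun y => hconst y x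
      simp_rw [h1] at hgintl
      simpa using hgintl
    rw [hzero, hc] at hgnl
    simp at hgnl
  · refine ⟨((cl : ℂ)⁻¹) • gl, ?_⟩
    have hc' : (cl : ℂ) ≠ 0 := by exact_mod_cast hc
    rw [map_smul, ← smul_sub, heq, smul_smul, inv_mul_cancel₀ hc', one_smul]

lemma exists_holderBd_of_isHolder {g : PState d → ℂ} (hg : IsHolder g) :
    ∃ α K : ℝ, 0 < α ∧ α ≤ 1 ∧ 0 ≤ K ∧ HolderBd α K g := by
  obtain ⟨C, α, hα, hα1, hH⟩ := hg
  refine ⟨α, C, by exact_mod_cast hα, by exact_mod_cast hα1, C.2, fun x y => ?_⟩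
  rw [← dist_eq_norm]
  exact hH.dist_le x y

lemma exists_solvesPoisson {μ : Measure (Op d)} [SigmaFinite μ] (h : IsStoch μ) (hErg : Erg μ)
    (hPur : Pur μ) {ν : Measure (PState d)} [IsProbabilityMeasure ν]
    (hν : (transKernel μ).Invariant ν) {g : PState d → ℂ} (hg : IsHolder g) :
    ∃ f : PState d → ℂ, Continuous f ∧ SolvesPoisson μ ν g f := by
  obtain ⟨α, K, hα, hα1, hK, hgH⟩ := exists_holderBd_of_isHolder hg
  have hgc := hgH.continuous hα
  let g' : PState d →ᵇ ℂ := BoundedContinuousFunction.mkOfCompact ⟨g, hgc⟩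
  let G : PState d →ᵇ ℂ := BoundedContinuousFunction.mkOfCompact
    ⟨fun x => g x - ∫ y, g y ∂ν, hgc.sub continuous_const⟩
  have hGx : ∀ x, G x = g x - ∫ y, g y ∂ν := fun x => rfl
  have hG : HolderBd α K G := fun x y => by
    rw [hGx, hGx, sub_sub_sub_cancel_right]; exact hgH x y
  have hG0 : ∫ x, G x ∂ν = 0 := by
    simp_rw [hGx]
    have hi : Integrable g ν := g'.integrable ν
    rw [integral_sub hi (integrable_const _)]
    simp
  obtain ⟨f, hf⟩ := exists_poisson h hErg hPur hν hα hα1 hK hG hG0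
  refine ⟨f, f.continuous, fun x => ?_⟩
  rw [transOp_eq_avg f.continuous.measurable, ← hGx, ← hf]
  rfl

/-- The difference of two solutions is a continuous harmonic function. -/
lemma eq_add_const_of_solvesPoisson {μ : Measure (Op d)} [SigmaFinite μ] (h : IsStoch μ)
    (hErg : Erg μ) (hPur : Pur μ) {ν : Measure (PState d)} {g f₁ f₂ : PState d → ℂ}
    (hf₁ : Continuous f₁) (h₁ : SolvesPoisson μ ν g f₁) (hf₂ : Continuous f₂)
    (h₂ : SolvesPoisson μ ν g f₂) : ∃ c : ℂ, ∀ x, f₁ x = f₂ x + c := by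
  have hc : Continuous fun x => (-1) * f₂ x := continuous_const.mul hf₂
  have hharm : avg μ (fun x => f₁ x + (-1) * f₂ x) = fun x => f₁ x + (-1) * f₂ x := by
    funext x
    have h1 := h₁ x
    have h2 := h₂ x
    rw [transOp_eq_avg hf₁.measurable] at h1
    rw [transOp_eq_avg hf₂.measurable] at h2
    rw [avg_add h hf₁ hc, avg_const_mul]
    linear_combination h2 - h1
  have hconst : ∀ x y, f₁ x + (-1) * f₂ x = f₁ y + (-1) * f₂ y :=
    eq_of_harmonic h hErg hPur (hf₁.add hc) hharm
  rcases isEmpty_or_nonempty (PState d) with he | ⟨⟨x₀⟩⟩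
  · exact ⟨0, fun x => (he.false x).elim⟩
  · refine ⟨f₁ x₀ + (-1) * f₂ x₀, fun x => ?_⟩
    linear_combination hconst x x₀

/-! ### The invariant probability measure -/

/-- (Erg) rules out `d = 0`, since it provides a nonzero subspace. -/
lemma Erg.nonempty {μ : Measure (Op d)} (hErg : Erg μ) : Nonempty (PState d) := by
  obtain ⟨E, hE, -⟩ := hErg
  obtain ⟨e, -, he0⟩ := Submodule.exists_mem_ne_zero_of_ne_bot hE.prop.1
  exact ⟨Projectivization.mk ℂ e he0⟩

/-- Closed sets form a generating π-system, and their indicators are limits of thickened indicators,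
which are Lipschitz. -/
lemma measure_eq_of_forall_holder {ν₁ ν₂ : Measure (PState d)} [IsProbabilityMeasure ν₁]
    [IsProbabilityMeasure ν₂] (h : ∀ g : PState d → ℂ, IsHolder g → ∫ x, g x ∂ν₁ = ∫ x, g x ∂ν₂) :
    ν₁ = ν₂ := by
  refine ext_of_generate_finite {s : Set (PState d) | IsClosed s} ?_ isPiSystem_isClosed ?_ (by simp)
  · rw [← borel_eq_generateFrom_isClosed]; rfl
  · intro F hF
    have hF' : IsClosed F := hF
    have hδ : ∀ n : ℕ, (0 : ℝ) < 1 / ((n : ℝ) + 1) := fun n => Nat.one_div_pos_of_nat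
    have h1 := tendsto_integral_thickenedIndicator_of_isClosed ν₁ hF' hδ
      tendsto_one_div_add_atTop_nhds_zero_nat
    have h2 := tendsto_integral_thickenedIndicator_of_isClosed ν₂ hF' hδ
      tendsto_one_div_add_atTop_nhds_zero_nat
    have h3 : ∀ n, ∫ x, (thickenedIndicator (hδ n) F x : ℝ) ∂ν₁ =
        ∫ x, (thickenedIndicator (hδ n) F x : ℝ) ∂ν₂ := by
      intro n
      have hH : IsHolder fun x : PState d => ((thickenedIndicator (hδ n) F x : ℝ) : ℂ) := by
        have hl := lipschitzWith_thickenedIndicator (hδ n) F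
        have hi : LipschitzWith 1 (fun t : ℝ≥0 => ((t : ℝ) : ℂ)) :=
          LipschitzWith.of_dist_le_mul fun a b => by
            rw [NNReal.coe_one, one_mul, Complex.dist_eq, ← Complex.ofReal_sub, Complex.norm_real,
              NNReal.dist_eq, Real.norm_eq_abs]
        have hc := hi.comp hl
        exact ⟨_, 1, one_pos, le_rfl, hc.holderWith⟩
      have h4 := h _ hH
      rw [integral_complex_ofReal, integral_complex_ofReal] at h4
      exact_mod_cast h4
    simp_rw [h3] at h1
    have h5 := tendsto_nhds_unique h1 h2
    exact (measureReal_eq_measureReal_iff).mp h5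

/-- Solve the Poisson equation centred by `ν₁` and integrate it against `ν₂`: the left side vanishes
by invariance, leaving equality of the integrals of `g`. -/
lemma invariant_unique {μ : Measure (Op d)} [SigmaFinite μ] (h : IsStoch μ) (hErg : Erg μ)
    (hPur : Pur μ) {ν₁ ν₂ : Measure (PState d)} [IsProbabilityMeasure ν₁]
    [IsProbabilityMeasure ν₂] (h₁ : (transKernel μ).Invariant ν₁)
    (h₂ : (transKernel μ).Invariant ν₂) : ν₁ = ν₂ := by
  refine measure_eq_of_forall_holder fun g hg => ?_
  obtain ⟨f, hf, hsol⟩ := exists_solvesPoisson h hErg hPur h₁ hg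
  obtain ⟨α, K, hα, -, -, hgH⟩ := exists_holderBd_of_isHolder hg
  have hint : ∀ {u : PState d → ℂ}, Continuous u → Integrable u ν₂ := fun {u} hu =>
    (BoundedContinuousFunction.mkOfCompact ⟨u, hu⟩).integrable ν₂
  have h3 : ∫ x, (f x - avg μ f x) ∂ν₂ = ∫ x, (g x - ∫ y, g y ∂ν₁) ∂ν₂ := by
    refine integral_congr_ae (Filter.Eventually.of_forall fun x => ?_)
    have := hsol x
    rwa [transOp_eq_avg hf.measurable] at this
  rw [integral_sub (hint hf) (hint (h.continuous_avg hf)), h.integral_avg h₂ hf, sub_self,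
    integral_sub (hint (hgH.continuous hα)) (integrable_const _)] at h3
  simp only [integral_const, probReal_univ, one_smul] at h3
  exact (sub_eq_zero.mp h3.symm).symm

lemma integral_transKernel {μ : Measure (Op d)} [SFinite μ] {f : PState d → ℂ}
    (hf : Measurable f) (x : PState d) : ∫ y, f y ∂(transKernel μ x) = avg μ f x :=
  congrFun (transOp_eq_avg hf) x

/-- Krylov–Bogoliubov: Cesàro averages of the laws `Π^k(x₀, ·)` on a compact space, with `Π`
preserving continuous functions. -/
lemma exists_invariant {μ : Measure (Op d)} [SigmaFinite μ] (h : IsStoch μ)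
    [Nonempty (PState d)] :
    ∃ ν : Measure (PState d), IsProbabilityMeasure ν ∧ (transKernel μ).Invariant ν := by
  obtain ⟨x₀⟩ := ‹Nonempty (PState d)›
  have hmk := fun n => (isStoch_powMeas h n).isMarkovKernel
  let κ : ℕ → Measure (PState d) := fun n => transKernel (powMeas μ n) x₀
  have hκ : ∀ n, IsProbabilityMeasure (κ n) := fun n => (hmk n).isProbabilityMeasure x₀
  let S : ℕ → Measure (PState d) := fun n =>
    ((n : ℝ≥0∞) + 1)⁻¹ • ∑ k ∈ Finset.range (n + 1), κ k
  have hS : ∀ n, IsProbabilityMeasure (S n) := fun n => ⟨by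
    simp only [S, Measure.smul_apply, Measure.finsetSum_apply, measure_univ, smul_eq_mul]
    simp only [Finset.sum_const, Finset.card_range, nsmul_eq_mul, mul_one]
    push_cast
    exact ENNReal.inv_mul_cancel (by simp) (by simp)⟩
  have hint : ∀ (f : PState d →ᵇ ℂ) (n : ℕ), ∫ x, f x ∂(S n) =
      ((n : ℂ) + 1)⁻¹ * ∑ k ∈ Finset.range (n + 1), avg (powMeas μ k) f x₀ := by
    intro f n
    simp only [S]
    rw [integral_smul_measure, integral_finsetSum_measure fun k _ => f.integrable (κ k)]
    simp only [κ, integral_transKernel f.continuous.measurable]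
    rw [Complex.real_smul]
    congr 1
    rw [ENNReal.toReal_inv, ENNReal.toReal_add (by simp) (by simp)]
    simp
  let P : ℕ → ProbabilityMeasure (PState d) := fun n => ⟨S n, hS n⟩
  -- A limit along a nonprincipal ultrafilter stands in for a convergent subsequence.
  obtain ⟨Q, -, hQ⟩ := isCompact_univ.ultrafilter_le_nhds
    ((Filter.hyperfilter ℕ).map P) (by simp)
  have hlim : Filter.Tendsto P (Filter.hyperfilter ℕ) (nhds Q) := hQ
  have hlimf : ∀ f : PState d →ᵇ ℂ, Filter.Tendsto (fun n => ∫ x, f x ∂(S n))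
      (Filter.hyperfilter ℕ) (nhds (∫ x, f x ∂(Q : Measure (PState d)))) :=
    fun f => (ProbabilityMeasure.tendsto_iff_forall_integral_rclike_tendsto ℂ).mp hlim f
  have hinv : ∀ f : PState d →ᵇ ℂ, ∫ x, avgCLM h f x ∂(Q : Measure (PState d)) =
      ∫ x, f x ∂(Q : Measure (PState d)) := by
    intro f
    have h1 := (hlimf (avgCLM h f)).sub (hlimf f)
    -- Applying `Π` shifts the Cesàro sum by one, so the difference telescopes to two boundary
    -- terms.
    have h2 : ∀ n : ℕ, ∫ x, avgCLM h f x ∂(S n) - ∫ x, f x ∂(S n) =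
        ((n : ℂ) + 1)⁻¹ * (avg (powMeas μ (n + 1)) f x₀ - avg (powMeas μ 0) f x₀) := by
      intro n
      rw [hint, hint, ← mul_sub, ← Finset.sum_sub_distrib, ← Finset.sum_range_sub fun k => avg (powMeas μ k) f x₀]
      congr 1
      refine Finset.sum_congr rfl fun k _ => ?_
      rw [coe_avgCLM, powMeas, (isStoch_powMeas h k).avg_mconv h f.continuous.measurable
        f.norm_coe_le_norm]
    have h3 : Filter.Tendsto (fun n : ℕ => ∫ x, avgCLM h f x ∂(S n) - ∫ x, f x ∂(S n))
        Filter.atTop (nhds 0) := by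
      have h4 : Filter.Tendsto (fun n : ℕ => 1 / ((n : ℝ) + 1) * (2 * ‖f‖)) Filter.atTop
          (nhds (0 * (2 * ‖f‖))) := tendsto_one_div_add_atTop_nhds_zero_nat.mul_const _
      rw [zero_mul] at h4
      refine squeeze_zero_norm (fun n => ?_) h4
      rw [h2, norm_mul]
      refine mul_le_mul (le_of_eq ?_) ?_ (norm_nonneg _) (by positivity)
      · rw [norm_inv, one_div]
        congr 1
        have : ((n : ℂ) + 1) = ((n + 1 : ℕ) : ℂ) := by push_cast; rfl
        rw [this, Complex.norm_natCast]; push_cast; rfl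
      · refine (norm_sub_le _ _).trans ?_
        have h5 := (isStoch_powMeas h (n + 1)).norm_avg_le f.norm_coe_le_norm x₀
        have h6 := (isStoch_powMeas h 0).norm_avg_le f.norm_coe_le_norm x₀
        linarith
    have h7 := tendsto_nhds_unique h1 (h3.mono_left Nat.hyperfilter_le_atTop)
    exact sub_eq_zero.mp h7
  refine ⟨Q, inferInstance, ?_⟩
  have hM := h.isMarkovKernel
  refine ext_of_forall_integral_eq_of_IsFiniteMeasure fun f => ?_
  let F : PState d →ᵇ ℂ := BoundedContinuousFunction.mkOfCompact
    ⟨fun x => (f x : ℂ), Complex.continuous_ofReal.comp f.continuous⟩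
  have h1 := hinv F
  have h2 : ∫ x, avgCLM h F x ∂(Q : Measure (PState d)) =
      ∫ x, F x ∂((Q : Measure (PState d)).bind (transKernel μ)) := by
    have hi : Integrable F ((Q : Measure (PState d)).bind (transKernel μ)) := F.integrable _
    rw [Measure.comp_eq_comp_const_apply] at hi ⊢
    rw [Kernel.integral_comp hi, Kernel.const_apply]
    simp_rw [integral_transKernel F.continuous.measurable]
    rfl
  rw [h2] at h1
  have h3 : ∀ x, F x = (f x : ℂ) := fun x => rfl
  simp_rw [h3] at h1
  rw [integral_complex_ofReal, integral_complex_ofReal] at h1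
  exact_mod_cast h1

/-! ### The path law -/

/-- The kernel giving the law `‖v x‖² dμ(v)` of the next operator. -/
def opKernel (μ : Measure (Op d)) [SFinite μ] : Kernel (PState d) (Op d) :=
  (Kernel.const (PState d) μ).withDensity fun x v => ‖v (unitRep x)‖ₑ ^ 2

lemma measurable_weight_uncurry :
    Measurable (Function.uncurry fun (x : PState d) (v : Op d) => ‖v (unitRep x)‖ₑ ^ 2) := by
  have h : Measurable fun p : PState d × Op d => (p.2, p.1) := measurable_swap
  have h2 := measurable_weight.comp h
  exact h2

lemma lintegral_opKernel (μ : Measure (Op d)) [SFinite μ] (x : PState d) {f : Op d → ℝ≥0∞}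
    (hf : Measurable f) :
    ∫⁻ v, f v ∂(opKernel μ x) = ∫⁻ v, ‖v (unitRep x)‖ₑ ^ 2 * f v ∂μ := by
  rw [opKernel, Kernel.withDensity_apply _ measurable_weight_uncurry, Kernel.const_apply,
    lintegral_withDensity_eq_lintegral_mul _
      ((continuous_apply_vec _).measurable.enorm.pow_const 2) hf]
  rfl

lemma IsStoch.isMarkovKernel_opKernel {μ : Measure (Op d)} [SFinite μ] (h : IsStoch μ) :
    IsMarkovKernel (opKernel μ) := by
  refine ⟨fun x => ⟨?_⟩⟩
  have := lintegral_opKernel μ x (f := fun _ => 1) measurable_const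
  simp only [lintegral_const, one_mul, mul_one] at this
  rw [this, h (unitRep x), ← ofReal_norm, norm_unitRep]
  simp

/-- The position reached from `x` after the operators `v_1, …, v_n`. -/
def endPt (n : ℕ) (q : PState d × (Fin n → Op d)) : PState d := act (prodW n q.2) q.1

lemma measurable_endPt (n : ℕ) : Measurable (endPt (d := d) n) :=
  measurable_act.comp (((measurable_prodW n).comp measurable_snd).prodMk measurable_fst)

/-- The law of the next operator given the first `n` ones. -/
def stepKernel (μ : Measure (Op d)) [SFinite μ] (n : ℕ) :
    Kernel (PState d × (Fin n → Op d)) (Op d) :=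
  (opKernel μ).comap (endPt n) (measurable_endPt n)

lemma IsStoch.isMarkovKernel_stepKernel {μ : Measure (Op d)} [SFinite μ] (h : IsStoch μ)
    (n : ℕ) : IsMarkovKernel (stepKernel μ n) := by
  have := h.isMarkovKernel_opKernel
  rw [stepKernel]; infer_instance

/-- The law of `(x, v_1, …, v_n)`. -/
def pathMeas (μ : Measure (Op d)) (ν : Measure (PState d)) (n : ℕ) :
    Measure (PState d × (Fin n → Op d)) :=
  (ν.prod (Measure.pi fun _ : Fin n => μ)).withDensity
    fun q => ‖prodW n q.2 (unitRep q.1)‖ₑ ^ 2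

lemma measurable_pathDensity (n : ℕ) : Measurable fun q : PState d × (Fin n → Op d) =>
    ‖prodW n q.2 (unitRep q.1)‖ₑ ^ 2 := by
  have h : Measurable fun q : PState d × (Fin n → Op d) => (prodW n q.2, q.1) :=
    ((measurable_prodW n).comp measurable_snd).prodMk measurable_fst
  have h2 := measurable_weight.comp h
  exact h2

/-- Append an operator to a finite path. -/
def snocPath (n : ℕ) (p : (PState d × (Fin n → Op d)) × Op d) : PState d × (Fin (n + 1) → Op d) :=
  (p.1.1, Fin.snoc (α := fun _ => Op d) p.1.2 p.2)

/-- Split off the last operator of a finite path. -/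
def unsnocPath (n : ℕ) (q : PState d × (Fin (n + 1) → Op d)) :
    (PState d × (Fin n → Op d)) × Op d :=
  ((q.1, fun i => q.2 i.castSucc), q.2 (Fin.last n))

lemma measurable_snocPath (n : ℕ) : Measurable (snocPath (d := d) n) := by
  refine (measurable_fst.comp measurable_fst).prodMk (measurable_pi_lambda _ fun i => ?_)
  refine Fin.lastCases ?_ (fun j => ?_) i
  · simpa using measurable_snd
  · simp only [Fin.snoc_castSucc]
    exact (measurable_pi_apply j).comp (measurable_snd.comp measurable_fst)

lemma measurable_unsnocPath (n : ℕ) : Measurable (unsnocPath (d := d) n) := by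
  unfold unsnocPath
  fun_prop

lemma unsnocPath_snocPath (n : ℕ) (p : (PState d × (Fin n → Op d)) × Op d) :
    unsnocPath n (snocPath n p) = p := by
  simp [unsnocPath, snocPath]

lemma prodW_snoc (n : ℕ) (w : Fin n → Op d) (v : Op d) :
    prodW (n + 1) (Fin.snoc (α := fun _ => Op d) w v) = v * prodW n w := by
  simp [prodW]

lemma enorm_apply_act_mul (v W : Op d) (x : PState d) :
    ‖W (unitRep x)‖ₑ ^ 2 * ‖v (unitRep (act W x))‖ₑ ^ 2 = ‖(v * W) (unitRep x)‖ₑ ^ 2 := by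
  rw [← mul_pow, ← ofReal_norm, ← ofReal_norm, ← ofReal_norm,
    ← ENNReal.ofReal_mul (norm_nonneg _), mul_comm, norm_apply_act_mul]

lemma lintegral_pi_succ (μ : Measure (Op d)) [SigmaFinite μ] (n : ℕ)
    {F : (Fin (n + 1) → Op d) → ℝ≥0∞} (hF : Measurable F) :
    ∫⁻ w, F w ∂(Measure.pi fun _ : Fin (n + 1) => μ) =
      ∫⁻ w, ∫⁻ v, F (Fin.snoc (α := fun _ => Op d) w v) ∂μ ∂(Measure.pi fun _ : Fin n => μ) := by
  have hmp := (measurePreserving_piFinSuccAbove (fun _ : Fin (n + 1) => μ) (Fin.last n)).symm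
  rw [← hmp.map_eq, lintegral_map hF hmp.measurable,
    lintegral_prod_symm (fun a : Op d × (Fin n → Op d) =>
      F ((MeasurableEquiv.piFinSuccAbove (fun _ => Op d) (Fin.last n)).symm a))
      (hF.comp hmp.measurable).aemeasurable]
  refine lintegral_congr fun w => lintegral_congr fun v => ?_
  congr 1
  simp [MeasurableEquiv.piFinSuccAbove, Fin.insertNthEquiv]

/-- The identity `‖vWx‖² = ‖Wx‖² ‖v x_n‖²` factors the density: the weighted measures form a Markov
chain although the product of the `μ`'s need not be finite. It also yields their total mass one and
their consistency. -/
lemma pathMeas_succ {μ : Measure (Op d)} [SigmaFinite μ] (h : IsStoch μ) {ν : Measure (PState d)}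
    [SFinite ν] (n : ℕ) :
    pathMeas μ ν (n + 1) = (pathMeas μ ν n ⊗ₘ stepKernel μ n).map (snocPath n) := by
  have hM := h.isMarkovKernel_stepKernel n
  have hS : SFinite (pathMeas μ ν n) := by rw [pathMeas]; infer_instance
  refine Measure.ext_of_lintegral _ fun F hF => ?_
  have hFs : Measurable fun p => F (snocPath n p) := hF.comp (measurable_snocPath n)
  rw [lintegral_map hF (measurable_snocPath n), Measure.lintegral_compProd hFs, pathMeas,
    lintegral_withDensity_eq_lintegral_mul _ (measurable_pathDensity _) hF,
    lintegral_prod _ ((measurable_pathDensity _).mul hF).aemeasurable, pathMeas,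
    lintegral_withDensity_eq_lintegral_mul _ (measurable_pathDensity _)
      hFs.lintegral_kernel_prod_right',
    lintegral_prod _ ((measurable_pathDensity _).mul
      hFs.lintegral_kernel_prod_right').aemeasurable]
  refine lintegral_congr fun x => ?_
  have hm : Measurable fun w : Fin (n + 1) → Op d =>
      ((fun q : PState d × (Fin (n + 1) → Op d) =>
        ‖prodW (n + 1) q.2 (unitRep q.1)‖ₑ ^ 2) * F) (x, w) :=
    ((measurable_pathDensity _).mul hF).comp measurable_prodMk_left
  rw [lintegral_pi_succ μ n hm]
  refine lintegral_congr fun w => ?_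
  have hFv : Measurable fun v : Op d => F (snocPath n ((x, w), v)) :=
    hFs.comp measurable_prodMk_left
  have hk : ∫⁻ v, F (snocPath n ((x, w), v)) ∂(stepKernel μ n (x, w)) =
      ∫⁻ v, ‖v (unitRep (act (prodW n w) x))‖ₑ ^ 2 * F (snocPath n ((x, w), v)) ∂μ :=
    lintegral_opKernel μ _ hFv
  simp only [Pi.mul_apply]
  rw [hk, ← lintegral_const_mul]
  · refine lintegral_congr fun v => ?_
    rw [prodW_snoc, ← mul_assoc, enorm_apply_act_mul]
    rfl
  · exact ((continuous_apply_vec _).measurable.enorm.pow_const 2).mul hFv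

lemma pathMeas_zero (μ : Measure (Op d)) (ν : Measure (PState d)) :
    pathMeas μ ν 0 = ν.prod (Measure.pi fun _ : Fin 0 => μ) := by
  rw [pathMeas]
  have : (fun q : PState d × (Fin 0 → Op d) => ‖prodW 0 q.2 (unitRep q.1)‖ₑ ^ 2) = 1 := by
    funext q
    change ‖unitRep q.1‖ₑ ^ 2 = 1
    rw [← ofReal_norm, norm_unitRep]; simp
  rw [this, withDensity_one]

lemma isProbabilityMeasure_pathMeas {μ : Measure (Op d)} [SigmaFinite μ] (h : IsStoch μ)
    (ν : Measure (PState d)) [IsProbabilityMeasure ν] (n : ℕ) :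
    IsProbabilityMeasure (pathMeas μ ν n) := by
  induction n with
  | zero =>
    rw [pathMeas_zero, Measure.pi_of_empty (fun _ : Fin 0 => μ) finZeroElim]
    infer_instance
  | succ n ih =>
    have hM := h.isMarkovKernel_stepKernel n
    rw [pathMeas_succ h]
    exact Measure.isProbabilityMeasure_map (measurable_snocPath n).aemeasurable

/-! ### Finite-dimensional marginals determine the path law. -/

lemma IsPathLaw.map_trunc {μ : Measure (Op d)} [SigmaFinite μ] {ν : Measure (PState d)}
    {P : Measure (Path d)} (hP : IsPathLaw μ ν P) (n : ℕ) :
    P.map (trunc n) = pathMeas μ ν n := by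
  have := hP.1
  have hp : IsProbabilityMeasure (P.map (trunc n)) :=
    Measure.isProbabilityMeasure_map (measurable_trunc n).aemeasurable
  refine Measure.ext_prod fun {s t} hs ht => ?_
  rw [Measure.map_apply (measurable_trunc n) (hs.prod ht), pathMeas,
    withDensity_apply _ (hs.prod ht)]
  exact hP.2 n s t hs ht

lemma isPathLaw_of_map_trunc {μ : Measure (Op d)} {ν : Measure (PState d)}
    {P : Measure (Path d)} [IsProbabilityMeasure P]
    (hP : ∀ n, P.map (trunc n) = pathMeas μ ν n) : IsPathLaw μ ν P := by
  refine ⟨inferInstance, fun n S A hS hA => ?_⟩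
  rw [← Measure.map_apply (measurable_trunc n) (hS.prod hA), hP, pathMeas,
    withDensity_apply _ (hS.prod hA)]

lemma iSup_filtJ : (⨆ n, (filtJ d n : MeasurableSpace (Path d))) =
    (inferInstance : MeasurableSpace (Path d)) := by
  refine le_antisymm (iSup_le fun n => (filtJ d).le n) ?_
  have h1 : Measurable[⨆ n, (filtJ d n : MeasurableSpace (Path d))] (fun p : Path d => p.1) :=
    (measurable_fst.comp (comap_measurable (trunc 0))).mono (le_iSup (fun n => filtJ d n) 0) le_rfl
  have h2 : ∀ i, Measurable[⨆ n, (filtJ d n : MeasurableSpace (Path d))]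
      (fun p : Path d => p.2 i) := fun i => by
    have h3 : Measurable fun q : PState d × (Fin (i + 1) → Op d) => q.2 (Fin.last i) := by
      fun_prop
    exact (h3.comp (comap_measurable (trunc (i + 1)))).mono
      (le_iSup (fun n => filtJ d n) (i + 1)) le_rfl
  have h3 : Measurable[⨆ n, (filtJ d n : MeasurableSpace (Path d))] (fun p : Path d => p.2) :=
    @measurable_pi_lambda _ _ _ (⨆ n, filtJ d n) _ _ h2
  exact sup_le h1.comap_le h3.comap_le

/-- The increasing union of the `filtJ d n` is a π-system of cylinders generating the product
`σ`-algebra. -/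
lemma measure_path_ext {P Q : Measure (Path d)} [IsProbabilityMeasure P] [IsProbabilityMeasure Q]
    (h : ∀ n, P.map (trunc n) = Q.map (trunc n)) : P = Q := by
  refine ext_of_generate_finite (⋃ n, {s | MeasurableSet[filtJ d n] s}) ?_ ?_ ?_ (by simp)
  · exact iSup_filtJ.symm.trans
      (MeasurableSpace.generateFrom_iUnion_measurableSet fun n => filtJ d n).symm
  · exact isPiSystem_iUnion_of_monotone _
      (fun n => @MeasurableSpace.isPiSystem_measurableSet _ (filtJ d n)) fun m n hmn => (filtJ d).mono hmn
  · intro s hs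
    obtain ⟨n, hn⟩ := Set.mem_iUnion.mp hs
    obtain ⟨B, hB, rfl⟩ := hn
    rw [← Measure.map_apply (measurable_trunc n) hB, h, Measure.map_apply (measurable_trunc n) hB]

lemma trunc_succ (n : ℕ) (p : Path d) : trunc (n + 1) p = snocPath n (trunc n p, p.2 n) := by
  refine Prod.ext rfl ?_
  funext i
  refine Fin.lastCases ?_ (fun j => ?_) i
  · simp [trunc, snocPath]
  · simp [trunc, snocPath]

/-- The coordinates of a path up to time `n`, in the format of the Ionescu–Tulcea theorem. -/
def histPath (n : ℕ) (y : (Finset.Iic n) → PState d × Op d) : PState d × (Fin n → Op d) :=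
  ((y ⟨0, by simp⟩).1, fun i => (y ⟨i + 1, by simp⟩).2)

lemma measurable_histPath (n : ℕ) : Measurable (histPath (d := d) n) := by
  unfold histPath
  fun_prop

/-- The path read off from a sequence of the Ionescu–Tulcea theorem. -/
def toPath (y : ℕ → PState d × Op d) : Path d := ((y 0).1, fun i => (y (i + 1)).2)

lemma measurable_toPath : Measurable (toPath (d := d)) := by
  unfold toPath
  fun_prop

lemma eq_pathMeas_zero {μ : Measure (Op d)} {ν : Measure (PState d)} [SFinite ν]
    {M : Measure (PState d × (Fin 0 → Op d))} (hM : M.map Prod.fst = ν) :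
    M = pathMeas μ ν 0 := by
  have hm : Measurable fun x : PState d => (x, (finZeroElim : Fin 0 → Op d)) :=
    measurable_prodMk_right
  rw [pathMeas_zero, Measure.pi_of_empty (fun _ : Fin 0 => μ) finZeroElim, Measure.prod_dirac,
    ← hM, Measure.map_map hm measurable_fst]
  conv_lhs => rw [← Measure.map_id (μ := M)]
  congr 1
  funext q
  exact Prod.ext rfl (Subsingleton.elim _ _)

lemma exists_isPathLaw {μ : Measure (Op d)} [SigmaFinite μ] (h : IsStoch μ)
    (ν : Measure (PState d)) [IsProbabilityMeasure ν] :
    ∃ P : Measure (Path d), IsPathLaw μ ν P := by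
  obtain ⟨x₀⟩ : Nonempty (PState d) := nonempty_of_isProbabilityMeasure ν
  have hdummy : Measurable fun v : Op d => (x₀, v) := measurable_prodMk_left
  have hMs := fun n => h.isMarkovKernel_stepKernel n
  -- A common state type `PState d × Op d` holds the initial point at time zero and the operators
  -- afterwards; the unused components are filled with `0` and `x₀`, and `toPath` forgets them.
  let κ : (n : ℕ) → Kernel ((Finset.Iic n) → PState d × Op d) (PState d × Op d) := fun n =>
    ((stepKernel μ n).comap (histPath n) (measurable_histPath n)).map fun v => (x₀, v)
  have hκ : ∀ n, IsMarkovKernel (κ n) := fun n => Kernel.IsMarkovKernel.map _ hdummy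
  have hinit : Measurable fun x : PState d => (x, (0 : Op d)) := measurable_prodMk_right
  let ν₀ : Measure (PState d × Op d) := ν.map fun x => (x, 0)
  have hν₀ : IsProbabilityMeasure ν₀ := Measure.isProbabilityMeasure_map hinit.aemeasurable
  let P₀ : Measure (ℕ → PState d × Op d) :=
    Kernel.trajMeasure (X := fun _ => PState d × Op d) ν₀ κ
  have hP₀ : IsProbabilityMeasure P₀ :=
    inferInstanceAs (IsProbabilityMeasure (Kernel.trajMeasure (X := fun _ => PState d × Op d) ν₀ κ))
  have hstep : ∀ n, P₀.map (fun y => (Preorder.frestrictLe n y, y (n + 1))) =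
      P₀.map (Preorder.frestrictLe n) ⊗ₘ κ n := fun n =>
    (Kernel.map_frestrictLe_trajMeasure_compProd_eq_map_trajMeasure
      (X := fun _ => PState d × Op d) (μ₀ := ν₀) (κ := κ)).symm
  let P : Measure (Path d) := P₀.map toPath
  have hP : IsProbabilityMeasure P := Measure.isProbabilityMeasure_map measurable_toPath.aemeasurable
  refine ⟨P, isPathLaw_of_map_trunc fun n => ?_⟩
  have htr : ∀ n, P.map (trunc n) = (P₀.map (Preorder.frestrictLe n)).map (histPath n) := fun n => by
    rw [Measure.map_map (measurable_trunc n) measurable_toPath,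
      Measure.map_map (measurable_histPath n) (Preorder.measurable_frestrictLe n)]
    rfl
  induction n with
  | zero =>
    refine eq_pathMeas_zero ?_
    have hev : Measurable fun y : (Finset.Iic 0) → PState d × Op d => (y ⟨0, by simp⟩).1 := by
      fun_prop
    have h0 : P₀.map (Preorder.frestrictLe 0) =
        ν₀.map (MeasurableEquiv.piUnique fun _ : Finset.Iic 0 => PState d × Op d).symm := by
      change (Kernel.trajMeasure (X := fun _ => PState d × Op d) ν₀ κ).map _ = _
      rw [Kernel.trajMeasure, Measure.map_comp _ _ (Preorder.measurable_frestrictLe 0),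
        Kernel.traj_map_frestrictLe, Kernel.partialTraj_self, Measure.id_comp]
    have hfst : (fun q : PState d × (Fin 0 → Op d) => q.1) ∘ histPath 0 =
        fun y : (Finset.Iic 0) → PState d × Op d => (y ⟨0, by simp⟩).1 := rfl
    rw [htr, Measure.map_map measurable_fst (measurable_histPath 0), h0,
      Measure.map_map (measurable_fst.comp (measurable_histPath 0)) (MeasurableEquiv.measurable _),
      Measure.map_map ((measurable_fst.comp (measurable_histPath 0)).comp
        (MeasurableEquiv.measurable _)) hinit]
    exact Measure.map_id
  | succ n ih =>
    have hG : Measurable fun z : ((Finset.Iic n) → PState d × Op d) × (PState d × Op d) =>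
        snocPath n (histPath n z.1, z.2.2) :=
      (measurable_snocPath n).comp (((measurable_histPath n).comp measurable_fst).prodMk
        (measurable_snd.comp measurable_snd))
    have h1 : P.map (trunc (n + 1)) =
        (P₀.map (fun y => (Preorder.frestrictLe n y, y (n + 1)))).map
          (fun z => snocPath n (histPath n z.1, z.2.2)) := by
      rw [Measure.map_map (measurable_trunc _) measurable_toPath, Measure.map_map hG
        (by fun_prop)]
      congr 1
      funext y
      exact trunc_succ n (toPath y)
    rw [h1, hstep, pathMeas_succ h, ← ih, htr]
    refine Measure.ext_of_lintegral _ fun F hF => ?_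
    have hFs : Measurable fun p => F (snocPath n p) := hF.comp (measurable_snocPath n)
    have hFG : Measurable fun z : ((Finset.Iic n) → PState d × Op d) × (PState d × Op d) =>
        F (snocPath n (histPath n z.1, z.2.2)) := hF.comp hG
    rw [lintegral_map hF hG, Measure.lintegral_compProd hFG, lintegral_map hF
      (measurable_snocPath n), Measure.lintegral_compProd hFs,
      lintegral_map hFs.lintegral_kernel_prod_right' (measurable_histPath n)]
    refine lintegral_congr fun y => ?_
    have hy : Measurable fun z : PState d × Op d => F (snocPath n (histPath n y, z.2)) :=
      hFG.comp measurable_prodMk_left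
    rw [Kernel.lintegral_map _ hdummy _ hy]
    rfl

/-! ### The martingale approximation -/

lemma traj_eq_endPt (n : ℕ) (p : Path d) : traj n p = endPt n (trunc n p) := rfl

lemma measurable_traj (n : ℕ) : Measurable (traj (d := d) n) :=
  (measurable_endPt n).comp (measurable_trunc n)

lemma measurable_traj_filtJ {k n : ℕ} (hkn : k ≤ n) : Measurable[filtJ d n] (traj (d := d) k) :=
  ((measurable_endPt k).comp (comap_measurable (trunc k))).mono ((filtJ d).mono hkn) le_rfl

lemma IsPathLaw.eq {μ : Measure (Op d)} [SigmaFinite μ] {ν : Measure (PState d)}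
    {P Q : Measure (Path d)} (hP : IsPathLaw μ ν P) (hQ : IsPathLaw μ ν Q) : P = Q := by
  have := hP.1
  have := hQ.1
  exact measure_path_ext fun n => by rw [hP.map_trunc, hQ.map_trunc]

/-- Identifies the conditional law of `v_{n+1}` given the first `n` operators as `stepKernel μ n`.
-/
lemma IsPathLaw.map_trunc_prodMk {μ : Measure (Op d)} [SigmaFinite μ] (h : IsStoch μ)
    {ν : Measure (PState d)} [SFinite ν] {P : Measure (Path d)} (hP : IsPathLaw μ ν P) (n : ℕ) :
    P.map (fun p => (trunc n p, p.2 n)) = pathMeas μ ν n ⊗ₘ stepKernel μ n := by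
  have h1 := hP.map_trunc (n + 1)
  rw [pathMeas_succ h] at h1
  have h2 := congrArg (Measure.map (unsnocPath n)) h1
  rw [Measure.map_map (measurable_unsnocPath n) (measurable_trunc _),
    Measure.map_map (measurable_unsnocPath n) (measurable_snocPath n)] at h2
  have h3 : unsnocPath (d := d) n ∘ snocPath n = id := funext (unsnocPath_snocPath n)
  rw [h3, Measure.map_id] at h2
  exact h2

lemma integral_opKernel (μ : Measure (Op d)) [SFinite μ] (x : PState d) (F : Op d → ℂ) :
    ∫ v, F v ∂(opKernel μ x) = ∫ v, ‖v (unitRep x)‖ ^ 2 • F v ∂μ := by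
  have hw : Measurable fun v : Op d => ‖v (unitRep x)‖ₑ ^ 2 :=
    (continuous_apply_vec _).measurable.enorm.pow_const 2
  have hlt : ∀ᵐ v ∂μ, ‖v (unitRep x)‖ₑ ^ 2 < ∞ :=
    Filter.Eventually.of_forall fun v => ENNReal.pow_lt_top enorm_lt_top
  rw [opKernel, Kernel.withDensity_apply _ measurable_weight_uncurry, Kernel.const_apply,
    integral_withDensity_eq_integral_toReal_smul hw hlt]
  refine integral_congr_ae (Filter.Eventually.of_forall fun v => ?_)
  simp

/-- The hypothesis is essential: once the product kills `x`, the default value of `act` freezes the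
trajectory at `x`, and the Markov property may fail there. -/
lemma integral_stepKernel (μ : Measure (Op d)) [SFinite μ] (f : PState d → ℂ) {n : ℕ}
    {q : PState d × (Fin n → Op d)} (hq : prodW n q.2 (unitRep q.1) ≠ 0) :
    ∫ v, f (endPt (n + 1) (snocPath n (q, v))) ∂(stepKernel μ n q) = avg μ f (endPt n q) := by
  have h1 : stepKernel μ n q = opKernel μ (endPt n q) := rfl
  rw [h1, integral_opKernel, avg]
  refine integral_congr_ae (Filter.Eventually.of_forall fun v => ?_)
  have h2 := norm_apply_act_mul v (prodW n q.2) q.1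
  have h3 : endPt (n + 1) (snocPath n (q, v)) = act (v * prodW n q.2) q.1 := by
    simp only [endPt, snocPath, prodW_snoc]
  by_cases hv : v (unitRep (endPt n q)) = 0
  · simp [wact, hv]
  · have h4 : (v * prodW n q.2) (unitRep q.1) ≠ 0 := by
      rw [← norm_ne_zero_iff, ← h2]
      exact mul_ne_zero (norm_ne_zero_iff.mpr hv) (norm_ne_zero_iff.mpr hq)
    simp only [wact]
    rw [h3, act_mul h4, endPt]

lemma ae_prodW_ne_zero (μ : Measure (Op d)) (ν : Measure (PState d)) (n : ℕ) :
    ∀ᵐ q ∂(pathMeas μ ν n), prodW n q.2 (unitRep q.1) ≠ 0 := by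
  rw [pathMeas, ae_withDensity_iff (measurable_pathDensity n)]
  refine Filter.Eventually.of_forall fun q hq h0 => hq ?_
  simp [h0]

lemma integrable_traj {P : Measure (Path d)} [IsProbabilityMeasure P] {f : PState d → ℂ}
    (hf : Continuous f) (n : ℕ) : Integrable (fun p => f (traj n p)) P := by
  obtain ⟨B, -, hB⟩ := exists_norm_le hf
  exact (integrable_const B).mono' (hf.measurable.comp (measurable_traj n)).aestronglyMeasurable
    (Filter.Eventually.of_forall fun p => hB _)

/-- The Markov property of the trajectory, tested on sets of the filtration. Paths whose product
kills `x` are negligible because the density vanishes on them. -/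
lemma IsPathLaw.setIntegral_traj_succ {μ : Measure (Op d)} [SigmaFinite μ] (h : IsStoch μ)
    {ν : Measure (PState d)} [IsProbabilityMeasure ν] {P : Measure (Path d)}
    (hP : IsPathLaw μ ν P) {f : PState d → ℂ} (hf : Continuous f) {n : ℕ} {s : Set (Path d)}
    (hs : MeasurableSet[filtJ d n] s) :
    ∫ p in s, f (traj (n + 1) p) ∂P = ∫ p in s, avg μ f (traj n p) ∂P := by
  have := hP.1
  have hM := h.isMarkovKernel_stepKernel n
  have hQ := isProbabilityMeasure_pathMeas h ν n
  have hQs : SFinite (pathMeas μ ν n) := inferInstanceAs (SFinite (Measure.withDensity _ _))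
  obtain ⟨A, hA, rfl⟩ := hs
  obtain ⟨B, -, hB⟩ := exists_norm_le hf
  have hpair : Measurable fun p : Path d => (trunc n p, p.2 n) :=
    (measurable_trunc n).prodMk ((measurable_pi_apply n).comp measurable_snd)
  have hF : Measurable fun z : (PState d × (Fin n → Op d)) × Op d =>
      f (endPt (n + 1) (snocPath n z)) :=
    hf.measurable.comp ((measurable_endPt (n + 1)).comp (measurable_snocPath n))
  have hG : Measurable fun q : PState d × (Fin n → Op d) => avg μ f (endPt n q) :=
    (h.continuous_avg hf).measurable.comp (measurable_endPt n)
  have h1 : ∫ p in trunc n ⁻¹' A, f (traj (n + 1) p) ∂P =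
      ∫ z in A ×ˢ Set.univ, f (endPt (n + 1) (snocPath n z)) ∂(pathMeas μ ν n ⊗ₘ stepKernel μ n) := by
    rw [← hP.map_trunc_prodMk h, setIntegral_map (hA.prod MeasurableSet.univ)
      hF.aestronglyMeasurable hpair.aemeasurable]
    have h2 : (fun p : Path d => (trunc n p, p.2 n)) ⁻¹' (A ×ˢ Set.univ) = trunc n ⁻¹' A := by
      ext p; simp
    rw [h2]
    refine integral_congr_ae (Filter.Eventually.of_forall fun p => ?_)
    simp only [traj_eq_endPt, trunc_succ]
  have h3 : ∫ p in trunc n ⁻¹' A, avg μ f (traj n p) ∂P =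
      ∫ q in A, avg μ f (endPt n q) ∂(pathMeas μ ν n) := by
    rw [← hP.map_trunc, setIntegral_map hA hG.aestronglyMeasurable
      (measurable_trunc n).aemeasurable]
    rfl
  have hint : Integrable (fun z => f (endPt (n + 1) (snocPath n z)))
      (pathMeas μ ν n ⊗ₘ stepKernel μ n) :=
    (integrable_const B).mono' hF.aestronglyMeasurable (Filter.Eventually.of_forall fun z => hB _)
  rw [h1, h3, Measure.setIntegral_compProd hA MeasurableSet.univ hint.integrableOn]
  refine integral_congr_ae (ae_restrict_of_ae ?_)
  filter_upwards [ae_prodW_ne_zero μ ν n] with q hq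
  rw [Measure.restrict_univ]
  exact integral_stepKernel μ f hq

lemma mart_succ (μ : Measure (Op d)) [SFinite μ] (f : PState d → ℂ) (n : ℕ) (p : Path d) :
    mart μ f (n + 1) p = mart μ f n p + (f (traj (n + 1) p) - transOp μ f (traj n p)) := by
  rw [mart, Finset.sum_Icc_succ_top (by omega)]
  rfl

lemma IsPathLaw.martingale_mart {μ : Measure (Op d)} [SigmaFinite μ] (h : IsStoch μ)
    {ν : Measure (PState d)} [IsProbabilityMeasure ν] {P : Measure (Path d)}
    (hP : IsPathLaw μ ν P) {f : PState d → ℂ} (hf : Continuous f) :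
    Martingale (mart μ f) (filtJ d) P := by
  have := hP.1
  have hT := transOp_eq_avg (μ := μ) hf.measurable
  have hint : ∀ n, Integrable (mart μ f n) P := fun n => by
    have : mart μ f n = fun p => ∑ k ∈ Finset.Icc 1 n,
        (f (traj k p) - avg μ f (traj (k - 1) p)) := by
      funext p; rw [mart, hT]
    rw [this]
    exact integrable_finsetSum _ fun k _ =>
      (integrable_traj hf k).sub (integrable_traj (h.continuous_avg hf) (k - 1))
  have hadp : StronglyAdapted (filtJ d) (mart μ f) := fun n => by
    refine Measurable.stronglyMeasurable ?_
    refine Finset.measurable_fun_sum _ fun k hk => ?_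
    rw [hT]
    have hk' := (Finset.mem_Icc.mp hk).2
    exact (hf.measurable.comp (measurable_traj_filtJ hk')).sub
      ((h.continuous_avg hf).measurable.comp
        (measurable_traj_filtJ ((Nat.sub_le _ _).trans hk')))
  refine martingale_of_setIntegral_eq_succ hadp hint fun n s hs => ?_
  have h1 := integrable_traj (P := P) hf (n + 1)
  have h2 := integrable_traj (P := P) (h.continuous_avg hf) n
  have h3 : Integrable (fun p => f (traj (n + 1) p) - avg μ f (traj n p)) P := h1.sub h2
  simp_rw [mart_succ, hT]
  rw [integral_add (hint n).integrableOn h3.integrableOn,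
    integral_sub h1.integrableOn h2.integrableOn, hP.setIntegral_traj_succ h hf hs, sub_self,
    add_zero]

lemma exists_norm_mart_succ_sub_le {μ : Measure (Op d)} [SFinite μ] (h : IsStoch μ)
    {f : PState d → ℂ} (hf : Continuous f) :
    ∃ C : ℝ, ∀ (n : ℕ) (p : Path d), ‖mart μ f (n + 1) p - mart μ f n p‖ ≤ C := by
  obtain ⟨B, -, hB⟩ := exists_norm_le hf
  refine ⟨B + B, fun n p => ?_⟩
  rw [mart_succ, add_sub_cancel_left, transOp_eq_avg hf.measurable]
  exact (norm_sub_le _ _).trans (add_le_add (hB _) (h.norm_avg_le hB _))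

/-- Substituting `f - Π f` for the centred `g` makes the `Π f` terms cancel and the rest telescope.
This holds on every path. -/
lemma empSum_sub_mart {μ : Measure (Op d)} [SFinite μ] {νinv : Measure (PState d)}
    {g f : PState d → ℂ} (hsol : SolvesPoisson μ νinv g f) (n : ℕ) (p : Path d) :
    empSum (fun x => g x - ∫ y, g y ∂νinv) n p - mart μ f n p = f (traj 0 p) - f (traj n p) := by
  induction n with
  | zero => simp [empSum, mart]
  | succ n ih =>
    have h1 : empSum (fun x => g x - ∫ y, g y ∂νinv) (n + 1) p =
        empSum (fun x => g x - ∫ y, g y ∂νinv) n p + (g (traj n p) - ∫ y, g y ∂νinv) := by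
      rw [empSum, Finset.sum_range_succ]; rfl
    rw [h1, mart_succ, ← hsol (traj n p)]
    linear_combination ih

lemma norm_sub_le_osc {f : PState d → ℂ} (hf : Continuous f) (x y : PState d) :
    ‖f x - f y‖ ≤ osc f := by
  obtain ⟨B, -, hB⟩ := exists_norm_le hf
  refine le_ciSup (f := fun q : PState d × PState d => ‖f q.1 - f q.2‖) ⟨B + B, ?_⟩ (x, y)
  rintro _ ⟨q, rfl⟩
  exact (norm_sub_le _ _).trans (add_le_add (hB _) (hB _))

lemma osc_le_two_mul_supNorm [Nonempty (PState d)] {f : PState d → ℂ} (hf : Continuous f) :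
    osc f ≤ 2 * supNorm f := by
  obtain ⟨B, -, hB⟩ := exists_norm_le hf
  have h1 : ∀ x, ‖f x‖ ≤ supNorm f := fun x =>
    le_ciSup (f := fun x : PState d => ‖f x‖) ⟨B, by rintro _ ⟨y, rfl⟩; exact hB y⟩ x
  refine ciSup_le fun q => ?_
  rw [two_mul]
  exact (norm_sub_le _ _).trans (add_le_add (h1 _) (h1 _))

end QuantumTrajectory

end

open QuantumTrajectory in
theorem proposition4p2 {d : ℕ} (μ : Measure (Op d)) [SigmaFinite μ]
    (hsq : ∫⁻ v, ‖v‖ₑ ^ 2 ∂μ < ∞) (hstoch : ∫ v, adj v * v ∂μ = 1)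
    (hErg : Erg μ) (hPur : Pur μ) :
    -- for every initial law `ν`, the law `ℙ_ν` exists and is unique
    (∀ ν : Measure (PState d), IsProbabilityMeasure ν → ∃! P : Measure (Path d), IsPathLaw μ ν P) ∧
    -- the invariant probability measure exists and is unique
    (∃! νinv : Measure (PState d),
      IsProbabilityMeasure νinv ∧ (transKernel μ).Invariant νinv) ∧
    ∀ νinv : Measure (PState d), IsProbabilityMeasure νinv → (transKernel μ).Invariant νinv →
    ∀ g : PState d → ℂ, IsHolder g →
      -- existence of a continuous solution
      (∃ f : PState d → ℂ, Continuous f ∧ SolvesPoisson μ νinv g f) ∧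
      -- uniqueness up to an additive constant
      (∀ f₁ f₂ : PState d → ℂ, Continuous f₁ → SolvesPoisson μ νinv g f₁ →
        Continuous f₂ → SolvesPoisson μ νinv g f₂ → ∃ c : ℂ, ∀ x, f₁ x = f₂ x + c) ∧
      -- martingale approximation
      (∀ f : PState d → ℂ, Continuous f → SolvesPoisson μ νinv g f →
        osc f ≤ 2 * supNorm f ∧
        (∃ C : ℝ, ∀ (n : ℕ) (p : Path d), ‖mart μ f (n + 1) p - mart μ f n p‖ ≤ C) ∧
        ∀ (ν : Measure (PState d)) (P : Measure (Path d)), IsProbabilityMeasure ν →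
          IsPathLaw μ ν P →
          Martingale (mart μ f) (filtJ d) P ∧
          ∀ᵐ p ∂P, ∀ n : ℕ,
            ‖empSum (fun x => g x - ∫ y, g y ∂νinv) n p - mart μ f n p‖ ≤ osc f) := by
  have h : IsStoch μ := isStoch_of_integral hsq hstoch
  have hne := hErg.nonempty
  refine ⟨fun ν hν => ?_, ?_, fun νinv hp hinv g hg => ⟨?_, ?_, ?_⟩⟩
  · obtain ⟨P, hP⟩ := exists_isPathLaw h ν
    exact ⟨P, hP, fun Q hQ => hQ.eq hP⟩
  · obtain ⟨ν, hν, hinv⟩ := exists_invariant h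
    refine ⟨ν, ⟨hν, hinv⟩, ?_⟩
    rintro ν' ⟨hν', hinv'⟩
    exact invariant_unique h hErg hPur hinv' hinv
  · exact exists_solvesPoisson h hErg hPur hinv hg
  · exact fun f₁ f₂ hf₁ h₁ hf₂ h₂ => eq_add_const_of_solvesPoisson h hErg hPur hf₁ h₁ hf₂ h₂
  · intro f hf hsol
    refine ⟨osc_le_two_mul_supNorm hf, exists_norm_mart_succ_sub_le h hf, fun ν P hν hP =>
      ⟨hP.martingale_mart h hf, Filter.Eventually.of_forall fun p n => ?_⟩⟩
    rw [empSum_sub_mart hsol]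
    exact norm_sub_le_osc hf _ _
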